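/- **Theorem (LG/CY correspondence).** *Setup.* Let $E=\{x_0^3+x_1^3+x_2^3=0\}\subset\mathbb P^2$, let $G=(\mathbb C^*)^4\ni(t_x,t_y,t_z,t_a)$ act on $\mathbb C^{13}$ with weights $t_vt_a^{-1},t_v,t_v$ on $v_0,v_1,v_2$ ($v\in\{x,y,z\}$), $t_a^3$ on $a$ and $t_v^{-3}$ on $p_v$, and let $W=\sum_v p_v(av_0^3+v_1^3+v_2^3)$. A phase $\theta$ is given by a set $S\subseteq\{x,y,z\}$ of subscript variables (the others are superscript): its semistable locus is $a\ne0$, $(v_0,v_1,v_2)\neq0$ for $v\notin S$, $p_v\ne0$ for $v\in S$, and $Z(\theta)$ is the quotient by $G$ of the semistable critical points of $W$. For $S=\emptyset$ this is $[E^3/\mu_3]$; for $S=\{x,y,z\}$ it is $B(\mu_3^4)$. *State space.* Let $\zeta=e^{2\pi i/3}$. The narrow sectors are indexed by the $\gamma=(\zeta^{g_x},\zeta^{g_y},\zeta^{g_z},\zeta^{g_a})\in G$ which, for each $v\in S$, fix none of the coordinates $v_0,v_1,v_2$ and, for each $v\notin S$, fix at least two of them (equivalently, the fixed locus in $\mathbb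 P^2$ meets $E$). The ambient narrow state space $H(\theta)$ has the basis $\prod_{v\in e}H_v\cdot 1_\gamma$, where $\gamma$ is a narrow sector and $e$ is a set of variables $v\notin S$ such that $\gamma$ fixes all of $v_0,v_1,v_2$. Here $H_v^2=0$, $H_v1_\gamma=0$ for a variable $v\notin S$ such that $\gamma$ does not fix all of $v_0,v_1,v_2$, and $H_v=0$ for $v\in S$. *The $I$-function.* Let $\hbar\in\mathbb C^*$, $D_v=H_v$ for $v\notin S$ and $D_v=0$ for $v\in S$. Let $\beta=(\beta_x,\beta_y,\beta_z,\beta_a)$ range over $(\frac13\mathbb Z)^4$ with $\beta_a\ge0$, $\beta_v\ge0$ for $v\notin S$, and $\beta_v<0$ for $v\in S$. For a class $D$ and $d\in\frac13\mathbb Z$ put $$M(D,d)=\prod_{0\le\nu\le\lceil d\rceil-1}(D+(d-\nu)\hbar)^{-1}\ (d\ge0),\qquad M(D,d)=\prod_{\lfloor d\rfloor+1\le\nu\le-1}(D+(d-\nu)\hbar)\ (d<0),$$ the products being over integers $\nu$. Let $A_v=D_v$ if $0\le\beta_v<\beta_a$ and $\beta_v-\beta_a\in\mathbb Z$, and $A_v=1$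 otherwise. Then $$I^{\theta,\mathrm{Giv}}(q,\hbar)=\sum_\beta q_a^{\beta_a}M(0,3\beta_a)\prod_{v}\Big(q_v^{\beta_v+D_v/\hbar}(-1)^{3\beta_v}A_v\,M(D_v,\beta_v-\beta_a)M(D_v,\beta_v)^2M(-3D_v,-3\beta_v-1)\Big)1_{\langle-\beta\rangle},$$ where $1_{\langle-\beta\rangle}=1_\gamma$ for $\gamma=(e^{-2\pi i\beta_x},e^{-2\pi i\beta_y},e^{-2\pi i\beta_z},e^{-2\pi i\beta_a})$, which is $0$ if $\gamma$ is not a narrow sector. It is regarded as a function of $\log q_x,\log q_y,\log q_z,\log q_a$. The chamber of $\theta$ is $|q_v|<3^{-3}$ for $v\notin S$ and $|q_v|>3^{-3}$ for $v\in S$. *The transformation.* For a superscript variable $v$ of $\theta$, let $\theta'$ be the phase with subscript set $S\cup\{v\}$. Let $M_v:H(\theta')\to H(\theta)$ be the linear map which sends a basis vector with $v$-exponent $g_v=j$ to $\hbar^{\delta}\,C$ times the basis vector with $v$-exponent $0$ and all other labels the same, where, with $r=\langle -j/3\rangle$ and $f=\langle -g_a/3\rangle$ (fractional parts), $$C=\frac{2\pi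 i}{3\,(e^{2\pi i(r-H_v/\hbar)}-1)}\cdot\frac{\Gamma(1-f+H_v/\hbar)\,\Gamma(1+H_v/\hbar)^2}{\Gamma(1+3H_v/\hbar)\,\Gamma(\langle r-f\rangle)\,\Gamma(r)^2}$$ is expanded to first order in $H_v$, and $\delta=1$ if $j=2$ and $g_a=0$, $\delta=0$ otherwise. *Claim.* For every $\hbar\in\mathbb C^*$: 1. For every $\theta$ and every superscript variable $v$ of $\theta$, the map $M_v$ is invertible; write $U_v=M_v^{-1}:H(\theta)\to H(\theta')$. The series $I^{\theta,\mathrm{Giv}}$ converges absolutely in the chamber of $\theta$, with $0<\arg q_v<2\pi$, for $|q_a|$ small (locally uniformly in the other variables). It has an analytic continuation $F$ to a connected open set of $(\log q_x,\log q_y,\log q_z,\log q_a)$ which contains all points with $0<\arg q_v<2\pi$, with $|q_w|<3^{-3}$ for the superscript and $|q_w|>3^{-3}$ for the subscript variables $w\neq v$ of $\theta$, and with $|q_a|$ small (locally uniformly in the other variables). In the chamber of $\theta'$, for $0<\arg q_v<2\pi$ and $|q_a|$ small (locally uniformly), the series $I^{\theta',\mathrm{Giv}}$ converges absolutely and $U_v(F)=I^{\theta',\mathrm{Giv}}$.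 2. The composite $U_xU_yU_z$ of the three wall-crossings through $S=\emptyset,\{z\},\{y,z\},\{x,y,z\}$ relates in the same way the $I$-function of $[E^3/\mu_3]$ (Gromov–Witten phase) and the $I$-function of the phase $S=\{x,y,z\}$ (Fan–Jarvis–Ruan–Witten type): the former has an analytic continuation $F$ to a connected open set containing all points with $0<\arg q_x,\arg q_y,\arg q_z<2\pi$ and $|q_a|$ small (locally uniformly in the other variables), and $U_xU_yU_z(F)$ is the latter where $|q_x|,|q_y|,|q_z|>3^{-3}$ and $|q_a|$ is small (locally uniformly). -/

import Mathlib

open scoped DualNumber Topology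

noncomputable section

namespace LGCY

/-!
The toroidal orbifold `[E³/μ₃]` and its phases.  The three variables `x, y, z` are the elements
`0, 1, 2` of `Fin 3`.  The group `G = (ℂˣ)⁴ ∋ (t_x, t_y, t_z, t_a)` acts on `V = ℂ¹³`, with weights
`t_v / t_a, t_v, t_v` on the coordinates `v_0, v_1, v_2` (for `v = x, y, z`), weight `t_a ^ 3` on `a`
and weight `t_v ^ (-3)` on `p_v`.  The superpotential is `W = ∑ v, p_v (a v_0³ + v_1³ + v_2³)`.

A character `θ` (with `a` a superscript variable) is recorded by the finset `s : Finset (Fin 3)` of its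
subscript variables: `∅` is `θ^{xyza}` and `{0, 1, 2}` is `θ_{xyz}^a`.  The semistable locus is: `a ≠ 0`,
`(v_0, v_1, v_2) ≠ 0` for `v ∉ s`, and `p_v ≠ 0` for `v ∈ s`.  So the factor of the critical locus
`Z(θ)` in the direction `v` is the cubic curve `E` for `v ∉ s` and `Bμ₃` for `v ∈ s`.
-/

/-! ### Sectors and the state space -/

/-- The stabilizer elements are `(t_x, t_y, t_z, t_a) = (ζ ^ g_x, ζ ^ g_y, ζ ^ g_z, ζ ^ g_a)`,
`ζ = exp (2πi / 3)`.  Such a group element is encoded by its exponents `(g, g_a)`. -/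
abbrev GroupElt : Type := (Fin 3 → ZMod 3) × ZMod 3

/-- The exponent of `ζ` by which `γ` multiplies the coordinate `v_i`. -/
def coordWeight (γ : GroupElt) (v i : Fin 3) : ZMod 3 :=
  if i = 0 then γ.1 v - γ.2 else γ.1 v

/-- The number of coordinates among `v_0, v_1, v_2` which are fixed by `γ`. -/
def fixedCount (γ : GroupElt) (v : Fin 3) : ℕ :=
  (Finset.univ.filter fun i : Fin 3 => coordWeight γ v i = 0).card

/-- `γ` gives a narrow sector meeting `Z(θ)`.
For a subscript variable, narrowness says that `γ` fixes none of the three coordinates of `[ℂ³/μ₃]`.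
For a superscript variable, the locus in `ℙ²` cut out by the vanishing of the coordinates which `γ`
moves has to meet the curve `E`: a line (two fixed coordinates) and the whole plane do; the only
possible single fixed coordinate is `v_0`, and the point `[1 : 0 : 0]` is not on `E`. -/
def IsSector (s : Finset (Fin 3)) (γ : GroupElt) : Prop :=
  ∀ v, if v ∈ s then fixedCount γ v = 0 else 2 ≤ fixedCount γ v

instance (s : Finset (Fin 3)) : DecidablePred (IsSector s) := fun γ => by
  unfold IsSector; infer_instance

/-- Labels `(γ, e)` of the basis `(∏_{v ∈ e} H_v) · 1_γ` of the ambient narrow state space.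
On the `γ`-twisted sector the factor in the direction of a superscript variable `v` is the curve `E`
if `γ` fixes all three coordinates, with ambient classes `1, H_v` (`H_v ^ 2 = 0`), and a finite set of
points if `γ` fixes two, where `H_v` restricts to `0`.  In the direction of a subscript variable
`H_v = 0`. -/
def IsBasisLabel (s : Finset (Fin 3)) (b : GroupElt × Finset (Fin 3)) : Prop :=
  IsSector s b.1 ∧ ∀ v ∈ b.2, v ∉ s ∧ fixedCount b.1 v = 3

instance (s : Finset (Fin 3)) : DecidablePred (IsBasisLabel s) := fun b => by
  unfold IsBasisLabel; infer_instance

/-- The index set of the standard basis of `H(θ)`. -/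
abbrev BasisLabel (s : Finset (Fin 3)) : Type :=
  {b : GroupElt × Finset (Fin 3) // IsBasisLabel s b}

/-- The ambient narrow (compact type) state space `H(θ)`: vectors of coordinates with respect to the
basis `(∏_{v ∈ e} H_v) · 1_γ`. -/
abbrev StateSpace (s : Finset (Fin 3)) : Type := BasisLabel s → ℂ

/-- For `A = a₀ + a₁ ε`, with `ε` standing for `H_v`: the coefficient of `1` (if `v ∉ e`) or of `H_v`
(if `v ∈ e`). -/
def coeffAt (e : Finset (Fin 3)) (v : Fin 3) (A : ℂ[ε]) : ℂ :=
  if v ∈ e then A.snd else A.fst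

/-! ### The I-function

A degree is `β = (n, k) : (Fin 3 → ℤ) × ℤ`, standing for `β_v = n v / 3` and `β_a = k / 3`.  The
parameters are logarithmic: `t = (b, c) : (Fin 3 → ℂ) × ℂ` stands for `q_v = exp (b v)`,
`q_a = exp c`. -/

/-- Necessary conditions for a one-pointed degree to be `θ`-effective: `β_a ≥ 0`, `β_v ≥ 0` for
superscript variables and `β_v ≤ -1/3` for subscript variables. -/
def Effective (s : Finset (Fin 3)) (β : (Fin 3 → ℤ) × ℤ) : Prop :=
  0 ≤ β.2 ∧ ∀ v, if v ∈ s then β.1 v ≤ -1 else 0 ≤ β.1 v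

/-- The group element `⟨-β⟩`. -/
def negMonodromy (β : (Fin 3 → ℤ) × ℤ) : GroupElt :=
  (fun v => ((-β.1 v : ℤ) : ZMod 3), ((-β.2 : ℤ) : ZMod 3))

/-- The hypergeometric factor of a character `ρ` with divisor `D = D_ρ` and degree `d = β_ρ`:
`1 / ∏_{0 ≤ ν ≤ ⌈d⌉ - 1} (D + (d - ν) ħ)` if `d ≥ 0`, and `∏_{⌊d⌋ + 1 ≤ ν ≤ -1} (D + (d - ν) ħ)` if
`d < 0` (an empty product for `-1 ≤ d < 0`). -/
def hyperFactor (hbar : ℂ) (D : ℂ[ε]) (d : ℚ) : ℂ[ε] :=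
  if 0 ≤ d then
    (∏ ν ∈ Finset.Icc (0 : ℤ) (⌈d⌉ - 1), (D + TrivSqZeroExt.inl (((d - ν : ℚ) : ℂ) * hbar)))⁻¹
  else
    ∏ ν ∈ Finset.Icc (⌊d⌋ + 1) (-1), (D + TrivSqZeroExt.inl (((d - ν : ℚ) : ℂ) * hbar))

/-- The toric divisor `D_v = H_v` for a superscript variable, `0` for a subscript variable. -/
def divisor (s : Finset (Fin 3)) (v : Fin 3) : ℂ[ε] := if v ∈ s then 0 else ε

/-- The class `A_v`: it is `D_v` if `0 ≤ β_v < β_a` and `β_v - β_a ∈ ℤ`, and `1` otherwise. -/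
def excessClass (s : Finset (Fin 3)) (v : Fin 3) (β : (Fin 3 → ℤ) × ℤ) : ℂ[ε] :=
  if 0 ≤ β.1 v ∧ β.1 v < β.2 ∧ (3 : ℤ) ∣ β.1 v - β.2 then divisor s v else 1

/-- The contribution of the variable `v` to the coefficient of degree `β` of the `I`-function:
`q_v ^ (β_v + D_v / ħ) (-1) ^ (3 β_v) A_v` times the hypergeometric factors of the four characters
`v_0, v_1, v_2, p_v`, whose degrees are `β_v - β_a, β_v, β_v, -3 β_v - 1` and whose divisors are
`D_v, D_v, D_v, -3 D_v`.  Here `q_v ^ (D_v / ħ) = exp (b_v D_v / ħ) = 1 + (b_v / ħ) D_v`. -/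
def varFactor (s : Finset (Fin 3)) (hbar : ℂ) (v : Fin 3) (bv : ℂ) (β : (Fin 3 → ℤ) × ℤ) : ℂ[ε] :=
  let D := divisor s v
  let βv : ℚ := (β.1 v : ℚ) / 3
  let βa : ℚ := (β.2 : ℚ) / 3
  TrivSqZeroExt.inl (Complex.exp ((βv : ℂ) * bv)) * (1 + (bv / hbar) • D)
    * (-1) ^ (β.1 v).natAbs * excessClass s v β
    * hyperFactor hbar D (βv - βa) * hyperFactor hbar D βv ^ 2
    * hyperFactor hbar (-3 * D) (-3 * βv - 1)

/-- The contribution of `a`: `q_a ^ β_a / ∏_{0 ≤ ν ≤ 3 β_a - 1} (3 β_a - ν) ħ`. -/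
def aFactor (hbar c : ℂ) (β : (Fin 3 → ℤ) × ℤ) : ℂ :=
  Complex.exp ((((β.2 : ℚ) / 3 : ℚ) : ℂ) * c) * (hyperFactor hbar 0 (β.2 : ℚ)).fst

/-- The term of degree `β` of the small Givental `I`-function `I^{θ,Giv}(q, ħ)`: the class
`aFactor · ∏ v, varFactor · 1_{⟨-β⟩}` in `H(θ)`. -/
def ITerm (s : Finset (Fin 3)) (hbar : ℂ) (t : (Fin 3 → ℂ) × ℂ) (β : (Fin 3 → ℤ) × ℤ) :
    StateSpace s := fun b =>
  if b.1.1 = negMonodromy β then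
    aFactor hbar t.2 β * ∏ v, coeffAt b.1.2 v (varFactor s hbar v (t.1 v) β)
  else 0

/-- The series `I^{θ,Giv}` converges (absolutely) at `t`, with value `y`. -/
def HasIValue (s : Finset (Fin 3)) (hbar : ℂ) (t : (Fin 3 → ℂ) × ℂ) (y : StateSpace s) : Prop :=
  HasSum (fun β : {β : (Fin 3 → ℤ) × ℤ // Effective s β} => ITerm s hbar t β.1) y

/-! ### The transformation between the state spaces -/

/-- The extension of `f` to the dual numbers by Taylor expansion, `f (x + y ε) = f x + f' x y ε`. -/
def dualExt (f : ℂ → ℂ) (A : ℂ[ε]) : ℂ[ε] :=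
  TrivSqZeroExt.inl (f A.fst) + TrivSqZeroExt.inr (deriv f A.fst * A.snd)

/-- The representative in `{0, 1/3, 2/3}` of `-j / 3` modulo `1`; this is `⟨β_v⟩` if `⟨-β⟩` has
`v`-exponent `j`. -/
def fracOf (j : ZMod 3) : ℚ := Int.fract (-(j.val : ℚ) / 3)

/-- With `r = ⟨β_v⟩`, `f = ⟨β_a⟩` and `H = H_v / ħ`:
`2πi / (3 (exp (2πi (r - H)) - 1)) · Γ(1 - f + H) Γ(1 + H)² / (Γ(1 + 3H) Γ(⟨r - f⟩) Γ(r)²)`. -/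
def gammaCoeff (hbar : ℂ) (r f : ℚ) : ℂ[ε] :=
  let H : ℂ[ε] := hbar⁻¹ • ε
  let c : ℂ → ℂ[ε] := TrivSqZeroExt.inl
  c (2 * Real.pi * Complex.I / 3)
    * (dualExt Complex.exp (c (2 * Real.pi * Complex.I) * (c (r : ℂ) - H)) - 1)⁻¹
    * (dualExt Complex.Gamma (c (1 - (f : ℂ)) + H) * dualExt Complex.Gamma (1 + H) ^ 2)
    * (dualExt Complex.Gamma (1 + 3 * H)
        * c (Complex.Gamma ((Int.fract (r - f) : ℚ) : ℂ) * Complex.Gamma (r : ℂ) ^ 2))⁻¹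

/-- The entry of the wall-crossing map: `gammaCoeff`, times the power of `ħ` which makes the map
homogeneous (`deg ħ = 2`). -/
def wallCoeff (hbar : ℂ) (j ga : ZMod 3) : ℂ[ε] :=
  (if j = 2 ∧ ga = 0 then hbar else 1) • gammaCoeff hbar (fracOf j) (fracOf ga)

/-- The explicit linear map `H(θ') → H(θ)`, where `θ'` is obtained from `θ` by moving `v` to the
subscript.  With `C = C₀ + C₁ H_v = wallCoeff ħ j g_a`, it sends a basis vector of `H(θ')` with
`v`-exponent `j` and `a`-exponent `g_a` to `C₀` times the basis vector of `H(θ)` with `v`-exponent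
`0` and all other labels unchanged, plus (on the sectors where `H_v ≠ 0`, that is `g_a = 0`) `C₁` times
the product of the latter with `H_v`. -/
def wallMap (s : Finset (Fin 3)) (v : Fin 3) (hbar : ℂ) :
    StateSpace (insert v s) →ₗ[ℂ] StateSpace s :=
  Matrix.mulVecLin (Matrix.of fun (b : BasisLabel s) (b' : BasisLabel (insert v s)) =>
    if b.1.1 = (Function.update b'.1.1.1 v 0, b'.1.1.2) ∧ b.1.2.erase v = b'.1.2 then
      coeffAt b.1.2 v (wallCoeff hbar (b'.1.1.1 v) b'.1.1.2)
    else 0)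

/-! ### Analytic continuation -/

/-- `b` lies in the chamber of `θ` in the direction `v`: `|q_v| < 3 ^ (-3)` if `v` is a superscript
variable and `|q_v| > 3 ^ (-3)` if it is a subscript variable. -/
def InChamber (s : Finset (Fin 3)) (v : Fin 3) (b : Fin 3 → ℂ) : Prop :=
  if v ∈ s then -(3 * Real.log 3) < (b v).re else (b v).re < -(3 * Real.log 3)

/-- The domain of the continuation from `θ` to `θ'` (subscript variables `s ⊆ s'`) in the variables
`log q_x, log q_y, log q_z`: the variables which move range over the strip `0 < arg q_v < 2π`, the
others over their half plane `InChamber`. -/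
def corridor (s s' : Finset (Fin 3)) : Set (Fin 3 → ℂ) :=
  {b | ∀ v, if v ∈ s' \ s then 0 < (b v).im ∧ (b v).im < 2 * Real.pi else InChamber s v b}

/-- The property `P` of `t = (b, c)` holds whenever `|q_a| = exp (Re c)` is small enough, locally
uniformly in `b` near `b₀`. -/
def ForSmallQa (b₀ : Fin 3 → ℂ) (P : (Fin 3 → ℂ) × ℂ → Prop) : Prop :=
  ∃ R : ℝ, ∀ᶠ b in 𝓝 b₀, ∀ c : ℂ, c.re < R → P (b, c)

/-- The series `I^{θ,Giv}` converges in the chamber of `θ` for small `q_a`, and has an analytic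
continuation `F` to a connected domain which lies over the whole corridor from `θ` to `θ'`, such that
`U ∘ F` is the sum of the convergent series `I^{θ',Giv}` in the chamber of `θ'` for small `q_a`. -/
def ContinuesTo (s s' : Finset (Fin 3)) (hbar : ℂ) (U : StateSpace s ≃ₗ[ℂ] StateSpace s') : Prop :=
  ∃ (Ω : Set ((Fin 3 → ℂ) × ℂ)) (F : (Fin 3 → ℂ) × ℂ → StateSpace s),
    IsOpen Ω ∧ IsPreconnected Ω ∧ DifferentiableOn ℂ F Ω ∧
    (∀ b₀ ∈ corridor s s', ForSmallQa b₀ fun t => t ∈ Ω) ∧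
    (∀ b₀ ∈ corridor s s', (∀ v, InChamber s v b₀) →
      ForSmallQa b₀ fun t => HasIValue s hbar t (F t)) ∧
    (∀ b₀ ∈ corridor s s', (∀ v, InChamber s' v b₀) →
      ForSmallQa b₀ fun t => HasIValue s' hbar t (U (F t)))

end LGCY

end

noncomputable section

namespace LGCY

/-! ### Recursions for the hypergeometric factors -/

section

/-! Fix a basis label $(\gamma,e)$. The degrees with $\langle-\beta\rangle=\gamma$ are
$\beta_a=k/3+l$, with $k\in\{0,1,2\}$ determined by $g_a$ and $l\ge 0$, together with one natural
number $m$ for each variable. For fixed $l$ the terms factor over $x,y,z$, so the component of $I$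
is $\sum_l a_l(q_a)\prod_v\Phi_{v,l}(\log q_v)$. Raising $\beta_a$ by one multiplies the $v$-factor
by $D_v+(\beta_v-\beta_a)\hbar$, and $\hbar\,d/d\log q_v$ acts on $q_v^{\beta_v+D_v/\hbar}$ as
$D_v+\beta_v\hbar$. Hence $\Phi_{v,l}$ arises from $\Phi_{v,0}$ by the differential operators
$\hbar(d/db-k/3-i)$, $i<l$ (`degreeFactor_add_three`, `SeriesFamily.tower_eq`). These operators are
linear, so a linear relation between the functions $\Phi_{v,0}$ of the two phases persists for all
$l$, and the wall-crossing becomes a connection problem in one variable.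

For $k=1,2$ that problem concerns binomial series: $(1-27e^b)^{-k/3}$ on one side and a multiple of
$e^{-kb/3}(1-e^{-b}/27)^{-k/3}$ on the other (`subFun_self_eq`). For $k=0$ it is the hypergeometric
equation $\theta^2-27e^b(\theta+\frac13)(\theta+\frac23)$. Near $b=-\infty$ its solutions are a
power series and a logarithmic partner, the two coefficients of a dual number; on the other side
they are $e^{-jb/3}\,{}_2F_1(\frac j3,\frac j3;\frac{2j}3;e^{-b}/27)$ for $j=1,2$. Euler's integral
continues the latter to the whole strip $0<\operatorname{Im} b<2\pi$, where $e^{-b}/27$ avoids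
$[1,\infty)$. On the middle ray $\operatorname{Im} b=\pi$ the integral is real and its logarithmic
asymptotics is computed with an elementary antiderivative (`tendsto_realEuler_add_log`). A Wronskian
argument shows that a solution tending to $0$ along this ray vanishes (`eqOn_zero_of_hypergeomOp`),
so the asymptotics determines the connection formula (`eulerFun_eq`). The reflection formula for
$\Gamma(\frac13)\Gamma(\frac23)$ and sixth roots of unity identify the constants with the entries of
$M_v$ (`tsum_eq_wallFun`).

For convergence in $q_a$ on the continued domain, Nagumo's estimate bounds $l$ successive operators
by $A^{l+1}l!$ locally uniformly (`norm_tower_le_div`). The three variables contribute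
$(l!)^3\le(3l+k)!$, which the denominator of the $a$-factor compensates, so the series converges for
$|q_a|$ small. The local bounds on $\log|q_a|$ are glued to a continuous function on the corridor,
which gives a connected domain.

The map $M_v$ is invertible because on the sectors with $g_a=0$ it amounts to a $2\times2$ matrix
whose two columns have distinct ratios $C_1/C_0$; otherwise it is a nonzero scalar. For the
composite, all three wall-crossing identities hold at the same point of the product of strips, so
they can simply be chained. -/

open TrivSqZeroExt in
theorem hyperFactor_of_nonneg (ħ : ℂ) (D : ℂ[ε]) {d : ℚ} (hd : 0 ≤ d) :
    hyperFactor ħ D d = (∏ i ∈ Finset.range ⌈d⌉.toNat, (D + inl (((d - i : ℚ) : ℂ) * ħ)))⁻¹ := by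
  rw [hyperFactor, if_pos hd]
  congr 1
  symm
  refine Finset.prod_bij (fun i _ => (i : ℤ)) ?_ ?_ ?_ ?_
  · intro i hi
    simp only [Finset.mem_range, Finset.mem_Icc] at *
    omega
  · intro i _ j _ h
    exact_mod_cast h
  · intro j hj
    simp only [Finset.mem_range, Finset.mem_Icc] at *
    exact ⟨j.toNat, by omega, by omega⟩
  · intro i hi
    simp

open TrivSqZeroExt in
theorem hyperFactor_of_neg (ħ : ℂ) (D : ℂ[ε]) {d : ℚ} (hd : d < 0) :
    hyperFactor ħ D d =
      ∏ i ∈ Finset.range (-1 - ⌊d⌋).toNat, (D + inl (((d + 1 + i : ℚ) : ℂ) * ħ)) := by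
  rw [hyperFactor, if_neg (not_le.2 hd)]
  symm
  refine Finset.prod_bij (fun i _ => -1 - (i : ℤ)) ?_ ?_ ?_ ?_
  · intro i hi
    simp only [Finset.mem_range, Finset.mem_Icc] at *
    omega
  · intro i _ j _ h
    simpa using h
  · intro j hj
    simp only [Finset.mem_range, Finset.mem_Icc] at *
    exact ⟨(-1 - j).toNat, by omega, by omega⟩
  · intro i hi
    congr 3
    push_cast
    ring

theorem hyperFactor_zero (ħ : ℂ) (D : ℂ[ε]) : hyperFactor ħ D 0 = 1 := by
  simp [hyperFactor_of_nonneg, TrivSqZeroExt.inv_one]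

theorem hyperFactor_of_mem_Ico (ħ : ℂ) (D : ℂ[ε]) {d : ℚ} (h1 : -1 ≤ d) (h0 : d < 0) :
    hyperFactor ħ D d = 1 := by
  have h : ⌊d⌋ = -1 := Int.floor_eq_iff.2 ⟨by push_cast; linarith, by push_cast; linarith⟩
  simp [hyperFactor_of_neg ħ D h0, h]

-- The bound $-1<d$ lets the recursion cross zero: for $-1<d<0$ the factor is an empty product,
-- while for $d+1$ it consists of the single term $\nu=0$.
open TrivSqZeroExt in
theorem hyperFactor_add_one (ħ : ℂ) (D : ℂ[ε]) {d : ℚ} (hd : -1 < d) :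
    hyperFactor ħ D (d + 1) = (D + inl (((d + 1 : ℚ) : ℂ) * ħ))⁻¹ * hyperFactor ħ D d := by
  rcases le_or_gt 0 d with h0 | h0
  · have hc : ⌈d + 1⌉.toNat = ⌈d⌉.toNat + 1 := by
      have : 0 ≤ ⌈d⌉ := Int.ceil_nonneg h0
      rw [Int.ceil_add_one]; omega
    rw [hyperFactor_of_nonneg ħ D h0, hyperFactor_of_nonneg ħ D (by linarith), hc,
      Finset.prod_range_succ', TrivSqZeroExt.mul_inv_rev]
    congr 2
    · simp
    · refine Finset.prod_congr rfl fun i _ => ?_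
      congr 3
      push_cast
      ring
  · have hc : ⌈d + 1⌉.toNat = 1 := by
      have : ⌈d⌉ = 0 := Int.ceil_eq_iff.2 ⟨by push_cast; linarith, by push_cast; linarith⟩
      rw [Int.ceil_add_one, this]; rfl
    rw [hyperFactor_of_mem_Ico ħ D hd.le h0, hyperFactor_of_nonneg ħ D (by linarith), hc]
    simp

open TrivSqZeroExt in
theorem hyperFactor_sub_one (ħ : ℂ) (D : ℂ[ε]) {d : ℚ} (hd : d < 0) :
    hyperFactor ħ D (d - 1) = (D + inl ((d : ℂ) * ħ)) * hyperFactor ħ D d := by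
  have hc : (-1 - ⌊d - 1⌋).toNat = (-1 - ⌊d⌋).toNat + 1 := by
    have : ⌊d⌋ < 0 := Int.floor_lt.2 (by simpa using hd)
    rw [Int.floor_sub_one]; omega
  rw [hyperFactor_of_neg ħ D hd, hyperFactor_of_neg ħ D (by linarith), hc,
      Finset.prod_range_succ', mul_comm]
  congr 1
  · simp
  · refine Finset.prod_congr rfl fun i _ => ?_
    congr 3
    push_cast
    ring

-- Since $D$ is nilpotent and $d\hbar\ne0$, the factor $D+d\hbar$ is a unit and may be moved across.
-- This fails at $d=0$, the case that the excess class $A_v$ repairs.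
open TrivSqZeroExt in
theorem hyperFactor_eq_mul_add_one (ħ : ℂ) (hħ : ħ ≠ 0) (D : ℂ[ε]) (hD : D.fst = 0) {d : ℚ}
    (hd : 0 < d) :
    hyperFactor ħ D (d - 1) = (D + inl ((d : ℂ) * ħ)) * hyperFactor ħ D d := by
  have h := hyperFactor_add_one ħ D (d := d - 1) (by linarith)
  rw [sub_add_cancel] at h
  rw [h, ← mul_assoc, TrivSqZeroExt.mul_inv_cancel, one_mul]
  simp [hD, hħ, hd.ne']

/-- The contribution of a variable with divisor `D` in degree `β_v = n / 3`, `β_a = k / 3`. -/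
def degreeFactor (D : ℂ[ε]) (ħ b : ℂ) (n k : ℤ) : ℂ[ε] :=
  TrivSqZeroExt.inl (Complex.exp ((((n : ℚ) / 3 : ℚ) : ℂ) * b)) * (1 + (b / ħ) • D)
    * (-1) ^ n.natAbs * (if 0 ≤ n ∧ n < k ∧ (3 : ℤ) ∣ n - k then D else 1)
    * hyperFactor ħ D ((n : ℚ) / 3 - (k : ℚ) / 3) * hyperFactor ħ D ((n : ℚ) / 3) ^ 2
    * hyperFactor ħ (-3 * D) (-3 * ((n : ℚ) / 3) - 1)

theorem varFactor_eq_degreeFactor (s : Finset (Fin 3)) (ħ : ℂ) (v : Fin 3) (b : ℂ)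
    (β : (Fin 3 → ℤ) × ℤ) :
    varFactor s ħ v b β = degreeFactor (divisor s v) ħ b (β.1 v) β.2 := rfl

open TrivSqZeroExt in
/-- Raising `β_a` by one multiplies by the weight of the coordinate `v_0`. -/
theorem degreeFactor_add_three (D : ℂ[ε]) (hD : D.fst = 0) (ħ : ℂ) (hħ : ħ ≠ 0) (b : ℂ) (n k : ℤ)
    (hk : 0 ≤ k) :
    degreeFactor D ħ b n (k + 3) =
      (D + inl (((n : ℂ) - k) / 3 * ħ)) * degreeFactor D ħ b n k := by
  have e1 : (n : ℚ) / 3 - ((k + 3 : ℤ) : ℚ) / 3 = ((n : ℚ) / 3 - (k : ℚ) / 3) - 1 := by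
    push_cast; ring
  have e2 : ((n : ℂ) - k) / 3 = (((n : ℚ) / 3 - (k : ℚ) / 3 : ℚ) : ℂ) := by push_cast; ring
  have key : (if 0 ≤ n ∧ n < k + 3 ∧ (3 : ℤ) ∣ n - (k + 3) then D else 1)
        * hyperFactor ħ D ((n : ℚ) / 3 - (k : ℚ) / 3 - 1)
      = (D + inl (((n : ℂ) - k) / 3 * ħ)) * ((if 0 ≤ n ∧ n < k ∧ (3 : ℤ) ∣ n - k then D else 1)
        * hyperFactor ħ D ((n : ℚ) / 3 - (k : ℚ) / 3)) := by
    -- The cases are the sign of the degree $\beta_v-\beta_a$ of $v_0$. Away from zero the condition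
    -- defining $A_v$ is unchanged by $k\mapsto k+3$, because it involves a divisibility by $3$.
    rcases lt_trichotomy n k with h | h | h
    · have hd : (n : ℚ) / 3 - (k : ℚ) / 3 < 0 := by
        have : (n : ℚ) < k := by exact_mod_cast h
        linarith
      rw [hyperFactor_sub_one ħ D hd, e2]
      have : (0 ≤ n ∧ n < k + 3 ∧ (3 : ℤ) ∣ n - (k + 3)) ↔ (0 ≤ n ∧ n < k ∧ (3 : ℤ) ∣ n - k) := by
        omega
      simp only [this]
      ring
    -- Here the degree of $v_0$ drops from $0$ to $-1$, where both hypergeometric factors are $1$.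
    -- The expected factor $D+0\cdot\hbar$ comes from $A_v$, which switches from $1$ to $D$.
    · subst h
      rw [if_pos (by omega), if_neg (by omega)]
      simp [hyperFactor_zero, hyperFactor_of_mem_Ico]
    · have hd : 0 < (n : ℚ) / 3 - (k : ℚ) / 3 := by
        have : (k : ℚ) < n := by exact_mod_cast h
        linarith
      rw [hyperFactor_eq_mul_add_one ħ hħ D hD hd, e2, if_neg (by omega), if_neg (by omega)]
      ring
  unfold degreeFactor
  rw [e1]
  linear_combination (inl (Complex.exp ((((n : ℚ) / 3 : ℚ) : ℂ) * b)) * (1 + (b / ħ) • D)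
    * (-1) ^ n.natAbs * hyperFactor ħ D ((n : ℚ) / 3) ^ 2
    * hyperFactor ħ (-3 * D) (-3 * ((n : ℚ) / 3) - 1)) * key

end

/-! ### Explicit coefficients of the one-variable series for $\beta_a<1$ -/

section

open TrivSqZeroExt

theorem degreeFactor_eq_exp_mul (D : ℂ[ε]) (ħ b : ℂ) (n k : ℤ) :
    degreeFactor D ħ b n k =
      inl (Complex.exp ((n : ℂ) / 3 * b)) * (1 + (b / ħ) • D) * degreeFactor D ħ 0 n k := by
  simp only [degreeFactor, mul_zero, Complex.exp_zero, inl_one, zero_div, zero_smul, add_zero,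
    one_mul]
  push_cast
  ring

/-- Raising $\beta_v$ by one lowers the degree of $p_v$ by three, which produces three numerator
factors, and raises those of $v_0,v_1,v_2$ by one, which produces the inverses. The sign is
$(-1)^3$. The bound $k<3$ keeps the excess class equal to $1$ and the degree of $v_0$ above $-1$. -/
theorem degreeFactor_eps_add_three (ħ : ℂ) (m : ℕ) (k : ℕ) (hk : k < 3) :
    degreeFactor ε ħ 0 (3 * ((m + 1 : ℕ) : ℤ)) k =
      -((-3 * ε + inl ((-3 * m - 1) * ħ)) * (-3 * ε + inl ((-3 * m - 2) * ħ))
        * (-3 * ε + inl ((-3 * m - 3) * ħ)) * ((ε + inl ((m + 1) * ħ))⁻¹) ^ 2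
        * (ε + inl ((m + 1 - k / 3) * ħ))⁻¹) * degreeFactor ε ħ 0 (3 * (m : ℤ)) k := by
  have hk' : (k : ℚ) < 3 := by exact_mod_cast hk
  have hm : (0 : ℚ) ≤ m := by positivity
  unfold degreeFactor
  rw [if_neg (by omega), if_neg (by omega)]
  have e1 : ((3 * ((m + 1 : ℕ) : ℤ) : ℤ) : ℚ) / 3 - ((k : ℤ) : ℚ) / 3
      = ((3 * (m : ℤ) : ℤ) : ℚ) / 3 - ((k : ℤ) : ℚ) / 3 + 1 := by push_cast; ring
  have e2 : ((3 * ((m + 1 : ℕ) : ℤ) : ℤ) : ℚ) / 3 = ((3 * (m : ℤ) : ℤ) : ℚ) / 3 + 1 := by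
    push_cast; ring
  have e3 : -3 * (((3 * ((m + 1 : ℕ) : ℤ) : ℤ) : ℚ) / 3) - 1
      = -3 * (((3 * (m : ℤ) : ℤ) : ℚ) / 3) - 1 - 1 - 1 - 1 := by push_cast; ring
  have s : (-1 : ℂ[ε]) ^ (3 * ((m + 1 : ℕ) : ℤ)).natAbs = -(-1) ^ (3 * (m : ℤ)).natAbs := by
    rw [show (3 * ((m + 1 : ℕ) : ℤ)).natAbs = (3 * (m : ℤ)).natAbs + 3 by omega, pow_add]
    ring
  rw [e1, e3, e2, s, hyperFactor_add_one _ _ (by push_cast; linarith),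
    hyperFactor_add_one _ _ (by push_cast; linarith),
    hyperFactor_sub_one _ _ (by push_cast; linarith),
    hyperFactor_sub_one _ _ (by push_cast; linarith),
    hyperFactor_sub_one _ _ (by push_cast; linarith)]
  have c1 : ((((3 * (m : ℤ) : ℤ) : ℚ) / 3 - ((k : ℤ) : ℚ) / 3 + 1 : ℚ) : ℂ) = m + 1 - k / 3 := by
    push_cast; ring
  have c2 : ((((3 * (m : ℤ) : ℤ) : ℚ) / 3 + 1 : ℚ) : ℂ) = m + 1 := by
    push_cast; ring
  have c3 : ((-3 * (((3 * (m : ℤ) : ℤ) : ℚ) / 3) - 1 : ℚ) : ℂ) = -3 * m - 1 := by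
    push_cast; ring
  have c4 : ((-3 * (((3 * (m : ℤ) : ℤ) : ℚ) / 3) - 1 - 1 : ℚ) : ℂ) = -3 * m - 2 := by
    push_cast; ring
  have c5 : ((-3 * (((3 * (m : ℤ) : ℤ) : ℚ) / 3) - 1 - 1 - 1 : ℚ) : ℂ) = -3 * m - 3 := by
    push_cast; ring
  rw [c1, c2, c3, c4, c5]
  simp only [mul_zero, Complex.exp_zero, inl_one]
  ring

theorem degreeFactor_eps_zero (ħ : ℂ) (k : ℕ) (hk : k < 3) :
    degreeFactor ε ħ 0 0 k = 1 := by
  unfold degreeFactor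
  have h : hyperFactor ħ ε (0 / 3 - ((k : ℤ) : ℚ) / 3) = 1 := by
    have hk' : (k : ℚ) < 3 := by exact_mod_cast hk
    rcases k.eq_zero_or_pos with rfl | h0
    · simp [hyperFactor_zero]
    · have h0' : (0 : ℚ) < k := by exact_mod_cast h0
      exact hyperFactor_of_mem_Ico _ _ (by push_cast; linarith) (by push_cast; linarith)
  have h2 : hyperFactor ħ (-3 * ε) (-3 * (0 / 3) - 1) = 1 :=
    hyperFactor_of_mem_Ico _ _ (by norm_num) (by norm_num)
  rw [if_neg (by omega)]
  simp only [Int.cast_zero]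
  rw [h, h2]
  simp [hyperFactor_zero]

/-- The coefficients of the series of a superscript variable. -/
def supCoeff (k m : ℕ) : ℂ :=
  ∏ i ∈ Finset.range m, 9 * (3 * i + 1) * (3 * i + 2) / ((i + 1) * (3 * i + 3 - k) : ℂ)

/-- The logarithmic derivatives of the coefficients of the untwisted series of a superscript
variable. -/
def supHarmonic (m : ℕ) : ℂ :=
  ∑ i ∈ Finset.range m, (3 / (3 * i + 1) + 3 / (3 * i + 2) - 2 / (i + 1) : ℂ)

theorem supCoeff_succ (k m : ℕ) : supCoeff k (m + 1) =
    supCoeff k m * (9 * (3 * m + 1) * (3 * m + 2) / ((m + 1) * (3 * m + 3 - k) : ℂ)) :=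
  Finset.prod_range_succ _ _

theorem supHarmonic_succ (m : ℕ) : supHarmonic (m + 1) =
    supHarmonic m + (3 / (3 * m + 1) + 3 / (3 * m + 2) - 2 / (m + 1) : ℂ) :=
  Finset.sum_range_succ _ _

theorem fst_three : (3 : ℂ[ε]).fst = 3 := rfl

theorem snd_three : (3 : ℂ[ε]).snd = 0 := rfl

theorem three_mul_add_three_sub_ne_zero (m : ℕ) {k : ℕ} (hk : k < 3) : (3 * m + 3 - k : ℂ) ≠ 0 := by
  have : ((3 * m + 3 - k : ℕ) : ℂ) ≠ 0 := by
    rw [Nat.cast_ne_zero]; omega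
  rwa [Nat.cast_sub (by omega), Nat.cast_add, Nat.cast_mul, Nat.cast_ofNat] at this

theorem natCast_add_one_ne_zero (m : ℕ) : (m + 1 : ℂ) ≠ 0 := by exact_mod_cast Nat.succ_ne_zero m

theorem fst_degreeFactor_eps_coeff (ħ : ℂ) (hħ : ħ ≠ 0) (m k : ℕ) (hk : k < 3) :
    (degreeFactor ε ħ 0 (3 * (m : ℤ)) k).fst = supCoeff k m := by
  induction m with
  | zero => simp [degreeFactor_eps_zero ħ k hk, supCoeff]
  | succ m ih =>
    rw [degreeFactor_eps_add_three ħ m k hk, fst_mul, ih, supCoeff_succ, mul_comm]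
    congr 1
    have h1 := three_mul_add_three_sub_ne_zero m hk
    have h2 := natCast_add_one_ne_zero m
    have h3 : (m + 1 - k / 3 : ℂ) = (3 * m + 3 - k) / 3 := by ring
    simp [h3]
    field_simp
    ring

/-- The $\varepsilon$-coefficient is the coefficient times its logarithmic derivative, which
accumulates over the recursion. The summand $-2/(i+1)$ is what remains of $3/(3i+3)$ from $p_v$ and
$-3/(i+1)$ from $v_0,v_1,v_2$. -/
theorem snd_degreeFactor_eps_coeff (ħ : ℂ) (hħ : ħ ≠ 0) (m : ℕ) :
    (degreeFactor ε ħ 0 (3 * (m : ℤ)) 0).snd = supCoeff 0 m * supHarmonic m / ħ := by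
  induction m with
  | zero =>
    have := degreeFactor_eps_zero ħ 0 (by norm_num)
    simp at this
    simp [this, supHarmonic]
  | succ m ih =>
    have e := degreeFactor_eps_add_three ħ m 0 (by norm_num)
    have f := fst_degreeFactor_eps_coeff ħ hħ m 0 (by norm_num)
    simp only [Nat.cast_zero] at e f
    rw [e, snd_mul, ih, f, supCoeff_succ, supHarmonic_succ]
    have h2 := natCast_add_one_ne_zero m
    have h3 : (3 * m + 1 : ℂ) ≠ 0 := by exact_mod_cast Nat.succ_ne_zero (3 * m)
    have h4 : (3 * m + 2 : ℂ) ≠ 0 := by exact_mod_cast Nat.succ_ne_zero (3 * m + 1)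
    have h5 : (3 * m + 3 : ℂ) ≠ 0 := by exact_mod_cast Nat.succ_ne_zero (3 * m + 2)
    simp [pow_two, fst_three, snd_three]
    field_simp
    ring

theorem fst_degreeFactor_eps (ħ : ℂ) (hħ : ħ ≠ 0) (b : ℂ) (m k : ℕ) (hk : k < 3) :
    (degreeFactor ε ħ b (3 * (m : ℤ)) k).fst = supCoeff k m * Complex.exp (m * b) := by
  rw [degreeFactor_eq_exp_mul, fst_mul, fst_degreeFactor_eps_coeff ħ hħ m k hk]
  simp
  ring

theorem snd_degreeFactor_eps (ħ : ℂ) (hħ : ħ ≠ 0) (b : ℂ) (m : ℕ) :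
    (degreeFactor ε ħ b (3 * (m : ℤ)) 0).snd =
      supCoeff 0 m * (b + supHarmonic m) / ħ * Complex.exp (m * b) := by
  have f := fst_degreeFactor_eps_coeff ħ hħ m 0 (by norm_num)
  simp only [Nat.cast_zero] at f
  rw [degreeFactor_eq_exp_mul, snd_mul, f, snd_degreeFactor_eps_coeff ħ hħ m]
  simp
  ring

/-- The mirror image of the superscript recursion: lowering $\beta_v$ by one raises the degree of
$p_v$ by three. With $N>0$ every degree stays on the side of zero where one branch of the recursion
applies. -/
theorem degreeFactor_zero_sub_three (ħ : ℂ) (N k : ℕ) (hN : 0 < N) :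
    degreeFactor 0 ħ 0 (-((N + 3 : ℕ) : ℤ)) k =
      -(inl (((N : ℂ) * ħ)⁻¹) * inl (((N + 1 : ℂ) * ħ)⁻¹) * inl (((N + 2 : ℂ) * ħ)⁻¹)
        * (inl (-N / 3 * ħ)) ^ 2 * inl ((-(N + k) / 3) * ħ)) * degreeFactor 0 ħ 0 (-(N : ℤ)) k := by
  have hN' : (0 : ℚ) < N := by exact_mod_cast hN
  have hk' : (0 : ℚ) ≤ k := by positivity
  unfold degreeFactor
  rw [if_neg (by omega), if_neg (by omega)]
  have e1 : ((-((N + 3 : ℕ) : ℤ) : ℤ) : ℚ) / 3 - ((k : ℤ) : ℚ) / 3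
      = ((-(N : ℤ) : ℤ) : ℚ) / 3 - ((k : ℤ) : ℚ) / 3 - 1 := by push_cast; ring
  have e2 : ((-((N + 3 : ℕ) : ℤ) : ℤ) : ℚ) / 3 = ((-(N : ℤ) : ℤ) : ℚ) / 3 - 1 := by push_cast; ring
  have e3 : -3 * (((-((N + 3 : ℕ) : ℤ) : ℤ) : ℚ) / 3) - 1
      = -3 * (((-(N : ℤ) : ℤ) : ℚ) / 3) - 1 + 1 + 1 + 1 := by push_cast; ring
  have s : (-1 : ℂ[ε]) ^ (-((N + 3 : ℕ) : ℤ)).natAbs = -(-1) ^ (-(N : ℤ)).natAbs := by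
    rw [show (-((N + 3 : ℕ) : ℤ)).natAbs = (-(N : ℤ)).natAbs + 3 by omega, pow_add]
    ring
  rw [e1, e3, e2, s, hyperFactor_sub_one _ _ (by push_cast; linarith),
    hyperFactor_sub_one _ _ (by push_cast; linarith),
    hyperFactor_add_one _ _ (by push_cast; linarith),
    hyperFactor_add_one _ _ (by push_cast; linarith),
    hyperFactor_add_one _ _ (by push_cast; linarith)]
  have c1 : ((((-(N : ℤ) : ℤ) : ℚ) / 3 - ((k : ℤ) : ℚ) / 3 : ℚ) : ℂ) = -(N + k) / 3 := by
    push_cast; ring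
  have c2 : ((((-(N : ℤ) : ℤ) : ℚ) / 3 : ℚ) : ℂ) = -N / 3 := by
    push_cast; ring
  have c3 : ((-3 * (((-(N : ℤ) : ℤ) : ℚ) / 3) - 1 + 1 : ℚ) : ℂ) = N := by
    push_cast; ring
  have c4 : ((-3 * (((-(N : ℤ) : ℤ) : ℚ) / 3) - 1 + 1 + 1 : ℚ) : ℂ) = N + 1 := by
    push_cast; ring
  have c5 : ((-3 * (((-(N : ℤ) : ℤ) : ℚ) / 3) - 1 + 1 + 1 + 1 : ℚ) : ℂ) = N + 2 := by
    push_cast; ring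
  rw [c1, c2, c3, c4, c5]
  simp only [mul_zero, Complex.exp_zero, inl_one, zero_add, TrivSqZeroExt.inv_inl]
  ring

/-- The leading coefficient of the series of a subscript variable. -/
def subLead (ħ : ℂ) (j k : ℕ) : ℂ := if j = 1 then -1 else if k = 0 then ħ⁻¹ else -1 / 3

/-- The coefficients of the series of a subscript variable. -/
def subCoeff (ħ : ℂ) (j k m : ℕ) : ℂ :=
  subLead ħ j k * ∏ i ∈ Finset.range m,
    ((3 * i + j) * (3 * i + j + k) / (27 * (3 * i + j + 1) * (3 * i + j + 2)) : ℂ)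

theorem subCoeff_succ (ħ : ℂ) (j k m : ℕ) : subCoeff ħ j k (m + 1) = subCoeff ħ j k m *
    ((3 * m + j) * (3 * m + j + k) / (27 * (3 * m + j + 1) * (3 * m + j + 2)) : ℂ) := by
  rw [subCoeff, Finset.prod_range_succ, ← mul_assoc, ← subCoeff]

/-- Narrowness $3\nmid j+k$ leaves $(j,k)=(1,0),(1,1),(2,0),(2,2)$. For $j=1$ only the sign $-1$
survives; for $j=2$ the factor of $p_v$ gives $\hbar^{-1}$. In the case $(2,2)$ the degree of $v_0$
is $-4/3$, whose single factor $-\hbar/3$ cancels this power of $\hbar$. -/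
theorem fst_degreeFactor_zero_lead (ħ : ℂ) (hħ : ħ ≠ 0) (j k : ℕ) (hj : j = 1 ∨ j = 2)
    (hk : k < 3) (hjk : ¬ 3 ∣ j + k) : (degreeFactor 0 ħ 0 (-(j : ℤ)) k).fst = subLead ħ j k := by
  unfold degreeFactor
  rw [if_neg (by omega)]
  have hk' : (k : ℚ) < 3 := by exact_mod_cast hk
  have hk0 : (0 : ℚ) ≤ k := by positivity
  rcases hj with rfl | rfl
  · have hk1 : (k : ℚ) ≤ 1 := by
      have : k ≤ 1 := by omega
      exact_mod_cast this
    rw [hyperFactor_of_mem_Ico _ _ (by push_cast; linarith) (by push_cast; linarith),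
      hyperFactor_of_mem_Ico _ _ (by push_cast; linarith) (by push_cast; linarith),
      show -3 * (((-((1 : ℕ) : ℤ) : ℤ) : ℚ) / 3) - 1 = 0 by norm_num, hyperFactor_zero]
    simp [subLead]
  · rw [show -3 * (((-((2 : ℕ) : ℤ) : ℤ) : ℚ) / 3) - 1 = 0 + 1 by norm_num,
      hyperFactor_add_one _ _ (by norm_num), hyperFactor_zero]
    have : k = 0 ∨ k = 2 := by omega
    rcases this with rfl | rfl
    · rw [hyperFactor_of_mem_Ico _ _ (by norm_num) (by norm_num),
        hyperFactor_of_mem_Ico _ _ (by norm_num) (by norm_num)]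
      simp [subLead]
    · rw [show ((-((2 : ℕ) : ℤ) : ℤ) : ℚ) / 3 - (((2 : ℕ) : ℤ) : ℚ) / 3 = (-1 / 3) - 1 by norm_num,
        hyperFactor_sub_one _ _ (by norm_num), hyperFactor_of_mem_Ico _ _ (by norm_num) (by norm_num),
        hyperFactor_of_mem_Ico _ _ (by norm_num) (by norm_num)]
      simp [subLead]
      field_simp

theorem fst_degreeFactor_zero_coeff (ħ : ℂ) (hħ : ħ ≠ 0) (j k m : ℕ) (hj : j = 1 ∨ j = 2)
    (hk : k < 3) (hjk : ¬ 3 ∣ j + k) :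
    (degreeFactor 0 ħ 0 (-((3 * m + j : ℕ) : ℤ)) k).fst = subCoeff ħ j k m := by
  induction m with
  | zero =>
    simpa [subCoeff] using fst_degreeFactor_zero_lead ħ hħ j k hj hk hjk
  | succ m ih =>
    rw [show 3 * (m + 1) + j = (3 * m + j) + 3 by ring, degreeFactor_zero_sub_three _ _ _ (by omega),
      fst_mul, ih, subCoeff_succ, mul_comm]
    congr 1
    have h2 : (3 * m + j : ℂ) ≠ 0 := by
      have : ((3 * m + j : ℕ) : ℂ) ≠ 0 := Nat.cast_ne_zero.2 (by omega)
      exact_mod_cast this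
    have h3 : (3 * m + j + 1 : ℂ) ≠ 0 := by exact_mod_cast Nat.succ_ne_zero (3 * m + j)
    have h4 : (3 * m + j + 2 : ℂ) ≠ 0 := by exact_mod_cast Nat.succ_ne_zero (3 * m + j + 1)
    simp
    field_simp
    ring

theorem fst_degreeFactor_zero (ħ : ℂ) (hħ : ħ ≠ 0) (b : ℂ) (j k m : ℕ) (hj : j = 1 ∨ j = 2)
    (hk : k < 3) (hjk : ¬ 3 ∣ j + k) :
    (degreeFactor 0 ħ b (-((3 * m + j : ℕ) : ℤ)) k).fst =
      subCoeff ħ j k m * Complex.exp (-(m + j / 3) * b) := by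
  rw [degreeFactor_eq_exp_mul, fst_mul, fst_degreeFactor_zero_coeff ħ hħ j k m hj hk hjk]
  simp
  rw [mul_comm]
  congr 2
  ring

end

section

open Filter

/-! ### Towers of functions obtained by raising `β_a` -/

/-- The functions obtained from `Φ` by the operators `ħ (d/db - κ - l)`, `l = 0, 1, 2, …`. -/
def tower (ħ κ : ℂ) (Φ : ℂ → ℂ) : ℕ → ℂ → ℂ
  | 0 => Φ
  | l + 1 => fun b => ħ * (deriv (tower ħ κ Φ l) b - (κ + l) * tower ħ κ Φ l b)

theorem tower_differentiableOn (ħ κ : ℂ) {Φ : ℂ → ℂ} {D : Set ℂ} (hD : IsOpen D)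
    (hΦ : DifferentiableOn ℂ Φ D) (l : ℕ) : DifferentiableOn ℂ (tower ħ κ Φ l) D := by
  induction l with
  | zero => exact hΦ
  | succ l ih => exact ((ih.deriv hD).sub (ih.const_mul _)).const_mul _

theorem tower_congr (ħ κ : ℂ) {Φ Ψ : ℂ → ℂ} {D : Set ℂ} (hD : IsOpen D)
    (h : Set.EqOn Φ Ψ D) (l : ℕ) : Set.EqOn (tower ħ κ Φ l) (tower ħ κ Ψ l) D := by
  induction l with
  | zero => exact h
  | succ l ih =>
    intro b hb
    simp only [tower, ih hb, (ih.eventuallyEq_of_mem (hD.mem_nhds hb)).deriv_eq]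

theorem tower_sum {ι : Type*} (t : Finset ι) (ħ κ : ℂ) (c : ι → ℂ) {Φ : ι → ℂ → ℂ} {D : Set ℂ}
    (hD : IsOpen D) (hΦ : ∀ i ∈ t, DifferentiableOn ℂ (Φ i) D) (l : ℕ) :
    Set.EqOn (tower ħ κ (fun b => ∑ i ∈ t, c i * Φ i b) l)
      (fun b => ∑ i ∈ t, c i * tower ħ κ (Φ i) l b) D := by
  induction l with
  | zero => exact fun _ _ => rfl
  | succ l ih =>
    intro b hb
    have hd : deriv (tower ħ κ (fun b => ∑ i ∈ t, c i * Φ i b) l) b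
        = ∑ i ∈ t, c i * deriv (tower ħ κ (Φ i) l) b := by
      rw [(ih.eventuallyEq_of_mem (hD.mem_nhds hb)).deriv_eq]
      have hdiff : ∀ i ∈ t, DifferentiableAt ℂ (tower ħ κ (Φ i) l) b := fun i hi =>
        (tower_differentiableOn ħ κ hD (hΦ i hi) l).differentiableAt (hD.mem_nhds hb)
      rw [deriv_fun_sum fun i hi => (hdiff i hi).const_mul (c i)]
      exact Finset.sum_congr rfl fun i hi => deriv_const_mul _ (hdiff i hi)
    simp only [tower, hd, ih hb, Finset.mul_sum, ← Finset.sum_sub_distrib]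
    exact Finset.sum_congr rfl fun i _ => by ring

/-- This is the loss in Nagumo's argument when the distance to the boundary shrinks by the factor
$l/(l+1)$ and is raised to the power $l$. At $l=0$ the convention $1/0=0$ is harmless. -/
theorem one_add_inv_pow_le_three (l : ℕ) : (1 + 1 / (l : ℝ)) ^ l ≤ 3 := by
  rcases l.eq_zero_or_pos with rfl | hl
  · norm_num
  have hl' : (0 : ℝ) < l := by exact_mod_cast hl
  calc (1 + 1 / (l : ℝ)) ^ l ≤ (Real.exp (1 / l)) ^ l := by
        gcongr
        rw [add_comm]; exact Real.add_one_le_exp _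
    _ = Real.exp 1 := by rw [← Real.exp_nat_mul]; congr 1; field_simp
    _ ≤ 3 := by linarith [Real.exp_one_lt_d9]

/-- Nagumo's estimate for towers. -/
theorem norm_tower_le_div {ħ κ : ℂ} (hκ : ‖κ‖ ≤ 1) {Φ : ℂ → ℂ} {b₀ : ℂ} {r K : ℝ} (hr1 : r ≤ 1)
    (hK : 0 ≤ K) (hΦ : DifferentiableOn ℂ Φ (Metric.ball b₀ r))
    (hb : ∀ b ∈ Metric.ball b₀ r, ‖Φ b‖ ≤ K) (l : ℕ) :
    ∀ b ∈ Metric.ball b₀ r,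
      ‖tower ħ κ Φ l b‖ ≤ K * (4 * ‖ħ‖) ^ l * l.factorial / (r - dist b b₀) ^ l := by
  induction l with
  | zero => intro b h; simpa [tower] using hb b h
  | succ l ih =>
    intro b h
    have hδ : 0 < r - dist b b₀ := by simpa using h
    set δ := r - dist b b₀ with hδd
    have hδ1 : δ ≤ 1 := by have := dist_nonneg (x := b) (y := b₀); linarith
    set M := K * (4 * ‖ħ‖) ^ l * l.factorial with hM
    have hM0 : 0 ≤ M := by positivity
    have hl : (0 : ℝ) < l + 1 := by positivity
    have hη : 0 < δ / (l + 1) := by positivity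
    -- Cauchy's estimate on a circle of radius $\delta/(l+1)$ costs the factor $l+1$ needed for the
    -- factorial, and the distance to the boundary only shrinks to $\delta\,l/(l+1)$, which costs at
    -- most $3$.
    have hder : ‖deriv (tower ħ κ Φ l) b‖ ≤ 3 * (l + 1) * M / δ ^ (l + 1) := by
      -- For $l=0$ the radius $\delta/(l+1)$ would touch the boundary of the ball, so $\delta/2$ is
      -- used instead.
      rcases l.eq_zero_or_pos with rfl | hl0
      · have hle : ∀ η, 0 < η → η < δ → ‖deriv Φ b‖ ≤ K / η := by
          intro η h0 h1
          have hs : Metric.closedBall b η ⊆ Metric.ball b₀ r := by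
            intro w hw
            rw [Metric.mem_closedBall] at hw
            rw [Metric.mem_ball]
            linarith [dist_triangle w b b₀]
          refine Complex.norm_deriv_le_of_forall_mem_sphere_norm_le h0 ?_ fun w hw =>
            hb w (hs (Metric.sphere_subset_closedBall hw))
          refine (hΦ.mono ?_).diffContOnCl
          rw [closure_ball _ h0.ne']
          exact hs
        have h2 := hle (δ / 2) (by positivity) (by linarith)
        simp only [tower, hM]
        refine h2.trans ?_
        rw [div_le_div_iff₀ (by positivity) (by positivity)]
        norm_num
        nlinarith
      · have hl0' : (0 : ℝ) < l := by exact_mod_cast hl0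
        have hηδ : δ / (l + 1) < δ := div_lt_self hδ (by linarith)
        have hs : Metric.closedBall b (δ / (l + 1)) ⊆ Metric.ball b₀ r := by
          intro w hw
          rw [Metric.mem_closedBall] at hw
          rw [Metric.mem_ball]
          linarith [dist_triangle w b b₀]
        have hC : ∀ w ∈ Metric.sphere b (δ / (l + 1)),
            ‖tower ħ κ Φ l w‖ ≤ M * 3 / δ ^ l := by
          intro w hw
          refine (ih w (hs (Metric.sphere_subset_closedBall hw))).trans ?_
          have hd : δ * (l / (l + 1)) ≤ r - dist w b₀ := by
            have : dist w b₀ ≤ δ / (l + 1) + dist b b₀ := by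
              rw [← Metric.mem_sphere.1 hw]; exact dist_triangle w b b₀
            have e : δ * (l / (l + 1)) = δ - δ / (l + 1) := by field_simp; ring
            rw [e]; linarith
          have h3 := one_add_inv_pow_le_three l
          have e : (1 + 1 / (l : ℝ)) = ((l : ℝ) / (l + 1))⁻¹ := by field_simp
          rw [e, inv_pow] at h3
          have hp : 0 < ((l : ℝ) / (l + 1)) ^ l := by positivity
          calc M / (r - dist w b₀) ^ l ≤ M / (δ * (l / (l + 1))) ^ l := by gcongr
            _ = M * (((l : ℝ) / (l + 1)) ^ l)⁻¹ / δ ^ l := by rw [mul_pow]; field_simp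
            _ ≤ M * 3 / δ ^ l := by gcongr
        have := Complex.norm_deriv_le_of_forall_mem_sphere_norm_le hη
          (((tower_differentiableOn ħ κ Metric.isOpen_ball hΦ l).mono
            (by rw [closure_ball _ hη.ne']; exact hs)).diffContOnCl) hC
        refine this.trans (le_of_eq ?_)
        rw [pow_succ]
        field_simp
    -- The undifferentiated term is absorbed using $\delta\le1$. Together with the derivative it
    -- gives the constant $4=3+1$.
    have hval : ‖(κ + l) * tower ħ κ Φ l b‖ ≤ (l + 1) * M / δ ^ (l + 1) := by
      rw [norm_mul, mul_div_assoc]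
      have h1 : ‖κ + l‖ ≤ l + 1 := by
        refine (norm_add_le _ _).trans ?_
        rw [Complex.norm_natCast]; linarith
      have h2 : ‖tower ħ κ Φ l b‖ ≤ M / δ ^ (l + 1) := by
        refine (ih b h).trans ?_
        apply div_le_div_of_nonneg_left hM0 (by positivity)
        exact pow_le_pow_of_le_one hδ.le hδ1 (Nat.le_succ l)
      gcongr
    simp only [tower]
    rw [norm_mul]
    calc ‖ħ‖ * ‖deriv (tower ħ κ Φ l) b - (κ + l) * tower ħ κ Φ l b‖
        ≤ ‖ħ‖ * (3 * (l + 1) * M / δ ^ (l + 1) + (l + 1) * M / δ ^ (l + 1)) := by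
          gcongr
          exact (norm_sub_le _ _).trans (add_le_add hder hval)
      _ = K * (4 * ‖ħ‖) ^ (l + 1) * (l + 1).factorial / δ ^ (l + 1) := by
          rw [Nat.factorial_succ, hM]
          push_cast
          ring

/-- Local uniform factorial growth of a sequence of functions. -/
def FactorialGrowthAt (Φ : ℕ → ℂ → ℂ) (b₀ : ℂ) : Prop :=
  ∃ A : ℝ, 1 ≤ A ∧ ∀ᶠ b in 𝓝 b₀, ∀ l, ‖Φ l b‖ ≤ A ^ (l + 1) * l.factorial

/-- Continuity bounds $\Phi$ on a small ball, and Nagumo's estimate is applied on its concentric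
half, where the distance to the boundary is at least $\rho/2$. This gives the growth of the tower at
points where no series is available. -/
theorem factorialGrowthAt_tower {ħ κ : ℂ} (hκ : ‖κ‖ ≤ 1) {Φ : ℂ → ℂ} {D : Set ℂ} (hD : IsOpen D)
    (hΦ : DifferentiableOn ℂ Φ D) {b₀ : ℂ} (hb₀ : b₀ ∈ D) :
    FactorialGrowthAt (tower ħ κ Φ) b₀ := by
  have hc : ContinuousAt Φ b₀ := (hΦ.differentiableAt (hD.mem_nhds hb₀)).continuousAt
  have hev : ∀ᶠ b in 𝓝 b₀, ‖Φ b‖ < ‖Φ b₀‖ + 1 ∧ b ∈ D :=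
    (hc.norm.eventually (gt_mem_nhds (lt_add_one _))).and (hD.mem_nhds hb₀)
  obtain ⟨r, hr, hball⟩ := Metric.eventually_nhds_iff_ball.1 hev
  set ρ := min r 1 with hρ
  have hρ0 : 0 < ρ := lt_min hr one_pos
  have hsub : Metric.ball b₀ ρ ⊆ Metric.ball b₀ r := Metric.ball_subset_ball (min_le_left _ _)
  have hK : 0 ≤ ‖Φ b₀‖ + 1 := by positivity
  refine ⟨max (‖Φ b₀‖ + 1) (8 * ‖ħ‖ / ρ), le_max_of_le_left (by linarith [norm_nonneg (Φ b₀)]), ?_⟩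
  filter_upwards [Metric.ball_mem_nhds b₀ (half_pos hρ0)] with b hb l
  rw [Metric.mem_ball] at hb
  have h := norm_tower_le_div (ħ := ħ) hκ (min_le_right r 1) hK
    (hΦ.mono fun x hx => (hball x (hsub hx)).2) (fun x hx => (hball x (hsub hx)).1.le) l b
    (by rw [Metric.mem_ball]; linarith)
  refine h.trans ?_
  have h2 : ρ / 2 ≤ ρ - dist b b₀ := by linarith
  calc (‖Φ b₀‖ + 1) * (4 * ‖ħ‖) ^ l * l.factorial / (ρ - dist b b₀) ^ l
      ≤ (‖Φ b₀‖ + 1) * (4 * ‖ħ‖) ^ l * l.factorial / (ρ / 2) ^ l := by gcongr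
    _ = (‖Φ b₀‖ + 1) * (8 * ‖ħ‖ / ρ) ^ l * l.factorial := by
        have : 8 * ‖ħ‖ / ρ = (4 * ‖ħ‖) / (ρ / 2) := by field_simp; ring
        rw [this, div_pow (4 * ‖ħ‖)]
        generalize (4 * ‖ħ‖) ^ l = x
        generalize (ρ / 2) ^ l = y
        ring
    _ ≤ (max (‖Φ b₀‖ + 1) (8 * ‖ħ‖ / ρ)) * (max (‖Φ b₀‖ + 1) (8 * ‖ħ‖ / ρ)) ^ l
        * l.factorial := by
        gcongr
        · exact le_max_left _ _
        · exact le_max_right _ _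
    _ = _ := by rw [pow_succ']

end

section

open Filter

/-! ### Series whose terms have controlled growth -/

/-- The bound `∑ₘ C Kˡ l! binom(m + l, l) ρᵐ = C Kˡ l! / (1 - ρ)^(l + 1)`. -/
theorem hasSum_growth_bound (C K : ℝ) (l : ℕ) {ρ : ℝ} (h0 : 0 ≤ ρ) (h1 : ρ < 1) :
    HasSum (fun m : ℕ => C * K ^ l * (l.factorial * ((m + l).choose l : ℝ)) * ρ ^ m)
      (C * K ^ l * l.factorial * (1 / (1 - ρ) ^ (l + 1))) := by
  have h := (hasSum_choose_mul_geometric_of_norm_lt_one l (r := ρ)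
    (by rwa [Real.norm_of_nonneg h0])).mul_left (C * K ^ l * l.factorial)
  exact h.congr_fun fun m => by ring

/-- A family `u l m` of holomorphic functions on `D`, compatible with the operators
`ħ (d/db - κ - l)`, whose growth is controlled locally uniformly. -/
structure SeriesFamily (ħ κ : ℂ) (D : Set ℂ) (u : ℕ → ℕ → ℂ → ℂ) : Prop where
  hasDerivAt : ∀ l m b, HasDerivAt (u l m) (u (l + 1) m b / ħ + (κ + l) * u l m b) b
  bound : ∀ b₀ ∈ D, ∃ C K ρ : ℝ, 1 ≤ C ∧ 1 ≤ K ∧ 0 ≤ ρ ∧ ρ < 1 ∧ ∀ᶠ b in 𝓝 b₀, ∀ l m,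
    ‖u l m b‖ ≤ C * K ^ l * (l.factorial * ((m + l).choose l : ℝ)) * ρ ^ m

namespace SeriesFamily

variable {ħ κ : ℂ} {D : Set ℂ} {u : ℕ → ℕ → ℂ → ℂ}

/-- Summing the majorant over $m$ turns $\binom{m+l}{l}\rho^m$ into $(1-\rho)^{-l-1}$, which is
again geometric in $l$. -/
theorem norm_growth (h : SeriesFamily ħ κ D u) {b₀ : ℂ} (hb₀ : b₀ ∈ D) :
    ∃ A : ℝ, 1 ≤ A ∧ ∀ᶠ b in 𝓝 b₀, ∀ l, Summable (fun m => ‖u l m b‖) ∧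
      ∑' m, ‖u l m b‖ ≤ A ^ (l + 1) * l.factorial := by
  obtain ⟨C, K, ρ, hC, hK, h0, h1, hb⟩ := h.bound b₀ hb₀
  have hρ : 0 < 1 - ρ := by linarith
  have hinv : 1 ≤ 1 / (1 - ρ) := by rw [le_div_iff₀ hρ]; linarith
  have hA : 1 ≤ C * K * (1 / (1 - ρ)) :=
    one_le_mul_of_one_le_of_one_le (one_le_mul_of_one_le_of_one_le hC hK) hinv
  refine ⟨C * K * (1 / (1 - ρ)), hA, ?_⟩
  filter_upwards [hb] with b hb l
  have hs := hasSum_growth_bound C K l h0 h1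
  have hsum : Summable (fun m => ‖u l m b‖) :=
    Summable.of_nonneg_of_le (fun _ => norm_nonneg _) (hb l) hs.summable
  refine ⟨hsum, (hsum.tsum_le_tsum (hb l) hs.summable).trans ?_⟩
  rw [hs.tsum_eq]
  have e : (C * K * (1 / (1 - ρ))) ^ (l + 1) * l.factorial
      = C ^ (l + 1) * K ^ (l + 1) * l.factorial * (1 / (1 - ρ) ^ (l + 1)) := by
    rw [mul_pow, mul_pow, div_pow, one_pow]; ring
  rw [e]
  gcongr
  · exact le_self_pow₀ hC (Nat.succ_ne_zero l)
  · exact Nat.le_succ l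

theorem summable (h : SeriesFamily ħ κ D u) {b : ℂ} (hb : b ∈ D) (l : ℕ) :
    Summable (fun m => u l m b) := by
  obtain ⟨A, -, hA⟩ := h.norm_growth hb
  exact (hA.self_of_nhds l).1.of_norm

theorem exists_ball (h : SeriesFamily ħ κ D u) (hD : IsOpen D) {b : ℂ} (hb : b ∈ D) (l : ℕ) :
    ∃ U, IsOpen U ∧ b ∈ U ∧ U ⊆ D ∧ ∃ v : ℕ → ℝ, Summable v ∧ ∀ m, ∀ w ∈ U, ‖u l m w‖ ≤ v m := by
  obtain ⟨C, K, ρ, hC, hK, h0, h1, hev⟩ := h.bound b hb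
  obtain ⟨r, hr, hball⟩ := Metric.eventually_nhds_iff_ball.1 (hev.and (hD.mem_nhds hb))
  exact ⟨Metric.ball b r, Metric.isOpen_ball, Metric.mem_ball_self hr, fun w hw => (hball w hw).2,
    _, (hasSum_growth_bound C K l h0 h1).summable, fun m w hw => (hball w hw).1 l m⟩

theorem differentiable (h : SeriesFamily ħ κ D u) (l m : ℕ) : Differentiable ℂ (u l m) :=
  fun b => (h.hasDerivAt l m b).differentiableAt

theorem differentiableOn_tsum (h : SeriesFamily ħ κ D u) (hD : IsOpen D) (l : ℕ) :
    DifferentiableOn ℂ (fun b => ∑' m, u l m b) D := by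
  intro b hb
  obtain ⟨U, hU, hbU, -, v, hv, hle⟩ := h.exists_ball hD hb l
  exact ((Complex.differentiableOn_tsum_of_summable_norm hv
    (fun m => (h.differentiable l m).differentiableOn) hU hle).differentiableAt
      (hU.mem_nhds hbU)).differentiableWithinAt

theorem deriv_tsum (h : SeriesFamily ħ κ D u) (hD : IsOpen D) (l : ℕ) {b : ℂ} (hb : b ∈ D) :
    deriv (fun b => ∑' m, u l m b) b =
      (∑' m, u (l + 1) m b) / ħ + (κ + l) * ∑' m, u l m b := by
  obtain ⟨U, hU, hbU, -, v, hv, hle⟩ := h.exists_ball hD hb l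
  have h1 := Complex.hasSum_deriv_of_summable_norm hv
    (fun m => (h.differentiable l m).differentiableOn) hU hle hbU
  refine h1.unique ?_
  simp only [(h.hasDerivAt l _ b).deriv]
  exact ((h.summable hb (l + 1)).hasSum.div_const ħ).add ((h.summable hb l).hasSum.mul_left _)

/-- Termwise differentiation is legitimate by the local bounds, and the derivative relation of the
family is exactly one step of the tower. So the part of the $I$-function with larger $\beta_a$ is
determined by its $l=0$ part. -/
theorem tower_eq (h : SeriesFamily ħ κ D u) (hħ : ħ ≠ 0) (hD : IsOpen D) (l : ℕ) :
    Set.EqOn (tower ħ κ (fun b => ∑' m, u 0 m b) l) (fun b => ∑' m, u l m b) D := by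
  induction l with
  | zero => exact fun _ _ => rfl
  | succ l ih =>
    intro b hb
    simp only [tower, ih hb, (ih.eventuallyEq_of_mem (hD.mem_nhds hb)).deriv_eq]
    rw [h.deriv_tsum hD l hb]
    field_simp
    ring

end SeriesFamily

/-! ### The series of a superscript and of a subscript variable -/

open TrivSqZeroExt

theorem hasDerivAt_fst_degreeFactor (D : ℂ[ε]) (hD : D.fst = 0) (ħ : ℂ) (n k : ℤ) (b : ℂ) :
    HasDerivAt (fun b => (degreeFactor D ħ b n k).fst)
      ((n : ℂ) / 3 * (degreeFactor D ħ b n k).fst) b := by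
  have e : ∀ b, (degreeFactor D ħ b n k).fst
      = Complex.exp ((n : ℂ) / 3 * b) * (degreeFactor D ħ 0 n k).fst := by
    intro b
    rw [degreeFactor_eq_exp_mul]
    simp [hD]
  have := (((hasDerivAt_id b).const_mul ((n : ℂ) / 3)).cexp).mul_const (degreeFactor D ħ 0 n k).fst
  refine (this.congr_of_eventuallyEq (Eventually.of_forall e)).congr_deriv ?_
  rw [e b]
  simp
  ring

theorem hasDerivAt_snd_degreeFactor (D : ℂ[ε]) (hD : D.fst = 0) (ħ : ℂ) (n k : ℤ) (b : ℂ) :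
    HasDerivAt (fun b => (degreeFactor D ħ b n k).snd)
      ((n : ℂ) / 3 * (degreeFactor D ħ b n k).snd
        + D.snd / ħ * (degreeFactor D ħ b n k).fst) b := by
  have e : ∀ b, (degreeFactor D ħ b n k).snd
      = Complex.exp ((n : ℂ) / 3 * b) * ((degreeFactor D ħ 0 n k).snd
        + b / ħ * D.snd * (degreeFactor D ħ 0 n k).fst) := by
    intro b
    rw [degreeFactor_eq_exp_mul]
    simp [hD]
    ring
  have e' : (degreeFactor D ħ b n k).fst
      = Complex.exp ((n : ℂ) / 3 * b) * (degreeFactor D ħ 0 n k).fst := by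
    rw [degreeFactor_eq_exp_mul]
    simp [hD]
  have h1 := ((hasDerivAt_id b).const_mul ((n : ℂ) / 3)).cexp
  have h2 := ((((hasDerivAt_id b).div_const ħ).mul_const D.snd).mul_const
    (degreeFactor D ħ 0 n k).fst).const_add (degreeFactor D ħ 0 n k).snd
  refine ((h1.mul h2).congr_of_eventuallyEq (Eventually.of_forall e)).congr_deriv ?_
  rw [e b, e']
  simp
  ring

theorem fst_degreeFactor_add_three (D : ℂ[ε]) (hD : D.fst = 0) (ħ : ℂ) (hħ : ħ ≠ 0) (b : ℂ)
    (n k : ℤ) (hk : 0 ≤ k) : (degreeFactor D ħ b n (k + 3)).fst =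
      ((n : ℂ) - k) / 3 * ħ * (degreeFactor D ħ b n k).fst := by
  rw [degreeFactor_add_three D hD ħ hħ b n k hk]
  simp [hD]

theorem snd_degreeFactor_add_three (D : ℂ[ε]) (hD : D.fst = 0) (ħ : ℂ) (hħ : ħ ≠ 0) (b : ℂ)
    (n k : ℤ) (hk : 0 ≤ k) : (degreeFactor D ħ b n (k + 3)).snd =
      ((n : ℂ) - k) / 3 * ħ * (degreeFactor D ħ b n k).snd
        + D.snd * (degreeFactor D ħ b n k).fst := by
  rw [degreeFactor_add_three D hD ħ hħ b n k hk]
  simp [hD]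

/-- The operator $\hbar\,d/db$ multiplies a term by $D+\beta_v\hbar$, whereas raising $\beta_a$
multiplies it by $D+(\beta_v-\beta_a)\hbar$. The difference is $\beta_a\hbar$, with $\beta_a=k/3+l$.
-/
theorem hasDerivAt_fst_degreeFactor_add (D : ℂ[ε]) (hD : D.fst = 0) (ħ : ℂ) (hħ : ħ ≠ 0)
    (n : ℤ) (k l : ℕ) (b : ℂ) :
    HasDerivAt (fun b => (degreeFactor D ħ b n ((k + 3 * l : ℕ) : ℤ)).fst)
      ((degreeFactor D ħ b n ((k + 3 * (l + 1) : ℕ) : ℤ)).fst / ħ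
        + ((k : ℂ) / 3 + l) * (degreeFactor D ħ b n ((k + 3 * l : ℕ) : ℤ)).fst) b := by
  refine (hasDerivAt_fst_degreeFactor D hD ħ n _ b).congr_deriv ?_
  rw [show ((k + 3 * (l + 1) : ℕ) : ℤ) = ((k + 3 * l : ℕ) : ℤ) + 3 by push_cast; ring,
    fst_degreeFactor_add_three D hD ħ hħ _ _ _ (by positivity)]
  field_simp
  push_cast
  ring

theorem hasDerivAt_snd_degreeFactor_add (D : ℂ[ε]) (hD : D.fst = 0) (ħ : ℂ) (hħ : ħ ≠ 0)
    (n : ℤ) (k l : ℕ) (b : ℂ) :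
    HasDerivAt (fun b => (degreeFactor D ħ b n ((k + 3 * l : ℕ) : ℤ)).snd)
      ((degreeFactor D ħ b n ((k + 3 * (l + 1) : ℕ) : ℤ)).snd / ħ
        + ((k : ℂ) / 3 + l) * (degreeFactor D ħ b n ((k + 3 * l : ℕ) : ℤ)).snd) b := by
  refine (hasDerivAt_snd_degreeFactor D hD ħ n _ b).congr_deriv ?_
  rw [show ((k + 3 * (l + 1) : ℕ) : ℤ) = ((k + 3 * l : ℕ) : ℤ) + 3 by push_cast; ring,
    snd_degreeFactor_add_three D hD ħ hħ _ _ _ (by positivity)]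
  field_simp
  push_cast
  ring

/-- The growth of the hypergeometric factors in `β_a`, for a submultiplicative size `p`. -/
theorem degreeFactor_growth (p : ℂ[ε] → ℝ) (hp0 : ∀ A, 0 ≤ p A)
    (hp : ∀ A B, p (A * B) ≤ p A * p B) (D : ℂ[ε]) (hD : D.fst = 0)
    (hpD : ∀ x, p (D + inl x) ≤ 1 + ‖x‖) (ħ : ℂ) (hħ : ħ ≠ 0) (b : ℂ) (n : ℤ) (m k : ℕ)
    (hn : ∀ l : ℕ, ‖((n : ℂ) - (k + 3 * l : ℕ)) / 3‖ ≤ 2 * (m + l + 1)) (l : ℕ) :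
    p (degreeFactor D ħ b n ((k + 3 * l : ℕ) : ℤ)) ≤
      (1 + 2 * ‖ħ‖) ^ l * (l.factorial * ((m + l).choose l : ℝ)) * p (degreeFactor D ħ b n k) := by
  induction l with
  | zero => simp
  | succ l ih =>
    rw [show ((k + 3 * (l + 1) : ℕ) : ℤ) = ((k + 3 * l : ℕ) : ℤ) + 3 by push_cast; ring,
      degreeFactor_add_three D hD ħ hħ _ _ _ (by positivity)]
    have h1 : p (D + inl (((n : ℂ) - ((k + 3 * l : ℕ) : ℤ)) / 3 * ħ))
        ≤ (1 + 2 * ‖ħ‖) * (m + l + 1) := by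
      refine (hpD _).trans ?_
      rw [norm_mul]
      have := hn l
      have h3 : ‖((n : ℂ) - ((k + 3 * l : ℕ) : ℤ)) / 3‖ * ‖ħ‖ ≤ 2 * (m + l + 1) * ‖ħ‖ := by
        rw [Int.cast_natCast]
        gcongr
      have h4 : (0 : ℝ) ≤ m := by positivity
      have h5 : (0 : ℝ) ≤ l := by positivity
      nlinarith
    -- Each step contributes at most a constant times $m+l+1$; the product of these numbers is
    -- $(m+l)!/m!=l!\binom{m+l}{l}$.
    have hch : (((l + 1).factorial : ℝ) * ((m + (l + 1)).choose (l + 1) : ℝ))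
        = (m + l + 1) * (l.factorial * ((m + l).choose l : ℝ)) := by
      have := Nat.add_one_mul_choose_eq (m + l) l
      have h' : ((m + l : ℕ) + 1 : ℝ) * ((m + l).choose l : ℝ)
          = ((m + l + 1).choose (l + 1) : ℝ) * (l + 1) := by exact_mod_cast this
      rw [← add_assoc, Nat.factorial_succ]
      push_cast at h' ⊢
      linear_combination (-(l.factorial : ℝ)) * h'
    refine (hp _ _).trans ?_
    rw [hch, pow_succ]
    calc _ ≤ ((1 + 2 * ‖ħ‖) * (m + l + 1)) * ((1 + 2 * ‖ħ‖) ^ l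
        * (l.factorial * ((m + l).choose l : ℝ)) * p (degreeFactor D ħ b n k)) := by
          gcongr
          exact hp0 _
      _ = _ := by ring

end

/-! ### Convergence of the one-variable series in their half planes -/

section

open Filter TrivSqZeroExt

/-- The half plane of convergence of a superscript variable. -/
def supHalf : Set ℂ := {b | b.re < -(3 * Real.log 3)}

/-- The half plane of convergence of a subscript variable. -/
def subHalf : Set ℂ := {b | -(3 * Real.log 3) < b.re}

theorem isOpen_supHalf : IsOpen supHalf := isOpen_lt Complex.continuous_re continuous_const

theorem isOpen_subHalf : IsOpen subHalf := isOpen_lt continuous_const Complex.continuous_re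

theorem exp_neg_three_mul_log_three : Real.exp (-(3 * Real.log 3)) = 1 / 27 := by
  rw [Real.exp_neg, mul_comm, Real.exp_mul, Real.exp_log (by norm_num)]
  norm_num

/-- Every ratio of consecutive coefficients is at most $27$. The worst case is $k=2$, where $3m+1$
cancels and $9(3m+2)\le27(m+1)$ remains. -/
theorem norm_supCoeff_le {k : ℕ} (hk : k < 3) (m : ℕ) : ‖supCoeff k m‖ ≤ 27 ^ m := by
  induction m with
  | zero => simp [supCoeff]
  | succ m ih =>
    rw [supCoeff_succ, norm_mul, pow_succ]
    gcongr
    have hk' : (k : ℝ) ≤ 2 := by exact_mod_cast Nat.lt_succ_iff.1 hk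
    have hm : (0 : ℝ) ≤ m := by positivity
    have e : (9 * (3 * m + 1) * (3 * m + 2) / ((m + 1) * (3 * m + 3 - k)) : ℂ)
        = ((9 * (3 * m + 1) * (3 * m + 2) / ((m + 1) * (3 * m + 3 - k)) : ℝ) : ℂ) := by
      push_cast; rfl
    have hpos : (0 : ℝ) < (m + 1) * (3 * m + 3 - k) := mul_pos (by linarith) (by linarith)
    rw [e, Complex.norm_real, Real.norm_of_nonneg (div_nonneg (by positivity) hpos.le),
      div_le_iff₀ hpos]
    nlinarith

theorem norm_supHarmonic_le (m : ℕ) : ‖supHarmonic m‖ ≤ 7 * m := by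
  induction m with
  | zero => simp [supHarmonic]
  | succ m ih =>
    rw [supHarmonic_succ]
    refine (norm_add_le _ _).trans ?_
    have hm : (0 : ℝ) ≤ m := by positivity
    have e : (3 / (3 * m + 1) + 3 / (3 * m + 2) - 2 / (m + 1) : ℂ)
        = ((3 / (3 * m + 1) + 3 / (3 * m + 2) - 2 / (m + 1) : ℝ) : ℂ) := by
      push_cast; rfl
    have h1 : (3 / (3 * m + 1) : ℝ) ≤ 3 := (div_le_iff₀ (by positivity)).2 (by linarith)
    have h2 : (3 / (3 * m + 2) : ℝ) ≤ 2 := (div_le_iff₀ (by positivity)).2 (by linarith)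
    have h3 : (2 / (m + 1) : ℝ) ≤ 2 := (div_le_iff₀ (by positivity)).2 (by linarith)
    have h4 : (0 : ℝ) ≤ 3 / (3 * m + 1) := by positivity
    have h5 : (0 : ℝ) ≤ 3 / (3 * m + 2) := by positivity
    have h6 : (0 : ℝ) ≤ 2 / (m + 1) := by positivity
    have : |(3 / (3 * m + 1) + 3 / (3 * m + 2) - 2 / (m + 1) : ℝ)| ≤ 7 := by
      rw [abs_le]; constructor <;> linarith
    rw [e, Complex.norm_real, Real.norm_eq_abs]
    push_cast
    linarith

/-- With $N=3m+j$ the ratio is $N(N+k)/(27(N+1)(N+2))$, which is at most $1/27$ because $k\le2$. -/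
theorem norm_subCoeff_le (ħ : ℂ) (j : ℕ) {k : ℕ} (hk : k < 3) (m : ℕ) :
    ‖subCoeff ħ j k m‖ ≤ ‖subLead ħ j k‖ * (1 / 27) ^ m := by
  induction m with
  | zero => simp [subCoeff]
  | succ m ih =>
    rw [subCoeff_succ, norm_mul, pow_succ, ← mul_assoc]
    gcongr
    have hk' : (k : ℝ) ≤ 2 := by exact_mod_cast Nat.lt_succ_iff.1 hk
    have e : ((3 * m + j) * (3 * m + j + k) / (27 * (3 * m + j + 1) * (3 * m + j + 2)) : ℂ)
        = (((3 * m + j) * (3 * m + j + k) / (27 * (3 * m + j + 1) * (3 * m + j + 2)) : ℝ) : ℂ) := by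
      push_cast; rfl
    rw [e, Complex.norm_real, Real.norm_of_nonneg (by positivity),
      div_le_div_iff₀ (by positivity) (by norm_num)]
    have hN : (0 : ℝ) ≤ 3 * m + j := by positivity
    nlinarith

theorem norm_exp_natCast_mul (m : ℕ) (b : ℂ) :
    ‖Complex.exp (m * b)‖ = Real.exp b.re ^ m := by
  rw [Complex.norm_exp, ← Real.exp_nat_mul]
  simp

theorem exists_radius_supHalf {b₀ : ℂ} (hb₀ : b₀ ∈ supHalf) :
    ∃ ρ : ℝ, 0 < ρ ∧ ρ < 1 ∧ ∀ᶠ b in 𝓝 b₀, ∀ m : ℕ, 27 ^ m * ‖Complex.exp (m * b)‖ ≤ ρ ^ m := by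
  obtain ⟨r, hr, hr'⟩ := exists_between (show b₀.re < -(3 * Real.log 3) from hb₀)
  refine ⟨27 * Real.exp r, by positivity, ?_, ?_⟩
  · have := Real.exp_lt_exp.2 hr'
    rw [exp_neg_three_mul_log_three] at this
    linarith
  · filter_upwards [Complex.continuous_re.continuousAt.eventually (gt_mem_nhds hr)] with b hb m
    rw [norm_exp_natCast_mul, ← mul_pow]
    gcongr

/-- Bernoulli's inequality for $(\sigma/\rho)^m$. It absorbs the linear growth of the harmonic sums
into a slightly larger geometric ratio. -/
theorem one_add_natCast_mul_pow_le {ρ σ : ℝ} (h0 : 0 < ρ) (h : ρ < σ) (m : ℕ) :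
    (m : ℝ) * ρ ^ m ≤ ρ / (σ - ρ) * σ ^ m := by
  have h1 := one_add_mul_le_pow (a := (σ - ρ) / ρ)
    (by have : 0 < (σ - ρ) / ρ := div_pos (by linarith) h0
        linarith) m
  have e : 1 + (σ - ρ) / ρ = σ / ρ := by field_simp; ring
  rw [e, div_pow] at h1
  have h2 : (m : ℝ) * ((σ - ρ) / ρ) ≤ σ ^ m / ρ ^ m := by linarith
  rw [le_div_iff₀ (by positivity)] at h2
  have h3 : 0 < σ - ρ := by linarith
  calc (m : ℝ) * ρ ^ m = ρ / (σ - ρ) * (m * ((σ - ρ) / ρ) * ρ ^ m) := by field_simp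
    _ ≤ _ := by gcongr

theorem norm_sup_weight_le (m k l : ℕ) (hk : k < 3) :
    ‖(((3 * (m : ℤ) : ℤ) : ℂ) - (k + 3 * l : ℕ)) / 3‖ ≤ 2 * (m + l + 1) := by
  have hk' : (k : ℝ) ≤ 2 := by exact_mod_cast Nat.lt_succ_iff.1 hk
  have e : (((3 * (m : ℤ) : ℤ) : ℂ) - (k + 3 * l : ℕ)) / 3 = ((m - k / 3 - l : ℝ) : ℂ) := by
    push_cast; ring
  have hm : (0 : ℝ) ≤ m := by positivity
  have hl : (0 : ℝ) ≤ l := by positivity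
  have hk0 : (0 : ℝ) ≤ k := by positivity
  rw [e, Complex.norm_real, Real.norm_eq_abs, abs_le]
  constructor <;> linarith

theorem norm_sub_weight_le (m j k l : ℕ) (hj : j < 3) (hk : k < 3) :
    ‖(((-((3 * m + j : ℕ) : ℤ) : ℤ) : ℂ) - (k + 3 * l : ℕ)) / 3‖ ≤ 2 * (m + l + 1) := by
  have hk' : (k : ℝ) ≤ 2 := by exact_mod_cast Nat.lt_succ_iff.1 hk
  have hj' : (j : ℝ) ≤ 2 := by exact_mod_cast Nat.lt_succ_iff.1 hj
  have e : (((-((3 * m + j : ℕ) : ℤ) : ℤ) : ℂ) - (k + 3 * l : ℕ)) / 3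
      = ((-(m + j / 3 + k / 3 + l) : ℝ) : ℂ) := by
    push_cast; ring
  have hm : (0 : ℝ) ≤ m := by positivity
  have hl : (0 : ℝ) ≤ l := by positivity
  have hk0 : (0 : ℝ) ≤ k := by positivity
  have hj0 : (0 : ℝ) ≤ j := by positivity
  rw [e, Complex.norm_real, Real.norm_eq_abs, abs_le]
  constructor <;> linarith

theorem one_le_one_add_two_mul_norm (ħ : ℂ) : 1 ≤ 1 + 2 * ‖ħ‖ := by
  linarith [norm_nonneg ħ]

theorem seriesFamily_sup_fst {ħ : ℂ} (hħ : ħ ≠ 0) {k : ℕ} (hk : k < 3) :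
    SeriesFamily ħ ((k : ℂ) / 3) supHalf fun l m b =>
      (degreeFactor ε ħ b (3 * (m : ℤ)) ((k + 3 * l : ℕ) : ℤ)).fst where
  hasDerivAt l m b := hasDerivAt_fst_degreeFactor_add ε rfl ħ hħ _ k l b
  bound b₀ hb₀ := by
    obtain ⟨ρ, h0, h1, hρ⟩ := exists_radius_supHalf hb₀
    refine ⟨1, 1 + 2 * ‖ħ‖, ρ, le_rfl, one_le_one_add_two_mul_norm ħ, h0.le, h1, ?_⟩
    filter_upwards [hρ] with b hb l m
    have hg := degreeFactor_growth (fun A => ‖A.fst‖) (fun A => norm_nonneg _)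
      (fun A B => by simp) ε rfl (fun x => by simp) ħ hħ b (3 * (m : ℤ)) m k
      (fun l => norm_sup_weight_le m k l hk) l
    refine hg.trans ?_
    rw [one_mul]
    gcongr
    rw [fst_degreeFactor_eps ħ hħ b m k hk, norm_mul]
    exact (mul_le_mul_of_nonneg_right (norm_supCoeff_le hk m) (norm_nonneg _)).trans (hb m)

/-- The sum of the norms of the coordinates of a dual number. -/
def coeffNorm (A : ℂ[ε]) : ℝ := ‖A.fst‖ + ‖A.snd‖

theorem coeffNorm_mul_le (A B : ℂ[ε]) : coeffNorm (A * B) ≤ coeffNorm A * coeffNorm B := by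
  unfold coeffNorm
  simp only [fst_mul, snd_mul, norm_mul]
  have h := norm_add_le (A.fst • B.snd) (MulOpposite.op B.fst • A.snd)
  rw [norm_smul, op_smul_eq_smul, norm_smul] at h
  rw [op_smul_eq_smul]
  nlinarith [norm_nonneg A.fst, norm_nonneg B.fst, norm_nonneg A.snd, norm_nonneg B.snd,
    mul_nonneg (norm_nonneg A.snd) (norm_nonneg B.snd)]

/-- The $\varepsilon$-coefficient alone is not submultiplicative, so the growth in $l$ is estimated
for `coeffNorm`. The ratio is enlarged from $\rho$ to $\sigma<1$ to make room for the logarithm and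
the harmonic sums. -/
theorem seriesFamily_sup_snd {ħ : ℂ} (hħ : ħ ≠ 0) :
    SeriesFamily ħ 0 supHalf fun l m b =>
      (degreeFactor ε ħ b (3 * (m : ℤ)) ((3 * l : ℕ) : ℤ)).snd where
  hasDerivAt l m b := by
    simpa using hasDerivAt_snd_degreeFactor_add ε rfl ħ hħ (3 * (m : ℤ)) 0 l b
  bound b₀ hb₀ := by
    obtain ⟨ρ, h0, h1, hρ⟩ := exists_radius_supHalf hb₀
    obtain ⟨σ, h2, h3⟩ := exists_between h1
    have hσ : 0 < σ - ρ := by linarith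
    have hħ' : 0 < ‖ħ‖ := norm_pos_iff.2 hħ
    refine ⟨1 + (‖b₀‖ + 1 + 7 * (ρ / (σ - ρ))) / ‖ħ‖, 1 + 2 * ‖ħ‖, σ, ?_,
      one_le_one_add_two_mul_norm ħ, by linarith, h3, ?_⟩
    · have : 0 ≤ (‖b₀‖ + 1 + 7 * (ρ / (σ - ρ))) / ‖ħ‖ := by positivity
      linarith
    have hn : ∀ᶠ b in 𝓝 b₀, ‖b‖ < ‖b₀‖ + 1 :=
      continuous_norm.continuousAt.eventually (gt_mem_nhds (lt_add_one _))
    filter_upwards [hρ, hn] with b hb hbn l m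
    have hg := degreeFactor_growth coeffNorm (fun A => by unfold coeffNorm; positivity)
      coeffNorm_mul_le ε rfl (fun x => by simp [coeffNorm, add_comm]) ħ hħ b (3 * (m : ℤ)) m 0
      (fun l => norm_sup_weight_le m 0 l (by norm_num)) l
    simp only [zero_add] at hg
    refine (show _ ≤ _ from ?_).trans (hg.trans ?_)
    · exact le_add_of_nonneg_left (norm_nonneg _)
    have hbase : coeffNorm (degreeFactor ε ħ b (3 * (m : ℤ)) ((0 : ℕ) : ℤ))
        ≤ (1 + (‖b₀‖ + 1 + 7 * (ρ / (σ - ρ))) / ‖ħ‖) * σ ^ m := by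
      have f := fst_degreeFactor_eps ħ hħ b m 0 (by norm_num)
      have g := snd_degreeFactor_eps ħ hħ b m
      have hm := one_add_natCast_mul_pow_le h0 h2 m
      have hc : ‖supCoeff 0 m‖ * ‖Complex.exp (m * b)‖ ≤ ρ ^ m :=
        (mul_le_mul_of_nonneg_right (norm_supCoeff_le (by norm_num) m) (norm_nonneg _)).trans (hb m)
      have hρσ : ρ ^ m ≤ σ ^ m := by gcongr
      have hh := norm_supHarmonic_le m
      simp only [coeffNorm]
      rw [f, Nat.cast_zero, g, norm_mul, norm_mul, norm_div, norm_mul]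
      calc ‖supCoeff 0 m‖ * ‖Complex.exp (m * b)‖
            + ‖supCoeff 0 m‖ * ‖b + supHarmonic m‖ / ‖ħ‖ * ‖Complex.exp (m * b)‖
          = ‖supCoeff 0 m‖ * ‖Complex.exp (m * b)‖ * (1 + ‖b + supHarmonic m‖ / ‖ħ‖) := by ring
        _ ≤ ρ ^ m * (1 + (‖b₀‖ + 1 + 7 * m) / ‖ħ‖) := by
            gcongr
            exact (norm_add_le _ _).trans (by linarith)
        _ = ρ ^ m + ((‖b₀‖ + 1) * ρ ^ m + 7 * (m * ρ ^ m)) / ‖ħ‖ := by ring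
        _ ≤ σ ^ m + ((‖b₀‖ + 1) * σ ^ m + 7 * (ρ / (σ - ρ) * σ ^ m)) / ‖ħ‖ := by gcongr
        _ = _ := by ring
    calc _ ≤ (1 + 2 * ‖ħ‖) ^ l * (l.factorial * ((m + l).choose l : ℝ))
          * ((1 + (‖b₀‖ + 1 + 7 * (ρ / (σ - ρ))) / ‖ħ‖) * σ ^ m) := by gcongr
      _ = _ := by ring

theorem seriesFamily_sub {ħ : ℂ} (hħ : ħ ≠ 0) {j k : ℕ} (hj : j = 1 ∨ j = 2)
    (hk : k < 3) (hjk : ¬ 3 ∣ j + k) :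
    SeriesFamily ħ ((k : ℂ) / 3) subHalf fun l m b =>
      (degreeFactor 0 ħ b (-((3 * m + j : ℕ) : ℤ)) ((k + 3 * l : ℕ) : ℤ)).fst where
  hasDerivAt l m b := hasDerivAt_fst_degreeFactor_add 0 rfl ħ hħ _ k l b
  bound b₀ hb₀ := by
    obtain ⟨r, hr, hr'⟩ := exists_between (show -(3 * Real.log 3) < b₀.re from hb₀)
    have hρ : 1 / 27 * Real.exp (-r) < 1 := by
      have := Real.exp_lt_exp.2 hr
      rw [exp_neg_three_mul_log_three] at this
      rw [Real.exp_neg, ← div_eq_mul_inv, div_lt_one (Real.exp_pos r)]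
      exact this
    refine ⟨1 + ‖subLead ħ j k‖ * Real.exp (-(j / 3) * r), 1 + 2 * ‖ħ‖, 1 / 27 * Real.exp (-r),
      ?_, one_le_one_add_two_mul_norm ħ, by positivity, hρ, ?_⟩
    · have : 0 ≤ ‖subLead ħ j k‖ * Real.exp (-(j / 3) * r) := by positivity
      linarith
    filter_upwards [Complex.continuous_re.continuousAt.eventually (lt_mem_nhds hr')] with b hb l m
    have hg := degreeFactor_growth (fun A => ‖A.fst‖) (fun A => norm_nonneg _)
      (fun A B => by simp) 0 rfl (fun x => by simp) ħ hħ b (-((3 * m + j : ℕ) : ℤ)) m k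
      (fun l => norm_sub_weight_le m j k l (by omega) hk) l
    refine hg.trans ?_
    have hbase : ‖(degreeFactor 0 ħ b (-((3 * m + j : ℕ) : ℤ)) k).fst‖
        ≤ ‖subLead ħ j k‖ * Real.exp (-(j / 3) * r) * (1 / 27 * Real.exp (-r)) ^ m := by
      rw [fst_degreeFactor_zero ħ hħ b j k m hj hk hjk, norm_mul]
      have he : ‖Complex.exp (-(m + j / 3) * b)‖ ≤ Real.exp (-(j / 3) * r) * Real.exp (-r) ^ m := by
        rw [Complex.norm_exp, ← Real.exp_nat_mul, ← Real.exp_add, Real.exp_le_exp]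
        have e : (-(m + j / 3) * b : ℂ) = ((-(m + j / 3) : ℝ) : ℂ) * b := by push_cast; ring
        rw [e, Complex.re_ofReal_mul]
        have h0 : (0 : ℝ) ≤ m + j / 3 := by positivity
        nlinarith
      calc _ ≤ (‖subLead ħ j k‖ * (1 / 27) ^ m) * (Real.exp (-(j / 3) * r) * Real.exp (-r) ^ m) := by
            gcongr
            exact norm_subCoeff_le ħ j hk m
        _ = _ := by rw [mul_pow]; ring
    calc _ ≤ (1 + 2 * ‖ħ‖) ^ l * (l.factorial * ((m + l).choose l : ℝ))
          * ((1 + ‖subLead ħ j k‖ * Real.exp (-(j / 3) * r)) * (1 / 27 * Real.exp (-r)) ^ m) := by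
          gcongr
          refine hbase.trans ?_
          gcongr
          linarith
      _ = _ := by ring

end

section

open Filter TrivSqZeroExt

/-! ### Series of holomorphic functions of several variables -/

/-- Cauchy's estimate on the complex line $t\mapsto y+tv$, where the disc $|t|\le r/\|v\|$ stays in
the ball. -/
theorem norm_fderiv_le_of_norm_le_on_closedBall {E : Type*} [NormedAddCommGroup E]
    [NormedSpace ℂ E] {f : E → ℂ} {y : E} {r M : ℝ} (hr : 0 < r)
    (hf : ∀ x ∈ Metric.closedBall y r, DifferentiableAt ℂ f x)
    (hM : ∀ x ∈ Metric.closedBall y r, ‖f x‖ ≤ M) : ‖fderiv ℂ f y‖ ≤ M / r := by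
  have hM0 : 0 ≤ M := (norm_nonneg _).trans (hM y (Metric.mem_closedBall_self hr.le))
  refine ContinuousLinearMap.opNorm_le_bound _ (by positivity) fun v => ?_
  rcases eq_or_ne v 0 with rfl | hv
  · simp
  have hv' : 0 < ‖v‖ := norm_pos_iff.2 hv
  have hline : ∀ t ∈ Metric.closedBall (0 : ℂ) (r / ‖v‖), y + t • v ∈ Metric.closedBall y r := by
    intro t ht
    rw [mem_closedBall_zero_iff, le_div_iff₀ hv'] at ht
    rwa [mem_closedBall_iff_norm, add_sub_cancel_left, norm_smul]
  have hd : ∀ t ∈ Metric.closedBall (0 : ℂ) (r / ‖v‖),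
      HasDerivAt (fun t : ℂ => f (y + t • v)) (fderiv ℂ f (y + t • v) v) t := by
    intro t ht
    have h1 : HasDerivAt (fun t : ℂ => y + t • v) v t := by
      simpa using ((hasDerivAt_id t).smul_const v).const_add y
    exact (hf _ (hline t ht)).hasFDerivAt.comp_hasDerivAt t h1
  have h0 := (hd 0 (Metric.mem_closedBall_self (by positivity))).deriv
  simp only [zero_smul, add_zero] at h0
  rw [← h0]
  have hr' : 0 < r / ‖v‖ := by positivity
  have := Complex.norm_deriv_le_of_forall_mem_sphere_norm_le (f := fun t : ℂ => f (y + t • v)) hr'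
    (DifferentiableOn.diffContOnCl (by
      rw [closure_ball _ hr'.ne']
      exact fun t ht => (hd t ht).differentiableAt.differentiableWithinAt))
    fun t ht => hM _ (hline t (Metric.sphere_subset_closedBall ht))
  refine this.trans (le_of_eq ?_)
  field_simp

/-- Weierstrass' theorem in several variables: the Cauchy estimate turns a summable bound on the
functions into one on their derivatives over a smaller ball, and then the series may be
differentiated termwise. -/
theorem differentiableOn_tsum_of_summable_bound {E : Type*} [NormedAddCommGroup E]
    [NormedSpace ℂ E] {f : ℕ → E → ℂ} {u : ℕ → ℝ} (hu : Summable u) {U : Set E} (hU : IsOpen U)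
    (hf : ∀ l, DifferentiableOn ℂ (f l) U) (hle : ∀ l, ∀ x ∈ U, ‖f l x‖ ≤ u l) :
    DifferentiableOn ℂ (fun x => ∑' l, f l x) U := by
  intro x hx
  obtain ⟨r, hr, hball⟩ := Metric.isOpen_iff.1 hU x hx
  have hr2 : 0 < r / 2 := half_pos hr
  have hsub : ∀ y ∈ Metric.ball x (r / 2), Metric.closedBall y (r / 2) ⊆ U := by
    intro y hy z hz
    apply hball
    rw [Metric.mem_ball] at *
    rw [Metric.mem_closedBall] at hz
    linarith [dist_triangle z y x]
  have hda : ∀ l, ∀ y ∈ U, DifferentiableAt ℂ (f l) y := fun l y hy =>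
    (hf l).differentiableAt (hU.mem_nhds hy)
  let : NormedSpace ℝ E := NormedSpace.restrictScalars ℝ ℂ E
  have hx' : x ∈ Metric.ball x (r / 2) := Metric.mem_ball_self hr2
  refine (hasFDerivAt_tsum_of_isPreconnected (u := fun l => u l / (r / 2)) (hu.div_const _)
    Metric.isOpen_ball (convex_ball x (r / 2)).isPreconnected
    (fun l y hy => (hda l y (hsub y hy (Metric.mem_closedBall_self hr2.le))).hasFDerivAt)
    (fun l y hy => ?_) hx' ?_ hx').differentiableAt.differentiableWithinAt
  · exact norm_fderiv_le_of_norm_le_on_closedBall hr2 (fun z hz => hda l z (hsub y hy hz))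
      fun z hz => hle l z (hsub y hy hz)
  · exact Summable.of_norm_bounded hu fun l => hle l x hx

/-! ### Products of absolutely convergent series -/

theorem hasSum_mul_of_summable_norm {𝕜 ι ι' : Type*} [RCLike 𝕜] {f : ι → 𝕜} {g : ι' → 𝕜} {a b : 𝕜}
    (hf : Summable fun x => ‖f x‖) (hg : Summable fun x => ‖g x‖) (ha : HasSum f a)
    (hb : HasSum g b) : HasSum (fun p : ι × ι' => f p.1 * g p.2) (a * b) := by
  have h := summable_mul_of_summable_norm hf hg
  have := h.hasSum
  rwa [← tsum_mul_tsum_of_summable_norm hf hg, ha.tsum_eq, hb.tsum_eq] at this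

theorem hasSum_prod_fin {𝕜 : Type*} [RCLike 𝕜] (n : ℕ) (f : Fin n → ℕ → 𝕜)
    (hf : ∀ v, Summable fun m => ‖f v m‖) :
    Summable (fun m : Fin n → ℕ => ‖∏ v, f v (m v)‖) ∧
      HasSum (fun m : Fin n → ℕ => ∏ v, f v (m v)) (∏ v, ∑' m, f v m) := by
  induction n with
  | zero =>
    refine ⟨Summable.of_finite, ?_⟩
    simp
  | succ n ih =>
    obtain ⟨h1, h2⟩ := ih (fun v => f v.succ) fun v => hf v.succ
    let E : ℕ × (Fin n → ℕ) ≃ (Fin (n + 1) → ℕ) := Fin.consEquiv fun _ => ℕ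
    have e : ∀ p, ∏ v, f v (E p v) = f 0 p.1 * ∏ v : Fin n, f v.succ (p.2 v) := by
      intro p
      rw [Fin.prod_univ_succ]
      rfl
    clear_value E
    constructor
    · rw [← E.summable_iff]
      refine ((hf 0).mul_norm h1).congr fun p => ?_
      rw [Function.comp_apply, e]
    · have h3 := hasSum_mul_of_summable_norm (hf 0) h1 (hf 0).of_norm.hasSum h2
      rw [← E.hasSum_iff, Fin.prod_univ_succ]
      have e' : ((fun m : Fin (n + 1) → ℕ => ∏ v, f v (m v)) ∘ E)
          = fun p : ℕ × (Fin n → ℕ) => f 0 p.1 * ∏ v : Fin n, f v.succ (p.2 v) := funext e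
      rw [e']
      exact h3

/-! ### The factor of the variable `a` -/

/-- The factor of `a` in degree `β_a = N / 3`. -/
def aTerm (ħ c : ℂ) (N : ℕ) : ℂ := Complex.exp ((N : ℂ) / 3 * c) / (N.factorial * ħ ^ N)

theorem fst_hyperFactor_zero_natCast (ħ : ℂ) (N : ℕ) :
    (hyperFactor ħ 0 (N : ℚ)).fst = (N.factorial * ħ ^ N)⁻¹ := by
  induction N with
  | zero => simp [hyperFactor_zero]
  | succ N ih =>
    have hN : (0 : ℚ) ≤ N := by positivity
    rw [Nat.cast_add, Nat.cast_one, hyperFactor_add_one ħ 0 (by linarith), fst_mul, ih,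
      Nat.factorial_succ]
    simp only [fst_inv, fst_inl, zero_add]
    push_cast
    rw [← mul_inv, pow_succ]
    congr 1
    ring

theorem aFactor_natCast (ħ c : ℂ) (n : Fin 3 → ℤ) (N : ℕ) :
    aFactor ħ c (n, (N : ℤ)) = aTerm ħ c N := by
  simp only [aFactor, aTerm]
  rw [Int.cast_natCast, fst_hyperFactor_zero_natCast, div_eq_mul_inv]
  push_cast
  rfl

theorem norm_aTerm (ħ c : ℂ) (N : ℕ) :
    ‖aTerm ħ c N‖ = Real.exp (N / 3 * c.re) / (N.factorial * ‖ħ‖ ^ N) := by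
  rw [aTerm, norm_div, norm_mul, norm_pow, Complex.norm_natCast, Complex.norm_exp]
  congr 2
  have : ((N : ℂ) / 3 * c) = ((N / 3 : ℝ) : ℂ) * c := by push_cast; ring
  rw [this, Complex.re_ofReal_mul]

theorem differentiable_aTerm (ħ : ℂ) (N : ℕ) : Differentiable ℂ fun c => aTerm ħ c N := by
  unfold aTerm
  fun_prop

/-- The bound on `log |q_a|` for which factorial growth with constant `A` ensures convergence. -/
def logRadius (ħ : ℂ) (A : ℝ) : ℝ := Real.log (‖ħ‖ ^ 3 / (2 * A ^ 3))

/-- The quotient is at least a multinomial coefficient. The three towers, each growing like $l!$,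
are thus compensated by the denominator $(3\beta_a)!$ of the $a$-factor. -/
theorem factorial_pow_three_le (k l : ℕ) : l.factorial ^ 3 ≤ (k + 3 * l).factorial := by
  calc l.factorial ^ 3 = l.factorial * l.factorial * l.factorial := by ring
    _ ≤ (l + l).factorial * l.factorial := by
        gcongr
        exact Nat.le_of_dvd (Nat.factorial_pos _) (Nat.factorial_mul_factorial_dvd_factorial_add l l)
    _ ≤ (l + l + l).factorial :=
        Nat.le_of_dvd (Nat.factorial_pos _) (Nat.factorial_mul_factorial_dvd_factorial_add _ l)
    _ ≤ _ := Nat.factorial_le (by omega)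

/-- The constant in the geometric majorant of the series in `q_a`. -/
def majorantConst (ħ : ℂ) (k : ℕ) (A : ℝ) : ℝ :=
  Real.exp (k / 3 * logRadius ħ A) * A ^ 3 / ‖ħ‖ ^ k

/-- The radius is chosen so that $|q_a|A^3/|\hbar|^3<1/2$; the factorials cancel up to a quotient at
most $1$ and a geometric series in $1/2$ remains. -/
theorem norm_aTerm_mul_le {ħ : ℂ} (hħ : ħ ≠ 0) (k l : ℕ) {A : ℝ} (hA : 1 ≤ A) {c : ℂ}
    (hc : c.re < logRadius ħ A) (x : Fin 3 → ℝ) (hx0 : ∀ v, 0 ≤ x v)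
    (hx : ∀ v, x v ≤ A ^ (l + 1) * l.factorial) :
    ‖aTerm ħ c (k + 3 * l)‖ * ∏ v, x v ≤ majorantConst ħ k A * (1 / 2) ^ l := by
  have hħ' : 0 < ‖ħ‖ := norm_pos_iff.2 hħ
  have hA0 : 0 < A := by linarith
  rw [norm_aTerm]
  have hf : ((l.factorial : ℝ)) ^ 3 ≤ (k + 3 * l).factorial := by
    exact_mod_cast factorial_pow_three_le k l
  have hf0 : (0 : ℝ) < (k + 3 * l).factorial := by exact_mod_cast Nat.factorial_pos _
  have hprod : ∏ v, x v ≤ (A ^ (l + 1) * l.factorial) ^ 3 := by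
    calc ∏ v, x v ≤ ∏ _v : Fin 3, (A ^ (l + 1) * l.factorial) :=
          Finset.prod_le_prod (fun v _ => hx0 v) fun v _ => hx v
      _ = _ := by simp
  have hexp : Real.exp (((k + 3 * l : ℕ) : ℝ) / 3 * c.re)
      ≤ Real.exp (k / 3 * logRadius ħ A) * (‖ħ‖ ^ 3 / (2 * A ^ 3)) ^ l := by
    have h2 : ‖ħ‖ ^ 3 / (2 * A ^ 3) = Real.exp (logRadius ħ A) := by
      rw [logRadius, Real.exp_log (by positivity)]
    rw [h2, ← Real.exp_nat_mul, ← Real.exp_add, Real.exp_le_exp]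
    have e : (((k + 3 * l : ℕ) : ℝ) / 3 * c.re) = k / 3 * c.re + l * c.re := by push_cast; ring
    rw [e]
    gcongr
  calc _ ≤ (Real.exp (k / 3 * logRadius ħ A) * (‖ħ‖ ^ 3 / (2 * A ^ 3)) ^ l)
        / ((k + 3 * l).factorial * ‖ħ‖ ^ (k + 3 * l)) * (A ^ (l + 1) * l.factorial) ^ 3 := by
        have := Finset.prod_nonneg fun v (_ : v ∈ Finset.univ) => hx0 v
        gcongr
    _ = (Real.exp (k / 3 * logRadius ħ A) * A ^ 3 / ‖ħ‖ ^ k) * (1 / 2) ^ l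
        * (l.factorial ^ 3 / (k + 3 * l).factorial) := by
        rw [pow_add, pow_mul, div_pow, mul_pow, mul_pow, ← pow_mul, ← pow_mul, ← pow_mul,
          div_pow, one_pow]
        have : A ^ ((l + 1) * 3) = A ^ 3 * A ^ (3 * l) := by rw [← pow_add]; congr 1; ring
        rw [this]
        field_simp
    _ ≤ (Real.exp (k / 3 * logRadius ħ A) * A ^ 3 / ‖ħ‖ ^ k) * (1 / 2) ^ l * 1 := by
        gcongr
        exact (div_le_one hf0).2 hf
    _ = _ := by rw [mul_one]; rfl

/-- The sum over `β_a ∈ k / 3 + ℕ` of products of functions of the three variables. -/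
def towerSeries (ħ : ℂ) (k : ℕ) (Φ : Fin 3 → ℕ → ℂ → ℂ) (t : (Fin 3 → ℂ) × ℂ) : ℂ :=
  ∑' l, aTerm ħ t.2 (k + 3 * l) * ∏ v, Φ v l (t.1 v)

/-- The functions `Φ v` have factorial growth with constant `A` at the points near `b`. -/
def GrowthNear (Φ : Fin 3 → ℕ → ℂ → ℂ) (b : Fin 3 → ℂ) (A : ℝ) : Prop :=
  1 ≤ A ∧ ∀ᶠ b' in 𝓝 b, ∀ v l, ‖Φ v l (b' v)‖ ≤ A ^ (l + 1) * l.factorial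

theorem GrowthNear.summable {ħ : ℂ} (hħ : ħ ≠ 0) (k : ℕ) {Φ : Fin 3 → ℕ → ℂ → ℂ}
    {b : Fin 3 → ℂ} {A : ℝ} (h : GrowthNear Φ b A) {c : ℂ} (hc : c.re < logRadius ħ A) :
    Summable fun l => aTerm ħ c (k + 3 * l) * ∏ v, Φ v l (b v) := by
  refine Summable.of_norm_bounded
    ((summable_geometric_of_lt_one (by norm_num) one_half_lt_one).mul_left
      (majorantConst ħ k A)) fun l => ?_
  rw [norm_mul, norm_prod]
  exact norm_aTerm_mul_le hħ k l h.1 hc _ (fun v => norm_nonneg _) fun v => h.2.self_of_nhds v l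

theorem differentiableAt_towerSeries {ħ : ℂ} (hħ : ħ ≠ 0) (k : ℕ) {Φ : Fin 3 → ℕ → ℂ → ℂ}
    {D : Fin 3 → Set ℂ} (hD : ∀ v, IsOpen (D v)) (hΦ : ∀ v l, DifferentiableOn ℂ (Φ v l) (D v))
    {b : Fin 3 → ℂ} (hb : ∀ v, b v ∈ D v) {A : ℝ} (h : GrowthNear Φ b A) {c : ℂ}
    (hc : c.re < logRadius ħ A) : DifferentiableAt ℂ (towerSeries ħ k Φ) (b, c) := by
  have hev : ∀ᶠ b' in 𝓝 b, (∀ v l, ‖Φ v l (b' v)‖ ≤ A ^ (l + 1) * l.factorial) ∧ ∀ v, b' v ∈ D v :=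
    h.2.and (eventually_all.2 fun v =>
      (continuous_apply v).continuousAt.eventually ((hD v).mem_nhds (hb v)))
  obtain ⟨U, hU, hUo, hbU⟩ := eventually_nhds_iff.1 hev
  have hW : IsOpen {t : (Fin 3 → ℂ) × ℂ | t.1 ∈ U ∧ t.2.re < logRadius ħ A} :=
    (hUo.preimage _root_.continuous_fst).inter
      (isOpen_lt (Complex.continuous_re.comp _root_.continuous_snd) continuous_const)
  refine (differentiableOn_tsum_of_summable_bound
    ((summable_geometric_of_lt_one (by norm_num) one_half_lt_one).mul_left
      (majorantConst ħ k A)) hW (fun l => ?_) fun l t ht => ?_).differentiableAt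
      (hW.mem_nhds ⟨hbU, hc⟩)
  · refine DifferentiableOn.mul ?_ ?_
    · exact ((differentiable_aTerm ħ _).comp differentiable_snd).differentiableOn
    · have hd : ∀ v, DifferentiableOn ℂ (fun t : (Fin 3 → ℂ) × ℂ => Φ v l (t.1 v))
          {t | t.1 ∈ U ∧ t.2.re < logRadius ħ A} := fun v =>
        (hΦ v l).comp (t := D v) (f := fun t : (Fin 3 → ℂ) × ℂ => t.1 v) (by fun_prop)
          fun t ht => (hU t.1 ht.1).2 v
      simp only [Fin.prod_univ_three]
      exact ((hd 0).mul (hd 1)).mul (hd 2)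
  · rw [norm_mul, norm_prod]
    exact norm_aTerm_mul_le hħ k l h.1 ht.2 _ (fun v => norm_nonneg _) fun v => (hU t.1 ht.1).1 v l

/-- The joint absolute convergence of a product of series. -/
theorem hasSum_towerSeries {ħ : ℂ} (hħ : ħ ≠ 0) (k : ℕ) {u : Fin 3 → ℕ → ℕ → ℂ} {A : ℝ}
    (hA : 1 ≤ A) (hs : ∀ v l, Summable fun m => ‖u v l m‖)
    (hle : ∀ v l, ∑' m, ‖u v l m‖ ≤ A ^ (l + 1) * l.factorial) {c : ℂ}
    (hc : c.re < logRadius ħ A) :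
    HasSum (fun p : ℕ × (Fin 3 → ℕ) => aTerm ħ c (k + 3 * p.1) * ∏ v, u v p.1 (p.2 v))
      (∑' l, aTerm ħ c (k + 3 * l) * ∏ v, ∑' m, u v l m) := by
  have hgeo := (summable_geometric_of_lt_one (by norm_num) one_half_lt_one).mul_left
    (majorantConst ħ k A)
  -- Absolute summability over the pairs $(l,m)$ is proved fibre by fibre: norms of products factor,
  -- so each fibre sums to a product of norm series with factorial growth in $l$.
  have hnorm : ∀ l, HasSum (fun m : Fin 3 → ℕ => ‖aTerm ħ c (k + 3 * l) * ∏ v, u v l (m v)‖)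
      (‖aTerm ħ c (k + 3 * l)‖ * ∏ v, ∑' m, ‖u v l m‖) := by
    intro l
    have h := (hasSum_prod_fin 3 (fun v m => ‖u v l m‖)
      fun v => by simpa using hs v l).2.mul_left ‖aTerm ħ c (k + 3 * l)‖
    exact h.congr_fun fun m => by rw [norm_mul, norm_prod]
  have hsum : Summable fun p : ℕ × (Fin 3 → ℕ) =>
      aTerm ħ c (k + 3 * p.1) * ∏ v, u v p.1 (p.2 v) := by
    refine Summable.of_norm ((summable_prod_of_nonneg fun _ => norm_nonneg _).2
      ⟨fun l => (hnorm l).summable, ?_⟩)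
    refine Summable.of_nonneg_of_le (fun l => tsum_nonneg fun _ => norm_nonneg _) (fun l => ?_) hgeo
    rw [(hnorm l).tsum_eq]
    exact norm_aTerm_mul_le hħ k l hA hc _ (fun v => tsum_nonneg fun _ => norm_nonneg _) fun v => hle v l
  have h := hsum.hasSum
  rw [hsum.tsum_prod] at h
  have e : ∀ l, ∑' m : Fin 3 → ℕ, aTerm ħ c (k + 3 * l) * ∏ v, u v l (m v)
      = aTerm ħ c (k + 3 * l) * ∏ v, ∑' m, u v l m := fun l =>
    ((hasSum_prod_fin 3 (fun v m => u v l m) fun v => hs v l).2.mul_left _).tsum_eq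
  simpa only [e] using h

end

section

open Filter

/-! ### Binomial series and the Euler integral -/

/-- The coefficients of `(1 - w) ^ (-a)`. -/
def binCoeff (a : ℝ) (m : ℕ) : ℝ := ∏ i ∈ Finset.range m, (i + a) / (i + 1)

theorem binCoeff_succ (a : ℝ) (m : ℕ) : binCoeff a (m + 1) = binCoeff a m * ((m + a) / (m + 1)) :=
  Finset.prod_range_succ _ _

theorem binCoeff_nonneg {a : ℝ} (ha : 0 ≤ a) (m : ℕ) : 0 ≤ binCoeff a m :=
  Finset.prod_nonneg fun _ _ => by positivity

theorem ringChoose_neg_mul_neg_one_pow (a : ℝ) (m : ℕ) :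
    Ring.choose (-(a : ℂ)) m * (-1) ^ m = binCoeff a m := by
  induction m with
  | zero => simp [binCoeff]
  | succ m ih =>
    rw [binCoeff_succ, Complex.ofReal_mul, ← ih, Ring.choose_eq_smul, Ring.choose_eq_smul,
      descPochhammer_succ_right, Polynomial.smeval_mul, Nat.factorial_succ]
    have h : (m + 1 : ℂ) ≠ 0 := by exact_mod_cast Nat.succ_ne_zero m
    have h2 : (m.factorial : ℂ) ≠ 0 := by exact_mod_cast Nat.factorial_ne_zero m
    simp [Polynomial.smeval_sub, Polynomial.smeval_natCast, Polynomial.smeval_X, smul_eq_mul]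
    field_simp
    ring

theorem hasSum_one_sub_cpow (a : ℝ) {w : ℂ} (hw : ‖w‖ < 1) :
    HasSum (fun m => (binCoeff a m : ℂ) * w ^ m) ((1 - w) ^ (-(a : ℂ))) := by
  have h := (Complex.one_add_cpow_hasFPowerSeriesOnBall_zero (a := -(a : ℂ))).hasSum (y := -w)
    (by simpa [← ENNReal.ofReal_one, Metric.eball_ofReal] using hw)
  simp only [zero_add] at h
  rw [← sub_eq_add_neg] at h
  refine h.congr_fun fun m => ?_
  rw [← ringChoose_neg_mul_neg_one_pow]
  simp only [binomialSeries_apply, List.ofFn_const, List.prod_replicate, smul_eq_mul]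
  rw [neg_pow w]
  ring

/-- The plane cut along `[1, ∞)`. -/
def cutPlane : Set ℂ := {w | 1 - w ∈ Complex.slitPlane}

theorem isOpen_cutPlane : IsOpen cutPlane :=
  Complex.isOpen_slitPlane.preimage (continuous_const.sub continuous_id)

/-- The cut plane is star-shaped about $0$, so $1-tw$ stays off the branch cut of the power along
the whole path of Euler's integral. -/
theorem mul_mem_cutPlane {w : ℂ} (hw : w ∈ cutPlane) {t : ℝ} (h0 : 0 ≤ t) (h1 : t ≤ 1) :
    (t : ℂ) * w ∈ cutPlane := by
  simp only [cutPlane, Set.mem_ofPred_eq, Complex.mem_slitPlane_iff, Complex.sub_re, Complex.one_re,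
    Complex.sub_im, Complex.one_im, Complex.re_ofReal_mul, Complex.im_ofReal_mul, zero_sub,
    neg_ne_zero, mul_ne_zero_iff] at hw ⊢
  rcases h0.eq_or_lt with rfl | h0
  · left; simp
  · rcases hw with hw | hw
    · left
      rcases le_or_gt w.re 0 with h | h
      · nlinarith
      · nlinarith
    · right; exact ⟨h0.ne', hw⟩

theorem mem_cutPlane_of_norm_lt {w : ℂ} (hw : ‖w‖ < 1) : w ∈ cutPlane := by
  simp only [cutPlane, Set.mem_ofPred_eq, Complex.mem_slitPlane_iff]
  left
  have := (Complex.abs_re_le_norm w).trans_lt hw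
  rw [abs_lt] at this
  simp
  linarith

/-- Euler's integral for `B(a, a) ₂F₁(a, a; 2a; w)`. -/
def eulerIntegral (a : ℝ) (w : ℂ) : ℂ :=
  ∫ t in (0 : ℝ)..1,
    (t : ℂ) ^ ((a : ℂ) - 1) * (1 - (t : ℂ)) ^ ((a : ℂ) - 1) * (1 - t * w) ^ (-(a : ℂ))

theorem continuousOn_one_sub_mul_cpow (s : ℂ) :
    ContinuousOn (fun p : ℝ × ℂ => (1 - (p.1 : ℂ) * p.2) ^ s) (Set.Icc 0 1 ×ˢ cutPlane) := by
  refine ContinuousOn.cpow_const (by fun_prop) fun p hp => ?_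
  exact mul_mem_cutPlane hp.2 hp.1.1 hp.1.2

theorem intervalIntegrable_beta_mul {a : ℝ} (ha : 0 < a) {g : ℝ → ℂ}
    (hg : ContinuousOn g (Set.Icc 0 1)) :
    IntervalIntegrable (fun t : ℝ => (t : ℂ) ^ ((a : ℂ) - 1) * (1 - (t : ℂ)) ^ ((a : ℂ) - 1) * g t)
      MeasureTheory.volume 0 1 := by
  refine (Complex.betaIntegral_convergent (u := a) (v := a) (by simpa) (by simpa)).mul_continuousOn ?_
  rwa [Set.uIcc_of_le zero_le_one]

/-- Differentiation under the integral sign. The endpoint singularities sit in the integrable beta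
kernel, and the derivative of the remaining factor is continuous, hence bounded for $w$ in a compact
disc. -/
theorem differentiableOn_eulerIntegral {a : ℝ} (ha : 0 < a) :
    DifferentiableOn ℂ (eulerIntegral a) cutPlane := by
  intro w₀ hw₀
  obtain ⟨r, hr, hball⟩ := Metric.isOpen_iff.1 isOpen_cutPlane w₀ hw₀
  have hsub : Metric.closedBall w₀ (r / 2) ⊆ cutPlane :=
    (Metric.closedBall_subset_ball (by linarith)).trans hball
  set F' : ℂ → ℝ → ℂ := fun w t =>
    (a : ℂ) * t * (1 - t * w) ^ (-(a : ℂ) - 1) with hF'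
  have hcont : ContinuousOn (fun p : ℝ × ℂ => F' p.2 p.1) (Set.Icc 0 1 ×ˢ cutPlane) :=
    ContinuousOn.mul (by fun_prop) (continuousOn_one_sub_mul_cpow _)
  obtain ⟨C, hC⟩ := (isCompact_Icc.prod (isCompact_closedBall w₀ (r / 2))).exists_bound_of_continuousOn
    (hcont.mono (Set.prod_mono_right hsub))
  have hslice : ∀ w ∈ cutPlane, ∀ s : ℂ, ContinuousOn (fun t : ℝ => (1 - (t : ℂ) * w) ^ s)
      (Set.Icc 0 1) := fun w hw s =>
    (continuousOn_one_sub_mul_cpow s).comp (f := fun t : ℝ => (t, w)) (by fun_prop)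
      fun t ht => ⟨ht, hw⟩
  have hint : ∀ w ∈ cutPlane, ∀ s : ℂ, IntervalIntegrable (fun t : ℝ => (t : ℂ) ^ ((a : ℂ) - 1)
      * (1 - (t : ℂ)) ^ ((a : ℂ) - 1) * (1 - t * w) ^ s) MeasureTheory.volume 0 1 :=
    fun w hw s => intervalIntegrable_beta_mul ha (hslice w hw s)
  have hIoc : Set.uIoc (0 : ℝ) 1 ⊆ Set.Icc 0 1 := by
    rw [Set.uIoc_of_le zero_le_one]; exact Set.Ioc_subset_Icc_self
  have key := intervalIntegral.hasDerivAt_integral_of_dominated_loc_of_deriv_le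
    (μ := MeasureTheory.volume) (a := 0) (b := 1)
    (F := fun w (t : ℝ) => (t : ℂ) ^ ((a : ℂ) - 1) * (1 - (t : ℂ)) ^ ((a : ℂ) - 1)
      * (1 - t * w) ^ (-(a : ℂ)))
    (F' := fun w (t : ℝ) => (t : ℂ) ^ ((a : ℂ) - 1) * (1 - (t : ℂ)) ^ ((a : ℂ) - 1) * F' w t)
    (bound := fun t => ‖(t : ℂ) ^ ((a : ℂ) - 1) * (1 - (t : ℂ)) ^ ((a : ℂ) - 1)‖ * C)
    (x₀ := w₀) (Metric.closedBall_mem_nhds w₀ (half_pos hr)) ?_ (hint w₀ hw₀ _) ?_ ?_ ?_ ?_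
  · exact key.2.differentiableAt.differentiableWithinAt
  · filter_upwards [isOpen_cutPlane.mem_nhds hw₀] with w hw
    exact (intervalIntegrable_iff.1 (hint w hw _)).aestronglyMeasurable
  · exact (intervalIntegrable_iff.1 (intervalIntegrable_beta_mul ha
      (ContinuousOn.mul (by fun_prop) (hslice w₀ hw₀ _)))).aestronglyMeasurable
  · refine Eventually.of_forall fun t ht w hw => ?_
    rw [norm_mul]
    gcongr
    exact hC (t, w) ⟨hIoc ht, hw⟩
  · exact ((Complex.betaIntegral_convergent (u := a) (v := a) (by simpa) (by simpa)).norm).mul_const C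
  · refine Eventually.of_forall fun t ht w hw => ?_
    refine HasDerivAt.const_mul _ ?_
    have hs : 1 - (t : ℂ) * w ∈ Complex.slitPlane :=
      mul_mem_cutPlane (hsub hw) (hIoc ht).1 (hIoc ht).2
    have h1 : HasDerivAt (fun w : ℂ => 1 - (t : ℂ) * w) (-(t : ℂ)) w := by
      simpa using ((hasDerivAt_id w).const_mul (t : ℂ)).const_sub 1
    refine (h1.cpow_const hs).congr_deriv ?_
    simp only [hF']
    ring

theorem betaIntegral_add_one_left {u v : ℂ} (hu : 0 < u.re) (hv : 0 < v.re) :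
    Complex.betaIntegral (u + 1) v = u / (u + v) * Complex.betaIntegral u v := by
  have hu0 : u ≠ 0 := by rintro rfl; simp at hu
  have huv : u + v ≠ 0 := by
    intro h
    have := congrArg Complex.re h
    simp at this
    linarith
  rw [Complex.betaIntegral_eq_Gamma_mul_div _ _ (by simp; linarith) hv,
    Complex.betaIntegral_eq_Gamma_mul_div _ _ hu hv, add_right_comm, Complex.Gamma_add_one u hu0,
    Complex.Gamma_add_one _ huv]
  have hG : Complex.Gamma (u + v) ≠ 0 := Complex.Gamma_ne_zero_of_re_pos (by simp; linarith)
  field_simp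

theorem betaIntegral_add_natCast {a : ℝ} (ha : 0 < a) (m : ℕ) :
    Complex.betaIntegral (a + m) a =
      (∏ i ∈ Finset.range m, ((i + a) / (i + 2 * a) : ℂ)) * Complex.betaIntegral a a := by
  induction m with
  | zero => simp
  | succ m ih =>
    have hre : 0 < ((a : ℂ) + m).re := by simp; positivity
    rw [Nat.cast_succ, ← add_assoc, betaIntegral_add_one_left hre (by simpa), ih,
      Finset.prod_range_succ, show (a + m + a : ℂ) = m + 2 * a by ring, add_comm (a : ℂ) m]
    ring

/-- The coefficients of `₂F₁(a, a; 2a; w)`. -/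
def eulerCoeff (a : ℝ) (m : ℕ) : ℂ :=
  ∏ i ∈ Finset.range m, ((i + a) ^ 2 / ((i + 1) * (i + 2 * a)) : ℂ)

theorem eulerCoeff_eq (a : ℝ) (m : ℕ) : eulerCoeff a m =
    binCoeff a m * ∏ i ∈ Finset.range m, ((i + a) / (i + 2 * a) : ℂ) := by
  rw [eulerCoeff, binCoeff, Complex.ofReal_prod, ← Finset.prod_mul_distrib]
  refine Finset.prod_congr rfl fun i _ => ?_
  push_cast
  rw [div_mul_div_comm, pow_two]

/-- Expand $(1-tw)^{-a}$ and integrate termwise; since its binomial coefficients are nonnegative,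
the sum at $|w|$ dominates uniformly in $t$. The shifted beta integrals supply the remaining
Pochhammer quotient. -/
theorem hasSum_eulerIntegral {a : ℝ} (ha : 0 < a) {w : ℂ} (hw : ‖w‖ < 1) :
    HasSum (fun m => eulerCoeff a m * w ^ m * Complex.betaIntegral a a) (eulerIntegral a w) := by
  have hb := Complex.betaIntegral_convergent (u := a) (v := a) (by simpa) (by simpa)
  have hIoc : ∀ t ∈ Set.uIoc (0 : ℝ) 1, 0 < t ∧ t ≤ 1 := by
    intro t ht
    rwa [Set.uIoc_of_le zero_le_one] at ht
  have hsum : Summable fun m => binCoeff a m * ‖w‖ ^ m := by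
    have := (hasSum_one_sub_cpow a hw).summable.norm
    refine this.congr fun m => ?_
    rw [norm_mul, norm_pow, Complex.norm_real, Real.norm_of_nonneg (binCoeff_nonneg ha.le m)]
  set β : ℝ → ℂ := fun t => (t : ℂ) ^ ((a : ℂ) - 1) * (1 - (t : ℂ)) ^ ((a : ℂ) - 1) with hβ
  have h := intervalIntegral.hasSum_integral_of_dominated_convergence
    (μ := MeasureTheory.volume) (a := 0) (b := 1)
    (F := fun m (t : ℝ) => β t * ((binCoeff a m : ℂ) * (t * w) ^ m))
    (f := fun t : ℝ => β t * (1 - t * w) ^ (-(a : ℂ)))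
    (fun m t => ‖β t‖ * (binCoeff a m * ‖w‖ ^ m)) ?_ ?_ ?_ ?_ ?_
  · refine h.congr_fun fun m => ?_
    have e : ∫ t in (0 : ℝ)..1, β t * ((binCoeff a m : ℂ) * (t * w) ^ m)
        = (binCoeff a m : ℂ) * w ^ m * Complex.betaIntegral (a + m) a := by
      rw [Complex.betaIntegral, ← intervalIntegral.integral_const_mul]
      refine intervalIntegral.integral_congr_ae (Eventually.of_forall fun t ht => ?_)
      have ht0 : (t : ℂ) ≠ 0 := by exact_mod_cast (hIoc t ht).1.ne'
      rw [show (a + m - 1 : ℂ) = (a - 1) + m by ring, Complex.cpow_add _ _ ht0,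
        Complex.cpow_natCast, mul_pow]
      simp only [hβ]
      ring
    rw [e, betaIntegral_add_natCast ha, eulerCoeff_eq]
    ring
  · intro m
    exact (intervalIntegrable_iff.1 (intervalIntegrable_beta_mul ha
      (g := fun t : ℝ => (binCoeff a m : ℂ) * (t * w) ^ m)
      (Continuous.continuousOn (by fun_prop)))).aestronglyMeasurable
  · refine fun m => Eventually.of_forall fun t ht => ?_
    rw [norm_mul (β t), norm_mul (binCoeff a m : ℂ), norm_pow, norm_mul (t : ℂ), Complex.norm_real,
      Complex.norm_real,
      Real.norm_of_nonneg (binCoeff_nonneg ha.le m), Real.norm_of_nonneg (hIoc t ht).1.le]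
    have := binCoeff_nonneg ha.le m
    have h1 : t * ‖w‖ ≤ ‖w‖ := mul_le_of_le_one_left (norm_nonneg _) (hIoc t ht).2
    have h2 : 0 ≤ t * ‖w‖ := mul_nonneg (hIoc t ht).1.le (norm_nonneg _)
    gcongr
  · exact Eventually.of_forall fun t _ => hsum.mul_left _
  · simp only [tsum_mul_left]
    exact hb.norm.mul_const _
  · refine Eventually.of_forall fun t ht => ?_
    refine (hasSum_one_sub_cpow a ?_).mul_left _
    rw [norm_mul, Complex.norm_real, Real.norm_of_nonneg (hIoc t ht).1.le]
    exact (mul_le_of_le_one_left (norm_nonneg _) (hIoc t ht).2).trans_lt hw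

theorem betaIntegral_self_ne_zero {a : ℝ} (ha : 0 < a) : Complex.betaIntegral a a ≠ 0 := by
  have h := Complex.Gamma_ne_zero_of_re_pos (s := (a : ℂ)) (by simpa)
  rw [Complex.betaIntegral_eq_Gamma_mul_div _ _ (by simpa) (by simpa)]
  exact div_ne_zero (mul_ne_zero h h) (Complex.Gamma_ne_zero_of_re_pos (by simp; linarith))

end

section

open Filter

/-! ### The hypergeometric differential equation -/

/-- The operator `θ² - 27 eᵇ (θ + 1/3) (θ + 2/3)`, `θ = d/db`. -/
def hypergeomOp (y : ℂ → ℂ) (b : ℂ) : ℂ :=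
  (1 - 27 * Complex.exp b) * deriv (deriv y) b - 27 * Complex.exp b * deriv y b
    - 6 * Complex.exp b * y b

theorem hypergeomOp_differentiableOn {D : Set ℂ} (hD : IsOpen D) {y : ℂ → ℂ}
    (hy : DifferentiableOn ℂ y D) : DifferentiableOn ℂ (hypergeomOp y) D := by
  have h1 := hy.deriv hD
  have h2 := h1.deriv hD
  have he : DifferentiableOn ℂ Complex.exp D := Complex.differentiable_exp.differentiableOn
  exact ((((he.const_mul 27).const_sub 1).mul h2).sub ((he.const_mul 27).mul h1)).sub
    ((he.const_mul 6).mul hy)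

theorem hypergeomOp_congr {D : Set ℂ} (hD : IsOpen D) {y y' : ℂ → ℂ} (h : Set.EqOn y y' D) :
    Set.EqOn (hypergeomOp y) (hypergeomOp y') D := by
  have h1 : Set.EqOn (deriv y) (deriv y') D := fun b hb =>
    (h.eventuallyEq_of_mem (hD.mem_nhds hb)).deriv_eq
  have h2 : Set.EqOn (deriv (deriv y)) (deriv (deriv y')) D := fun b hb =>
    (h1.eventuallyEq_of_mem (hD.mem_nhds hb)).deriv_eq
  intro b hb
  simp only [hypergeomOp, h hb, h1 hb, h2 hb]

theorem hypergeomOp_add {D : Set ℂ} (hD : IsOpen D) {y y' : ℂ → ℂ} (hy : DifferentiableOn ℂ y D)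
    (hy' : DifferentiableOn ℂ y' D) {b : ℂ} (hb : b ∈ D) :
    hypergeomOp (fun b => y b + y' b) b = hypergeomOp y b + hypergeomOp y' b := by
  have h1 : Set.EqOn (deriv fun b => y b + y' b) (fun b => deriv y b + deriv y' b) D :=
    fun b hb => deriv_fun_add (hy.differentiableAt (hD.mem_nhds hb))
      (hy'.differentiableAt (hD.mem_nhds hb))
  have h2 : deriv (deriv fun b => y b + y' b) b = deriv (deriv y) b + deriv (deriv y') b := by
    rw [(h1.eventuallyEq_of_mem (hD.mem_nhds hb)).deriv_eq]
    exact deriv_fun_add ((hy.deriv hD).differentiableAt (hD.mem_nhds hb))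
      ((hy'.deriv hD).differentiableAt (hD.mem_nhds hb))
  simp only [hypergeomOp, h1 hb, h2]
  ring

theorem hypergeomOp_const_mul (c : ℂ) (y : ℂ → ℂ) (b : ℂ) :
    hypergeomOp (fun b => c * y b) b = c * hypergeomOp y b := by
  have h1 : (deriv fun b => c * y b) = fun b => c * deriv y b := by
    funext b; exact deriv_const_mul_field c
  simp only [hypergeomOp, h1, deriv_const_mul_field]
  ring

/-- The series `∑ u m` is dominated near every point of `D`. -/
def LocallyDominated (u : ℕ → ℂ → ℂ) (D : Set ℂ) : Prop :=
  ∀ b ∈ D, ∃ U, IsOpen U ∧ b ∈ U ∧ ∃ v : ℕ → ℝ, Summable v ∧ ∀ m, ∀ w ∈ U, ‖u m w‖ ≤ v m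

theorem LocallyDominated.hasSum {u : ℕ → ℂ → ℂ} {D : Set ℂ} (H : LocallyDominated u D) {b : ℂ}
    (hb : b ∈ D) : HasSum (fun m => u m b) (∑' m, u m b) := by
  obtain ⟨U, -, hbU, v, hv, hle⟩ := H b hb
  exact (Summable.of_norm_bounded hv fun m => hle m b hbU).hasSum

theorem LocallyDominated.hasSum_deriv {u u' : ℕ → ℂ → ℂ} {D : Set ℂ} (H : LocallyDominated u D)
    (hu : ∀ m b, HasDerivAt (u m) (u' m b) b) {b : ℂ} (hb : b ∈ D) :
    HasSum (fun m => u' m b) (deriv (fun b => ∑' m, u m b) b) := by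
  obtain ⟨U, hU, hbU, v, hv, hle⟩ := H b hb
  have := Complex.hasSum_deriv_of_summable_norm hv
    (fun m w _ => (hu m w).differentiableAt.differentiableWithinAt) hU hle hbU
  simpa only [(hu _ b).deriv] using this

theorem LocallyDominated.deriv {u u' : ℕ → ℂ → ℂ} {D : Set ℂ} (H : LocallyDominated u D)
    (hu : ∀ m b, HasDerivAt (u m) (u' m b) b) : LocallyDominated u' D := by
  intro b hb
  obtain ⟨U, hU, hbU, v, hv, hle⟩ := H b hb
  obtain ⟨r, hr, hball⟩ := Metric.isOpen_iff.1 hU b hbU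
  refine ⟨Metric.ball b (r / 2), Metric.isOpen_ball, Metric.mem_ball_self (half_pos hr),
    fun m => v m / (r / 2), hv.div_const _, fun m w hw => ?_⟩
  rw [← (hu m w).deriv]
  refine Complex.norm_deriv_le_of_forall_mem_sphere_norm_le (half_pos hr)
    (Differentiable.diffContOnCl fun w => (hu m w).differentiableAt) fun z hz => hle m z (hball ?_)
  rw [Metric.mem_ball] at *
  rw [Metric.mem_sphere] at hz
  linarith [dist_triangle z w b]

theorem LocallyDominated.hasSum_deriv_deriv {u u' u'' : ℕ → ℂ → ℂ} {D : Set ℂ} (hD : IsOpen D)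
    (H : LocallyDominated u D) (hu : ∀ m b, HasDerivAt (u m) (u' m b) b)
    (hu' : ∀ m b, HasDerivAt (u' m) (u'' m b) b) {b : ℂ} (hb : b ∈ D) :
    HasSum (fun m => u'' m b) (_root_.deriv (_root_.deriv fun b => ∑' m, u m b) b) := by
  have h1 : Set.EqOn (_root_.deriv fun b => ∑' m, u m b) (fun b => ∑' m, u' m b) D :=
    fun b hb => (H.hasSum_deriv hu hb).tsum_eq.symm
  rw [(h1.eventuallyEq_of_mem (hD.mem_nhds hb)).deriv_eq]
  exact (H.deriv hu).hasSum_deriv hu' hb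

theorem LocallyDominated.hasSum_hypergeomOp {u u' u'' : ℕ → ℂ → ℂ} {D : Set ℂ} (hD : IsOpen D)
    (H : LocallyDominated u D) (hu : ∀ m b, HasDerivAt (u m) (u' m b) b)
    (hu' : ∀ m b, HasDerivAt (u' m) (u'' m b) b) {b : ℂ} (hb : b ∈ D) :
    HasSum (fun m => u'' m b -
      Complex.exp b * (27 * u'' m b + 27 * u' m b + 6 * u m b))
      (hypergeomOp (fun b => ∑' m, u m b) b) := by
  have h2 := H.hasSum_deriv_deriv hD hu hu' hb
  have h1 := H.hasSum_deriv hu hb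
  have h0 := H.hasSum hb
  have := ((h2.mul_left (1 - 27 * Complex.exp b)).sub (h1.mul_left (27 * Complex.exp b))).sub
    (h0.mul_left (6 * Complex.exp b))
  exact this.congr_fun fun m => by ring

/-- A series in increasing powers of `eᵇ` solves the equation when its terms satisfy the recursion. -/
theorem hypergeomOp_tsum_eq_zero_of_up {u u' u'' : ℕ → ℂ → ℂ} {D : Set ℂ} (hD : IsOpen D)
    (H : LocallyDominated u D) (hu : ∀ m b, HasDerivAt (u m) (u' m b) b)
    (hu' : ∀ m b, HasDerivAt (u' m) (u'' m b) b) {b : ℂ} (hb : b ∈ D) (h0 : u'' 0 b = 0)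
    (hrec : ∀ m, u'' (m + 1) b = Complex.exp b * (27 * u'' m b + 27 * u' m b + 6 * u m b)) :
    hypergeomOp (fun b => ∑' m, u m b) b = 0 := by
  have h2 := H.hasSum_deriv_deriv hD hu hu' hb
  -- The zeroth second derivative vanishes, so $\theta^2y$ is also the sum of the shifted terms. The
  -- recursion then cancels it against the rest of the operator.
  have h2' := (hasSum_nat_add_iff' 1).2 h2
  simp only [Finset.sum_range_one, h0, sub_zero] at h2'
  have h3 := h2.sub h2'
  rw [sub_self] at h3
  refine (H.hasSum_hypergeomOp hD hu hu' hb).unique (h3.congr_fun fun m => ?_)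
  rw [← hrec]

/-- A series in decreasing powers of `eᵇ` solves the equation when its terms satisfy the recursion. -/
theorem hypergeomOp_tsum_eq_zero_of_down {u u' u'' : ℕ → ℂ → ℂ} {D : Set ℂ} (hD : IsOpen D)
    (H : LocallyDominated u D) (hu : ∀ m b, HasDerivAt (u m) (u' m b) b)
    (hu' : ∀ m b, HasDerivAt (u' m) (u'' m b) b) {b : ℂ} (hb : b ∈ D)
    (h0 : Complex.exp b * (27 * u'' 0 b + 27 * u' 0 b + 6 * u 0 b) = 0)
    (hrec : ∀ m, Complex.exp b * (27 * u'' (m + 1) b + 27 * u' (m + 1) b + 6 * u (m + 1) b)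
      = u'' m b) :
    hypergeomOp (fun b => ∑' m, u m b) b = 0 := by
  have h2 := H.hasSum_deriv_deriv hD hu hu' hb
  have hv : HasSum (fun m => Complex.exp b * (27 * u'' m b + 27 * u' m b + 6 * u m b))
      (_root_.deriv (_root_.deriv fun b => ∑' m, u m b) b) := by
    refine (hasSum_nat_add_iff' 1).1 ?_
    simp only [Finset.sum_range_one, h0, sub_zero, hrec]
    exact h2
  have h3 := h2.sub hv
  rw [sub_self] at h3
  exact (H.hasSum_hypergeomOp hD hu hu' hb).unique h3

/-! ### Uniqueness -/

/-- The ray accumulates at the chosen point, so the identity theorem applies. This reduces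
identities on a half strip to positive real arguments, where powers have no branch ambiguity. -/
theorem eqOn_of_eventually_ray {D : Set ℂ} (hD : IsOpen D) (hc : IsPreconnected D) {f g : ℂ → ℂ}
    (hf : DifferentiableOn ℂ f D) (hg : DifferentiableOn ℂ g D) {β₀ : ℝ}
    (hβ₀ : (β₀ + Real.pi * Complex.I : ℂ) ∈ D)
    (h : ∀ᶠ β : ℝ in 𝓝 β₀, f (β + Real.pi * Complex.I) = g (β + Real.pi * Complex.I)) :
    Set.EqOn f g D := by
  refine (hf.analyticOnNhd hD).eqOn_of_preconnected_of_frequently_eq (hg.analyticOnNhd hD) hc hβ₀ ?_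
  have hT : Tendsto (fun β : ℝ => (β + Real.pi * Complex.I : ℂ)) (𝓝[≠] β₀)
      (𝓝[≠] (β₀ + Real.pi * Complex.I : ℂ)) := by
    refine tendsto_nhdsWithin_of_tendsto_nhds_of_eventually_within _ ?_ ?_
    · exact (Continuous.tendsto (by fun_prop) β₀).mono_left nhdsWithin_le_nhds
    · filter_upwards [self_mem_nhdsWithin] with β hβ heq
      exact hβ (by simpa using heq)
  exact hT.frequently (h.filter_mono nhdsWithin_le_nhds).frequently

/-- The part of the strip `0 < Im b < 2π` in the half plane of a superscript variable. -/
def leftHalfStrip : Set ℂ := {b | b.re < -(3 * Real.log 3) ∧ 0 < b.im ∧ b.im < 2 * Real.pi}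

theorem convex_halfStrip (R : ℝ) :
    Convex ℝ {b : ℂ | b.re < R ∧ 0 < b.im ∧ b.im < 2 * Real.pi} :=
  (convex_halfSpace_re_lt R).inter
    ((convex_halfSpace_im_gt 0).inter (convex_halfSpace_im_lt _))

theorem isOpen_halfStrip (R : ℝ) :
    IsOpen {b : ℂ | b.re < R ∧ 0 < b.im ∧ b.im < 2 * Real.pi} :=
  (isOpen_lt Complex.continuous_re continuous_const).inter
    ((isOpen_lt continuous_const Complex.continuous_im).inter
      (isOpen_lt Complex.continuous_im continuous_const))

theorem ray_mem_halfStrip {R β : ℝ} (h : β < R) :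
    (β + Real.pi * Complex.I : ℂ) ∈ {b : ℂ | b.re < R ∧ 0 < b.im ∧ b.im < 2 * Real.pi} := by
  have := Real.pi_pos
  refine ⟨by simpa using h, by simpa using this, by simp; linarith⟩

theorem eventually_comap_re_atBot {P : ℂ → Prop} (h : ∀ᶠ b in comap Complex.re atBot, P b) :
    ∃ R : ℝ, ∀ b : ℂ, b.re < R → P b := by
  rw [eventually_comap] at h
  obtain ⟨R, hR⟩ := eventually_atBot.1 h
  exact ⟨R, fun b hb => hR b.re hb.le b rfl⟩

/-- A solution on the half strip which tends to zero along the middle ray vanishes, provided that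
there is a second solution which tends to `1`. -/
theorem eqOn_zero_of_hypergeomOp {δ ψ : ℂ → ℂ} (hδ : DifferentiableOn ℂ δ leftHalfStrip)
    (hψ : DifferentiableOn ℂ ψ leftHalfStrip) (hδ0 : ∀ b ∈ leftHalfStrip, hypergeomOp δ b = 0)
    (hψ0 : ∀ b ∈ leftHalfStrip, hypergeomOp ψ b = 0)
    (hψ1 : Tendsto ψ (comap Complex.re atBot) (𝓝 1))
    (hlim : Tendsto (fun β : ℝ => δ (β + Real.pi * Complex.I)) atBot (𝓝 0)) :
    Set.EqOn δ 0 leftHalfStrip := by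
  have hH : IsOpen leftHalfStrip := isOpen_halfStrip _
  have hHc : IsPreconnected leftHalfStrip := (convex_halfStrip _).isPreconnected
  have hδd : ∀ b ∈ leftHalfStrip, HasDerivAt δ (deriv δ b) b := fun b hb =>
    (hδ.differentiableAt (hH.mem_nhds hb)).hasDerivAt
  have hψd : ∀ b ∈ leftHalfStrip, HasDerivAt ψ (deriv ψ b) b := fun b hb =>
    (hψ.differentiableAt (hH.mem_nhds hb)).hasDerivAt
  have hδd2 : ∀ b ∈ leftHalfStrip, HasDerivAt (deriv δ) (deriv (deriv δ) b) b := fun b hb =>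
    ((hδ.deriv hH).differentiableAt (hH.mem_nhds hb)).hasDerivAt
  have hψd2 : ∀ b ∈ leftHalfStrip, HasDerivAt (deriv ψ) (deriv (deriv ψ) b) b := fun b hb =>
    ((hψ.deriv hH).differentiableAt (hH.mem_nhds hb)).hasDerivAt
  -- By Abel's identity the Wronskian times the leading coefficient $1-27e^b$ is constant, because
  -- the coefficient of the first derivative is the derivative of the leading one.
  set p : ℂ → ℂ := fun b => (1 - 27 * Complex.exp b) * (δ b * deriv ψ b - deriv δ b * ψ b) with hp
  have hpd : ∀ b ∈ leftHalfStrip, HasDerivAt p 0 b := by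
    intro b hb
    have he : HasDerivAt (fun b => 1 - 27 * Complex.exp b) (-(27 * Complex.exp b)) b :=
      ((Complex.hasDerivAt_exp b).const_mul 27).const_sub 1
    refine (he.mul (((hδd b hb).mul (hψd2 b hb)).sub ((hδd2 b hb).mul (hψd b hb)))).congr_deriv ?_
    have e1 := hδ0 b hb
    have e2 := hψ0 b hb
    unfold hypergeomOp at e1 e2
    simp only [Pi.mul_apply, Pi.sub_apply]
    linear_combination δ b * e2 - ψ b * e1
  obtain ⟨p₀, hp₀⟩ : ∃ p₀, ∀ b ∈ leftHalfStrip, p b = p₀ := by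
    have hmem := ray_mem_halfStrip (R := -(3 * Real.log 3)) (β := -(3 * Real.log 3) - 1)
      (by linarith)
    exact ⟨_, fun b hb => hH.is_const_of_deriv_eq_zero hHc
      (fun b hb => (hpd b hb).differentiableAt.differentiableWithinAt)
      (fun b hb => (hpd b hb).deriv) hb hmem⟩
  have hexp : Tendsto (fun b => 1 - 27 * Complex.exp b) (comap Complex.re atBot) (𝓝 1) := by
    simpa using (Complex.tendsto_exp_comap_re_atBot.const_mul 27).const_sub 1
  have hinv : Tendsto (fun b => 1 - ((1 - 27 * Complex.exp b) * ψ b ^ 2)⁻¹)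
      (comap Complex.re atBot) (𝓝 0) := by
    simpa using ((hexp.mul (hψ1.pow 2)).inv₀ (by simp)).const_sub 1
  obtain ⟨R, hR⟩ := eventually_comap_re_atBot
    (((hinv.norm.eventually (gt_mem_nhds (show ‖(0 : ℂ)‖ < 1 / 2 by simp))).and
      ((hψ1.eventually_ne one_ne_zero).and (hexp.eventually_ne one_ne_zero))))
  set R' := min R (-(3 * Real.log 3)) with hR'
  set S := {b : ℂ | b.re < R' ∧ 0 < b.im ∧ b.im < 2 * Real.pi} with hS
  have hSH : S ⊆ leftHalfStrip := fun b hb => ⟨hb.1.trans_le (min_le_right _ _), hb.2⟩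
  have hSR : ∀ b ∈ S, b.re < R := fun b hb => hb.1.trans_le (min_le_left _ _)
  -- The derivative of $\delta/\psi$ tends to $-p_0$, so $\delta/\psi$ would grow linearly unless
  -- the constant $p_0$ vanishes.
  have hq : ∀ b ∈ S, HasDerivAt (fun b => δ b / ψ b)
      (-p₀ * ((1 - 27 * Complex.exp b) * ψ b ^ 2)⁻¹) b := by
    intro b hb
    obtain ⟨-, h2, h3⟩ := hR b (hSR b hb)
    refine ((hδd b (hSH hb)).div (hψd b (hSH hb)) h2).congr_deriv ?_
    rw [← hp₀ b (hSH hb)]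
    simp only [hp]
    field_simp
    ring
  have hqlim : Tendsto (fun β : ℝ => δ (β + Real.pi * Complex.I) / ψ (β + Real.pi * Complex.I))
      atBot (𝓝 0) := by
    have : Tendsto (fun β : ℝ => (β + Real.pi * Complex.I : ℂ)) atBot (comap Complex.re atBot) := by
      rw [tendsto_comap_iff]
      refine tendsto_id.congr fun β => ?_
      simp
    have h := hlim.div (hψ1.comp this) one_ne_zero
    rw [zero_div] at h
    exact h
  have hp0 : p₀ = 0 := by
    -- Far to the left the function $\delta/\psi+p_0b$ has derivative of norm at most $|p_0|/2$.
    -- Over a unit step its increment tends to $p_0$, since $\delta/\psi\to0$, and therefore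
    -- $|p_0|\le|p_0|/2$.
    have hle : ∀ β : ℝ, β < R' →
        ‖(δ (β + Real.pi * Complex.I) / ψ (β + Real.pi * Complex.I) + p₀ * (β + Real.pi * Complex.I))
          - (δ ((β - 1 : ℝ) + Real.pi * Complex.I) / ψ ((β - 1 : ℝ) + Real.pi * Complex.I)
            + p₀ * ((β - 1 : ℝ) + Real.pi * Complex.I))‖ ≤ ‖p₀‖ * (1 / 2) := by
      intro β hβ
      have hd : ∀ b ∈ S, HasDerivAt (fun b => δ b / ψ b + p₀ * b)
          (p₀ * (1 - ((1 - 27 * Complex.exp b) * ψ b ^ 2)⁻¹)) b := by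
        intro b hb
        refine ((hq b hb).add ((hasDerivAt_id b).const_mul p₀)).congr_deriv ?_
        ring
      have := (convex_halfStrip R').norm_image_sub_le_of_norm_deriv_le (𝕜 := ℂ)
        (f := fun b => δ b / ψ b + p₀ * b)
        (C := ‖p₀‖ * (1 / 2)) (fun b hb => (hd b hb).differentiableAt) (fun b hb => by
          rw [(hd b hb).deriv, norm_mul]
          gcongr
          exact (hR b (hSR b hb)).1.le)
        (ray_mem_halfStrip (show β - 1 < R' by linarith)) (ray_mem_halfStrip hβ)
      refine this.trans (le_of_eq ?_)
      have e : (β + Real.pi * Complex.I - ((β - 1 : ℝ) + Real.pi * Complex.I) : ℂ) = 1 := by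
        push_cast; ring
      rw [e, norm_one, mul_one]
    have hshift : Tendsto (fun β : ℝ => β - 1) atBot atBot :=
      tendsto_atBot_add_const_right atBot (-1) tendsto_id
    have hl := ((hqlim.sub (hqlim.comp hshift)).add_const p₀).norm
    have hl2 : ‖(0 - 0 + p₀ : ℂ)‖ ≤ ‖p₀‖ * (1 / 2) := by
      refine le_of_tendsto hl ?_
      filter_upwards [eventually_lt_atBot R'] with β hβ
      refine le_trans (le_of_eq ?_) (hle β hβ)
      congr 1
      simp only [Function.comp]
      push_cast
      ring
    have h0 := norm_nonneg p₀
    simp only [sub_zero, zero_add] at hl2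
    exact norm_eq_zero.1 (by linarith)
  have hconst : ∀ β : ℝ, β < R' → δ (β + Real.pi * Complex.I) = 0 := by
    intro β hβ
    have hz : ∀ b ∈ S, HasDerivAt (fun b => δ b / ψ b) 0 b := fun b hb => by
      simpa [hp0] using hq b hb
    have hev : ∀ᶠ β' : ℝ in atBot, δ (β' + Real.pi * Complex.I) / ψ (β' + Real.pi * Complex.I)
        = δ (β + Real.pi * Complex.I) / ψ (β + Real.pi * Complex.I) := by
      filter_upwards [eventually_lt_atBot R'] with β' hβ'
      exact (isOpen_halfStrip R').is_const_of_deriv_eq_zero (convex_halfStrip R').isPreconnected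
        (fun b hb => (hz b hb).differentiableAt.differentiableWithinAt)
        (fun b hb => (hz b hb).deriv) (ray_mem_halfStrip hβ') (ray_mem_halfStrip hβ)
    have h0 := tendsto_nhds_unique hqlim (tendsto_const_nhds.congr' (hev.mono fun _ h => h.symm))
    have hne := (hR _ (hSR _ (ray_mem_halfStrip hβ))).2.1
    exact (div_eq_zero_iff.1 h0.symm).resolve_right hne
  refine eqOn_of_eventually_ray hH hHc hδ (differentiableOn_const 0)
    (β₀ := R' - 1) (hSH (ray_mem_halfStrip (by linarith))) ?_
  filter_upwards [gt_mem_nhds (show R' - 1 < R' by linarith)] with β hβ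
  exact hconst β hβ

end

section

open Filter

/-! ### The logarithmic asymptotics of the Euler integral -/

/-- `1 + v + v²`, for `v` a cube root of `s`. -/
theorem one_add_add_sq_pos (v : ℝ) : 0 < 1 + v + v ^ 2 := by nlinarith [sq_nonneg (v + 1 / 2)]

/-- The elementary function `(3/2) log (1 + v + v²) + σ √3 arctan ((2v + 1) / √3)`, `v = s ^ (1/3)`. -/
def logArctan (σ s : ℝ) : ℝ :=
  3 / 2 * Real.log (1 + s ^ (1 / 3 : ℝ) + (s ^ (1 / 3 : ℝ)) ^ 2)
    + σ * (√3 * Real.arctan ((2 * s ^ (1 / 3 : ℝ) + 1) / √3))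

theorem continuousOn_logArctan (σ : ℝ) : ContinuousOn (logArctan σ) (Set.Ici 0) := by
  have h : ContinuousOn (fun s : ℝ => s ^ (1 / 3 : ℝ)) (Set.Ici 0) :=
    continuousOn_id.rpow_const fun x _ => Or.inr (by norm_num)
  refine ContinuousOn.add (ContinuousOn.mul continuousOn_const (ContinuousOn.log ?_ fun s _ =>
    (one_add_add_sq_pos _).ne')) (continuousOn_const.mul (continuousOn_const.mul
      (Real.continuous_arctan.comp_continuousOn ?_)))
  · exact (continuousOn_const.add h).add (h.pow 2)
  · exact ((continuousOn_const.mul h).add continuousOn_const).div_const _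

theorem logArctan_one_sub_zero (σ : ℝ) :
    logArctan σ 1 - logArctan σ 0 = 3 / 2 * Real.log 3 + σ * (Real.pi / (2 * √3)) := by
  have h3 : (√3 : ℝ) ^ 2 = 3 := Real.sq_sqrt (by norm_num)
  have h0 : (√3 : ℝ) ≠ 0 := by positivity
  have e1 : (2 * (1 : ℝ) + 1) / √3 = √3 := by
    rw [div_eq_iff h0, ← pow_two, h3]; norm_num
  have a1 : Real.arctan √3 = Real.pi / 3 := by
    rw [← Real.tan_pi_div_three, Real.arctan_tan] <;> linarith [Real.pi_pos]
  have a0 : Real.arctan (1 / √3) = Real.pi / 6 := by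
    rw [← Real.tan_pi_div_six, Real.arctan_tan] <;> linarith [Real.pi_pos]
  have z : (0 : ℝ) ^ (1 / 3 : ℝ) = 0 := Real.zero_rpow (by norm_num)
  simp only [logArctan, Real.one_rpow, z]
  rw [e1, a1, show (2 * (0 : ℝ) + 1) / √3 = 1 / √3 by ring, a0]
  norm_num
  field_simp
  linear_combination (6 * σ * Real.pi) * h3

theorem hasDerivAt_logArctan_aux (σ : ℝ) {s : ℝ} (hs : 0 < s) :
    HasDerivAt (logArctan σ)
      ((3 / 2 * (2 * s ^ (1 / 3 : ℝ) + 1) + σ * (3 / 2))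
        / ((1 + s ^ (1 / 3 : ℝ) + (s ^ (1 / 3 : ℝ)) ^ 2) * (3 * (s ^ (1 / 3 : ℝ)) ^ 2))) s := by
  have hv : 0 < s ^ (1 / 3 : ℝ) := Real.rpow_pos_of_pos hs _
  have hd : HasDerivAt (fun s : ℝ => s ^ (1 / 3 : ℝ)) (1 / (3 * (s ^ (1 / 3 : ℝ)) ^ 2)) s := by
    refine (Real.hasDerivAt_rpow_const (Or.inl hs.ne')).congr_deriv ?_
    rw [← Real.rpow_natCast, ← Real.rpow_mul hs.le, show (1 / 3 - 1 : ℝ) = -(2 / 3) by norm_num,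
      Real.rpow_neg hs.le]
    norm_num
    field_simp
  set v := s ^ (1 / 3 : ℝ) with hvd
  have hq := one_add_add_sq_pos v
  have h3 : (√3 : ℝ) ^ 2 = 3 := Real.sq_sqrt (by norm_num)
  have h0 : (√3 : ℝ) ≠ 0 := by positivity
  have h1 := (HasDerivAt.log ((hd.const_add 1).add (hd.pow 2)) (show 1 + v + v ^ 2 ≠ 0 from hq.ne')).const_mul (3 / 2)
  have h2 := (((((hd.const_mul 2).add_const 1).div_const √3).arctan).const_mul √3).const_mul σ
  refine (h1.add h2).congr_deriv ?_
  rw [← hvd]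
  have e : 1 + ((2 * v + 1) / √3) ^ 2 = 4 / 3 * (1 + v + v ^ 2) := by
    rw [div_pow, h3]; ring
  rw [e]
  simp only [Pi.add_apply, Pi.pow_apply]
  rw [← hvd]
  field_simp
  ring

/-- The two admissible pairs of an exponent and a sign. -/
def IsThird (a σ : ℝ) : Prop := a = 1 / 3 ∧ σ = 1 ∨ a = 2 / 3 ∧ σ = -1

theorem IsThird.pos {a σ : ℝ} (h : IsThird a σ) : 0 < a := by
  rcases h with ⟨rfl, -⟩ | ⟨rfl, -⟩ <;> norm_num

theorem IsThird.lt_one {a σ : ℝ} (h : IsThird a σ) : a < 1 := by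
  rcases h with ⟨rfl, -⟩ | ⟨rfl, -⟩ <;> norm_num

/-- With $s=v^3$ the factor $1-v$ cancels, leaving $(1+v)/(v^2(1+v+v^2))$ for $a=1/3$ and
$1/(v(1+v+v^2))$ for $a=2/3$. Both have a logarithm plus an arctangent as antiderivative, differing
only in the sign of the arctangent. -/
theorem hasDerivAt_logArctan {a σ : ℝ} (h : IsThird a σ) {s : ℝ} (hs : 0 < s) (hs1 : s < 1) :
    HasDerivAt (logArctan σ) ((s ^ (a - 1) - 1) / (1 - s)) s := by
  refine (hasDerivAt_logArctan_aux σ hs).congr_deriv ?_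
  have hv : 0 < s ^ (1 / 3 : ℝ) := Real.rpow_pos_of_pos hs _
  have hv3 : s = (s ^ (1 / 3 : ℝ)) ^ 3 := by
    rw [← Real.rpow_natCast, ← Real.rpow_mul hs.le]; norm_num
  have hv1 : s ^ (1 / 3 : ℝ) < 1 := Real.rpow_lt_one hs.le hs1 (by norm_num)
  have hq := one_add_add_sq_pos (s ^ (1 / 3 : ℝ))
  have hpow : s ^ (a - 1) = if σ = 1 then ((s ^ (1 / 3 : ℝ)) ^ 2)⁻¹ else (s ^ (1 / 3 : ℝ))⁻¹ := by
    rcases h with ⟨rfl, rfl⟩ | ⟨rfl, rfl⟩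
    · rw [if_pos rfl, ← Real.rpow_natCast, ← Real.rpow_mul hs.le, ← Real.rpow_neg hs.le]
      norm_num
    · rw [if_neg (by norm_num), ← Real.rpow_neg hs.le]
      norm_num
  have hden : 1 - s = (1 - s ^ (1 / 3 : ℝ)) * (1 + s ^ (1 / 3 : ℝ) + (s ^ (1 / 3 : ℝ)) ^ 2) := by
    conv_lhs => rw [hv3]
    ring
  rw [hpow, hden]
  generalize s ^ (1 / 3 : ℝ) = v at *
  have h1v : (1 - v) ≠ 0 := by linarith
  rcases h with ⟨-, rfl⟩ | ⟨-, rfl⟩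
  · rw [if_pos rfl]
    field_simp
    ring
  · rw [if_neg (by norm_num)]
    field_simp
    ring

/-- The real Euler integral at `w = -1 / x`, times `x ^ (-a)`. -/
def realEuler (a x : ℝ) : ℝ :=
  ∫ t in (0 : ℝ)..1, t ^ (a - 1) * (1 - t) ^ (a - 1) * (x + t) ^ (-a)

/-- The regular part of `realEuler`. -/
def realEulerReg (a x : ℝ) : ℝ :=
  ∫ t in (0 : ℝ)..1, t ^ (a - 1) * ((1 - t) ^ (a - 1) - 1) * (x + t) ^ (-a)

theorem intervalIntegrable_one_sub_rpow {a : ℝ} (ha : 0 < a) :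
    IntervalIntegrable (fun t : ℝ => (1 - t) ^ (a - 1)) MeasureTheory.volume 0 1 := by
  have h := (intervalIntegral.intervalIntegrable_rpow' (a := 0) (b := 1)
    (show -1 < a - 1 by linarith)).comp_sub_left 1
  simpa using h.symm

theorem rpow_sub_one_sub_one_bounds {a t : ℝ} (ha : 0 < a) (h0 : 0 < t) (h1 : t < 1) (ha1 : a < 1) :
    0 ≤ (1 - t) ^ (a - 1) - 1 ∧ (1 - t) ^ (a - 1) - 1 ≤ t * (1 - t) ^ (a - 1) := by
  have ht : 0 < 1 - t := by linarith
  constructor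
  · have := Real.one_le_rpow_of_pos_of_le_one_of_nonpos ht (by linarith) (show a - 1 ≤ 0 by linarith)
    linarith
  · have h2 : (1 - t) * (1 - t) ^ (a - 1) = (1 - t) ^ a := by
      rw [Real.rpow_sub_one ht.ne']; field_simp
    have h3 : (1 - t) ^ a ≤ 1 := Real.rpow_le_one ht.le (by linarith) ha.le
    linarith

/-- Subtracting $1$ from $(1-t)^{a-1}$ gains a factor $t$, which cancels $t^{a-1}\cdot t^{-a}$. The
resulting majorant is integrable and independent of $x$. -/
theorem norm_regular_integrand_le {a t x : ℝ} (ha : 0 < a) (ha1 : a < 1) (h0 : 0 < t) (h1 : t < 1)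
    (hx : 0 ≤ x) :
    ‖t ^ (a - 1) * ((1 - t) ^ (a - 1) - 1) * (x + t) ^ (-a)‖ ≤ (1 - t) ^ (a - 1) := by
  obtain ⟨hb0, hb1⟩ := rpow_sub_one_sub_one_bounds ha h0 h1 ha1
  have hxt : 0 < x + t := by linarith
  have hle : (x + t) ^ (-a) ≤ t ^ (-a) :=
    Real.rpow_le_rpow_of_nonpos h0 (by linarith) (by linarith)
  have ht : 0 < 1 - t := by linarith
  rw [Real.norm_of_nonneg (mul_nonneg (mul_nonneg (Real.rpow_nonneg h0.le _) hb0)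
    (Real.rpow_nonneg hxt.le _))]
  calc t ^ (a - 1) * ((1 - t) ^ (a - 1) - 1) * (x + t) ^ (-a)
      ≤ t ^ (a - 1) * (t * (1 - t) ^ (a - 1)) * t ^ (-a) := by
        have := Real.rpow_nonneg h0.le (a - 1)
        have := Real.rpow_nonneg hxt.le (-a)
        gcongr
    _ = (1 - t) ^ (a - 1) * (t ^ (a - 1) * t ^ (1 : ℝ) * t ^ (-a)) := by rw [Real.rpow_one]; ring
    _ = (1 - t) ^ (a - 1) := by
        rw [← Real.rpow_add h0, ← Real.rpow_add h0]
        norm_num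

theorem measurable_regular_integrand (a x : ℝ) :
    Measurable fun t : ℝ => t ^ (a - 1) * ((1 - t) ^ (a - 1) - 1) * (x + t) ^ (-a) := by
  fun_prop

theorem ae_ne_one : ∀ᵐ t : ℝ, t ≠ 1 := MeasureTheory.Measure.ae_ne _ 1

theorem ae_mem_uIoc_norm_le {a : ℝ} (ha : 0 < a) (ha1 : a < 1) {x : ℝ} (hx : 0 ≤ x) :
    ∀ᵐ t : ℝ, t ∈ Set.uIoc (0 : ℝ) 1 →
      ‖t ^ (a - 1) * ((1 - t) ^ (a - 1) - 1) * (x + t) ^ (-a)‖ ≤ (1 - t) ^ (a - 1) := by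
  filter_upwards [ae_ne_one] with t ht hmem
  rw [Set.uIoc_of_le zero_le_one] at hmem
  exact norm_regular_integrand_le ha ha1 hmem.1 (lt_of_le_of_ne hmem.2 ht) hx

theorem intervalIntegrable_regular_integrand {a : ℝ} (ha : 0 < a) (ha1 : a < 1) {x : ℝ}
    (hx : 0 ≤ x) : IntervalIntegrable
      (fun t : ℝ => t ^ (a - 1) * ((1 - t) ^ (a - 1) - 1) * (x + t) ^ (-a))
      MeasureTheory.volume 0 1 := by
  refine (intervalIntegrable_one_sub_rpow ha).mono_fun'
    (measurable_regular_integrand a x).aestronglyMeasurable ?_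
  exact (MeasureTheory.ae_restrict_iff' measurableSet_uIoc).2 (ae_mem_uIoc_norm_le ha ha1 hx)

/-- By dominated convergence one may put $x=0$; the integrand becomes $((1-t)^{a-1}-1)/t$, which is
the derivative of `logArctan` after the substitution $s=1-t$. -/
theorem tendsto_realEulerReg {a σ : ℝ} (h : IsThird a σ) :
    Tendsto (realEulerReg a) (𝓝[>] 0) (𝓝 (logArctan σ 1 - logArctan σ 0)) := by
  have ha := h.pos
  have ha1 := h.lt_one
  have hval : ∫ t in (0 : ℝ)..1, t ^ (a - 1) * ((1 - t) ^ (a - 1) - 1) * (0 + t) ^ (-a)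
      = logArctan σ 1 - logArctan σ 0 := by
    have := intervalIntegral.integral_eq_sub_of_hasDerivAt_of_le (a := 0) (b := 1)
      (f := fun t => -logArctan σ (1 - t)) zero_le_one ?_ (fun t ht => ?_)
      (intervalIntegrable_regular_integrand ha ha1 le_rfl)
    · rw [this]; simp; ring
    · exact ((continuousOn_logArctan σ).comp (by fun_prop)
        fun t ht => by simpa using ht.2).neg
    · have h1 := (hasDerivAt_logArctan h (s := 1 - t) (by linarith [ht.2]) (by linarith [ht.1]))
      have h2 := (h1.comp t ((hasDerivAt_id t).const_sub 1)).neg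
      refine h2.congr_deriv ?_
      have e : t ^ (a - 1) * t ^ (-a) = 1 / t := by
        rw [← Real.rpow_add ht.1, show a - 1 + -a = -1 by ring, Real.rpow_neg_one, one_div]
      have ht0 := ht.1.ne'
      rw [zero_add, mul_right_comm, e]
      simp
      field_simp
  rw [← hval]
  refine intervalIntegral.tendsto_integral_filter_of_dominated_convergence
    (fun t => (1 - t) ^ (a - 1)) ?_ ?_ (intervalIntegrable_one_sub_rpow ha) ?_
  · exact Eventually.of_forall fun x => (measurable_regular_integrand a x).aestronglyMeasurable
  · filter_upwards [self_mem_nhdsWithin] with x hx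
    exact ae_mem_uIoc_norm_le ha ha1 (le_of_lt hx)
  · refine Eventually.of_forall fun t ht => ?_
    rw [Set.uIoc_of_le zero_le_one] at ht
    refine Tendsto.const_mul _ ?_
    have : ContinuousAt (fun x : ℝ => (x + t) ^ (-a)) 0 :=
      ContinuousAt.rpow_const (by fun_prop) (Or.inl (by simpa using ht.1.ne'))
    exact this.tendsto.mono_left nhdsWithin_le_nhds

/-- Split $(1-t)^{a-1}$ as $1$ plus the rest. The part with $1$ carries the logarithmic singularity
and is elementary in $s=t/(x+t)$, with the same antiderivative function `logArctan`. -/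
theorem realEuler_eq {a σ : ℝ} (h : IsThird a σ) {x : ℝ} (hx : 0 < x) :
    realEuler a x = Real.log (1 + x) - Real.log x + (logArctan σ (1 / (1 + x)) - logArctan σ 0)
      + realEulerReg a x := by
  have ha := h.pos
  have hcont : ContinuousOn (fun t : ℝ => (x + t) ^ (-a)) (Set.uIcc 0 1) := by
    rw [Set.uIcc_of_le zero_le_one]
    exact ContinuousOn.rpow_const (by fun_prop) fun t ht => Or.inl (by linarith [ht.1])
  have hint : IntervalIntegrable (fun t : ℝ => t ^ (a - 1) * (x + t) ^ (-a))
      MeasureTheory.volume 0 1 :=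
    (intervalIntegral.intervalIntegrable_rpow' (by linarith)).mul_continuousOn hcont
  have hJ : ∫ t in (0 : ℝ)..1, t ^ (a - 1) * (x + t) ^ (-a)
      = Real.log (1 + x) - Real.log x + (logArctan σ (1 / (1 + x)) - logArctan σ 0) := by
    have := intervalIntegral.integral_eq_sub_of_hasDerivAt_of_le (a := 0) (b := 1)
      (f := fun t => Real.log (x + t) + logArctan σ (t / (x + t))) zero_le_one ?_ (fun t ht => ?_)
      hint
    · rw [this]; simp [add_comm x 1]; ring
    · refine ContinuousOn.add (ContinuousOn.log (by fun_prop) fun t ht => ?_)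
        ((continuousOn_logArctan σ).comp (ContinuousOn.div (by fun_prop) (by fun_prop)
          fun t ht => ?_) fun t ht => ?_)
      · linarith [ht.1]
      · linarith [ht.1]
      · exact div_nonneg ht.1 (by linarith [ht.1])
    · have ht0 := ht.1
      have hxt : 0 < x + t := by linarith
      have hs0 : 0 < t / (x + t) := by positivity
      have hs1 : t / (x + t) < 1 := by rw [div_lt_one hxt]; linarith
      have h1 : HasDerivAt (fun t : ℝ => x + t) 1 t := (hasDerivAt_id t).const_add x
      have h2 : HasDerivAt (fun t : ℝ => t / (x + t)) (x / (x + t) ^ 2) t := by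
        refine ((hasDerivAt_id t).div h1 hxt.ne').congr_deriv ?_
        simp
      have h3 := (hasDerivAt_logArctan h hs0 hs1).comp t h2
      refine ((h1.log hxt.ne').add h3).congr_deriv ?_
      have e : (t / (x + t)) ^ (a - 1) = t ^ (a - 1) * (x + t) ^ (-a) * (x + t) := by
        rw [Real.div_rpow ht0.le hxt.le, div_eq_mul_inv, ← Real.rpow_neg hxt.le, mul_assoc,
          show -(a - 1) = -a + 1 by ring, Real.rpow_add hxt, Real.rpow_one]
      have e2 : 1 - t / (x + t) = x / (x + t) := by field_simp; ring
      rw [e, e2]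
      field_simp
      ring
  rw [← hJ, realEulerReg, ← intervalIntegral.integral_add hint
    (intervalIntegrable_regular_integrand ha h.lt_one hx.le), realEuler]
  refine intervalIntegral.integral_congr fun t _ => ?_
  ring

/-- The singular and the regular part each contribute `logArctan σ 1 - logArctan σ 0`, which gives
twice the elementary constant. -/
theorem tendsto_realEuler_add_log {a σ : ℝ} (h : IsThird a σ) :
    Tendsto (fun x => realEuler a x + Real.log x) (𝓝[>] 0)
      (𝓝 (3 * Real.log 3 + σ * (Real.pi / √3))) := by
  have hid : Tendsto (fun x : ℝ => x) (𝓝[>] 0) (𝓝 0) := nhdsWithin_le_nhds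
  have h1 : Tendsto (fun x : ℝ => Real.log (1 + x)) (𝓝[>] 0) (𝓝 0) := by
    have : ContinuousAt (fun x : ℝ => Real.log (1 + x)) 0 :=
      ContinuousAt.log (by fun_prop) (by norm_num)
    simpa using this.tendsto.mono_left nhdsWithin_le_nhds
  have h2 : Tendsto (fun x : ℝ => logArctan σ (1 / (1 + x))) (𝓝[>] 0) (𝓝 (logArctan σ 1)) := by
    have hc : ContinuousAt (logArctan σ) 1 :=
      (continuousOn_logArctan σ).continuousAt (Ici_mem_nhds one_pos)
    refine hc.tendsto.comp ?_
    have : ContinuousAt (fun x : ℝ => 1 / (1 + x)) 0 :=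
      ContinuousAt.div (by fun_prop) (by fun_prop) (by norm_num)
    simpa using this.tendsto.mono_left nhdsWithin_le_nhds
  have h3 := (h1.add (h2.sub_const (logArctan σ 0))).add (tendsto_realEulerReg h)
  have e : 0 + (logArctan σ 1 - logArctan σ 0) + (logArctan σ 1 - logArctan σ 0)
      = 3 * Real.log 3 + σ * (Real.pi / √3) := by
    rw [logArctan_one_sub_zero]
    field_simp
    ring
  rw [e] at h3
  refine h3.congr' ?_
  filter_upwards [self_mem_nhdsWithin] with x hx
  rw [realEuler_eq h hx]
  ring

end

section

open Filter

/-! ### The solutions of a superscript variable -/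

theorem locallyDominated_sup {k : ℕ} (hk : k < 3) :
    LocallyDominated (fun m b => supCoeff k m * Complex.exp (m * b)) supHalf := by
  intro b hb
  obtain ⟨U, hU, hbU, -, v, hv, h⟩ :=
    (seriesFamily_sup_fst one_ne_zero hk).exists_ball isOpen_supHalf hb 0
  refine ⟨U, hU, hbU, v, hv, fun m w hw => ?_⟩
  have := h m w hw
  rwa [mul_zero, add_zero, fst_degreeFactor_eps 1 one_ne_zero w m k hk] at this

theorem locallyDominated_supLog :
    LocallyDominated (fun m b => supCoeff 0 m * (b + supHarmonic m) * Complex.exp (m * b))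
      supHalf := by
  intro b hb
  obtain ⟨U, hU, hbU, -, v, hv, h⟩ :=
    (seriesFamily_sup_snd one_ne_zero).exists_ball isOpen_supHalf hb 0
  refine ⟨U, hU, hbU, v, hv, fun m w hw => ?_⟩
  have := h m w hw
  rwa [mul_zero, Nat.cast_zero, snd_degreeFactor_eps 1 one_ne_zero w m, div_one] at this

/-- The series `∑ supCoeff k m e^{mb}`. -/
def supSeries (k : ℕ) (b : ℂ) : ℂ := ∑' m, supCoeff k m * Complex.exp (m * b)

/-- The logarithmic partner of `supSeries 0`. -/
def supLog (b : ℂ) : ℂ := ∑' m, supCoeff 0 m * (b + supHarmonic m) * Complex.exp (m * b)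

theorem LocallyDominated.differentiableOn {u : ℕ → ℂ → ℂ} {D : Set ℂ} (H : LocallyDominated u D)
    (hu : ∀ m, Differentiable ℂ (u m)) : DifferentiableOn ℂ (fun b => ∑' m, u m b) D := by
  intro b hb
  obtain ⟨U, hU, hbU, v, hv, hle⟩ := H b hb
  exact ((Complex.differentiableOn_tsum_of_summable_norm hv
    (fun m => (hu m).differentiableOn) hU hle).differentiableAt
      (hU.mem_nhds hbU)).differentiableWithinAt

theorem differentiableOn_supSeries {k : ℕ} (hk : k < 3) : DifferentiableOn ℂ (supSeries k) supHalf :=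
  (locallyDominated_sup hk).differentiableOn fun m => by fun_prop

theorem differentiableOn_supLog : DifferentiableOn ℂ supLog supHalf :=
  locallyDominated_supLog.differentiableOn fun m => by fun_prop

theorem hasDerivAt_exp_const_mul (s b : ℂ) :
    HasDerivAt (fun b => Complex.exp (s * b)) (s * Complex.exp (s * b)) b := by
  simpa [mul_comm] using ((hasDerivAt_id b).const_mul s).cexp

theorem exp_natCast_succ_mul (m : ℕ) (b : ℂ) :
    Complex.exp (((m + 1 : ℕ) : ℂ) * b) = Complex.exp b * Complex.exp (m * b) := by
  rw [← Complex.exp_add]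
  congr 1
  push_cast
  ring

theorem three_mul_add_ne_zero (m : ℕ) {j : ℕ} (hj : 0 < j) : (3 * m + j : ℂ) ≠ 0 := by
  have : ((3 * m + j : ℕ) : ℂ) ≠ 0 := Nat.cast_ne_zero.2 (by omega)
  exact_mod_cast this

theorem hypergeomOp_supSeries {b : ℂ} (hb : b ∈ supHalf) : hypergeomOp (supSeries 0) b = 0 := by
  refine hypergeomOp_tsum_eq_zero_of_up isOpen_supHalf
    (u' := fun m b => m * (supCoeff 0 m * Complex.exp (m * b)))
    (u'' := fun m b => m * (m * (supCoeff 0 m * Complex.exp (m * b))))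
    (locallyDominated_sup (by norm_num)) (fun m b => ?_) (fun m b => ?_) hb (by simp) fun m => ?_
  · exact ((hasDerivAt_exp_const_mul m b).const_mul _).congr_deriv (by ring)
  · exact (((hasDerivAt_exp_const_mul m b).const_mul _).const_mul _).congr_deriv (by ring)
  · have h1 := natCast_add_one_ne_zero m
    rw [exp_natCast_succ_mul, supCoeff_succ]
    have h3 : (3 * m + 3 : ℂ) = 3 * (m + 1) := by ring
    push_cast
    rw [sub_zero, h3]
    field_simp
    ring

/-- This is Frobenius' method: the recursion differentiated in the exponent. The term $2m$ in the
second derivative comes from $\theta^2$ applied to $b\,e^{mb}$. -/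
theorem hypergeomOp_supLog {b : ℂ} (hb : b ∈ supHalf) : hypergeomOp supLog b = 0 := by
  refine hypergeomOp_tsum_eq_zero_of_up isOpen_supHalf
    (u' := fun m b => supCoeff 0 m * (m * (b + supHarmonic m) + 1) * Complex.exp (m * b))
    (u'' := fun m b => supCoeff 0 m * (m * (m * (b + supHarmonic m)) + 2 * m) * Complex.exp (m * b))
    locallyDominated_supLog (fun m b => ?_) (fun m b => ?_) hb (by simp) fun m => ?_
  · exact ((((hasDerivAt_id b).add_const _).const_mul _).mul
      (hasDerivAt_exp_const_mul m b)).congr_deriv (by simp; ring)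
  · exact ((((((hasDerivAt_id b).add_const _).const_mul _).add_const _).const_mul _).mul
      (hasDerivAt_exp_const_mul m b)).congr_deriv (by simp; ring)
  · have h1 := natCast_add_one_ne_zero m
    have h2 : (3 * m + 1 : ℂ) ≠ 0 := by simpa using three_mul_add_ne_zero m (j := 1) (by norm_num)
    have h4 : (3 * m + 2 : ℂ) ≠ 0 := by simpa using three_mul_add_ne_zero m (j := 2) (by norm_num)
    rw [exp_natCast_succ_mul, supCoeff_succ, supHarmonic_succ]
    have h3 : (3 * m + 3 : ℂ) = 3 * (m + 1) := by ring
    push_cast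
    rw [sub_zero, h3]
    field_simp
    ring

/-- A power series in `eᵇ` differs from its constant term by `O(eᵇ)`. -/
theorem norm_tsum_exp_sub_le {c : ℕ → ℂ} {R : ℝ} (hc : Summable fun m => ‖c m‖ * Real.exp R ^ m)
    {b : ℂ} (hb : b.re ≤ R) :
    ‖∑' m, c m * Complex.exp (m * b) - c 0‖
      ≤ Real.exp b.re * ((∑' m, ‖c m‖ * Real.exp R ^ m) / Real.exp R) := by
  have hle : ∀ m, ‖c m * Complex.exp (m * b)‖ ≤ ‖c m‖ * Real.exp R ^ m := fun m => by
    rw [norm_mul, norm_exp_natCast_mul]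
    gcongr
  have hs : Summable fun m => c m * Complex.exp (m * b) := Summable.of_norm_bounded hc hle
  rw [hs.tsum_eq_zero_add]
  simp only [Nat.cast_zero, zero_mul, Complex.exp_zero, mul_one, add_sub_cancel_left]
  have hc1 := (summable_nat_add_iff 1).2 hc
  have hR := Real.exp_pos R
  have hle1 : ∀ m : ℕ, ‖c (m + 1) * Complex.exp (((m + 1 : ℕ) : ℂ) * b)‖
      ≤ Real.exp b.re / Real.exp R * (‖c (m + 1)‖ * Real.exp R ^ (m + 1)) := fun m => by
    rw [norm_mul, norm_exp_natCast_mul, pow_succ, pow_succ]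
    calc ‖c (m + 1)‖ * (Real.exp b.re ^ m * Real.exp b.re)
        ≤ ‖c (m + 1)‖ * (Real.exp R ^ m * Real.exp b.re) := by gcongr
      _ = _ := by field_simp
  refine (tsum_of_norm_bounded (hc1.mul_left _).hasSum hle1).trans ?_
  have hle2 : ∑' m, ‖c (m + 1)‖ * Real.exp R ^ (m + 1) ≤ ∑' m, ‖c m‖ * Real.exp R ^ m := by
    rw [hc.tsum_eq_zero_add]
    exact le_add_of_nonneg_left (by positivity)
  rw [tsum_mul_left, div_mul_eq_mul_div, mul_div_assoc]
  gcongr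

theorem summable_supHarmonic_mul :
    Summable fun m => ‖supCoeff 0 m * supHarmonic m‖ * Real.exp (-(3 * Real.log 3) - 1) ^ m := by
  have h := (summable_pow_mul_geometric_of_norm_lt_one (R := ℝ) 1 (r := Real.exp (-1))
    (by rw [Real.norm_of_nonneg (Real.exp_pos _).le]; simp)).mul_left 7
  refine Summable.of_nonneg_of_le (fun m => by positivity) (fun m => ?_) h
  rw [sub_eq_add_neg, Real.exp_add, exp_neg_three_mul_log_three, norm_mul, mul_pow, pow_one]
  calc _ ≤ 27 ^ m * (7 * m) * ((1 / 27) ^ m * Real.exp (-1) ^ m) := by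
        gcongr
        · exact norm_supCoeff_le (by norm_num) m
        · exact norm_supHarmonic_le m
    _ = (27 * (1 / 27)) ^ m * (7 * (m * Real.exp (-1) ^ m)) := by rw [mul_pow]; ring
    _ = _ := by norm_num

theorem summable_supCoeff :
    Summable fun m => ‖supCoeff 0 m‖ * Real.exp (-(3 * Real.log 3) - 1) ^ m := by
  have h := summable_geometric_of_lt_one (Real.exp_pos (-1)).le (by simp : Real.exp (-1) < 1)
  refine Summable.of_nonneg_of_le (fun m => by positivity) (fun m => ?_) h
  rw [sub_eq_add_neg, Real.exp_add, exp_neg_three_mul_log_three, mul_pow]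
  calc _ ≤ 27 ^ m * ((1 / 27) ^ m * Real.exp (-1) ^ m) := by
        gcongr
        exact norm_supCoeff_le (by norm_num) m
    _ = (27 * (1 / 27)) ^ m * Real.exp (-1) ^ m := by rw [mul_pow]; ring
    _ = _ := by norm_num

theorem supLog_eq {b : ℂ} (hb : b ∈ supHalf) :
    supLog b = b * supSeries 0 b
      + ∑' m, supCoeff 0 m * supHarmonic m * Complex.exp (m * b) := by
  have h1 := locallyDominated_supLog.hasSum hb
  have h2 := ((locallyDominated_sup (k := 0) (by norm_num)).hasSum hb).mul_left b
  have h3 := h1.sub h2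
  have : HasSum (fun m => supCoeff 0 m * supHarmonic m * Complex.exp (m * b))
      (supLog b - b * supSeries 0 b) := h3.congr_fun fun m => by ring
  rw [this.tsum_eq]
  ring

theorem tendsto_mul_exp_atBot : Tendsto (fun β : ℝ => β * Real.exp β) atBot (𝓝 0) := by
  have h := (Real.tendsto_pow_mul_exp_neg_atTop_nhds_zero 1).neg.comp tendsto_neg_atBot_atTop
  rw [neg_zero] at h
  exact h.congr fun β => by simp

theorem tendsto_exp_mul_const_comap (C : ℝ) :
    Tendsto (fun b : ℂ => Real.exp b.re * C) (comap Complex.re atBot) (𝓝 0) := by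
  simpa using (Real.tendsto_exp_atBot.comp tendsto_comap).mul_const C

theorem supSeries_sub_one_isBigO : ∃ C : ℝ, ∀ b : ℂ, b.re ≤ -(3 * Real.log 3) - 1 →
    ‖supSeries 0 b - 1‖ ≤ Real.exp b.re * C :=
  ⟨_, fun b hb => by
    have := norm_tsum_exp_sub_le summable_supCoeff hb
    rwa [show supCoeff 0 0 = 1 from Finset.prod_range_zero _] at this⟩

theorem eventually_re_le_comap (R : ℝ) : ∀ᶠ b : ℂ in comap Complex.re atBot, b.re ≤ R :=
  tendsto_comap.eventually (eventually_le_atBot R)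

theorem tendsto_supSeries : Tendsto (supSeries 0) (comap Complex.re atBot) (𝓝 1) := by
  obtain ⟨C, hC⟩ := supSeries_sub_one_isBigO
  rw [tendsto_iff_norm_sub_tendsto_zero]
  exact squeeze_zero' (Eventually.of_forall fun b => norm_nonneg _)
    ((eventually_re_le_comap _).mono hC) (tendsto_exp_mul_const_comap C)

theorem tendsto_ray : Tendsto (fun β : ℝ => (β + Real.pi * Complex.I : ℂ)) atBot
    (comap Complex.re atBot) := by
  rw [tendsto_comap_iff]
  exact tendsto_id.congr fun β => by simp

/-- Up to $O(e^b)$ the logarithmic solution is $b$ times the power series, and on the ray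
$b=\beta+\pi i$. Replacing $\beta$ times the power series by $\beta$ costs $O(\beta e^\beta)$. -/
theorem tendsto_supLog_ray : Tendsto (fun β : ℝ => supLog (β + Real.pi * Complex.I)
    - Real.pi * Complex.I * supSeries 0 (β + Real.pi * Complex.I) - β) atBot (𝓝 0) := by
  obtain ⟨C, hC⟩ := supSeries_sub_one_isBigO
  have h1 : Tendsto (fun β : ℝ => (β : ℂ) * (supSeries 0 (β + Real.pi * Complex.I) - 1))
      atBot (𝓝 0) := by
    rw [tendsto_zero_iff_norm_tendsto_zero]
    refine squeeze_zero' (Eventually.of_forall fun b => norm_nonneg _)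
      (g := fun β => |β * Real.exp β| * C) ?_ (by simpa using tendsto_mul_exp_atBot.abs.mul_const C)
    filter_upwards [tendsto_ray.eventually (eventually_re_le_comap (-(3 * Real.log 3) - 1))] with β hβ
    have := hC _ hβ
    rw [norm_mul, Complex.norm_real, Real.norm_eq_abs, abs_mul, abs_of_pos (Real.exp_pos β), mul_assoc]
    gcongr
    simpa using this
  have h2 : Tendsto (fun b : ℂ => ∑' m, supCoeff 0 m * supHarmonic m * Complex.exp (m * b))
      (comap Complex.re atBot) (𝓝 0) := by
    rw [tendsto_zero_iff_norm_tendsto_zero]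
    refine squeeze_zero' (Eventually.of_forall fun b => norm_nonneg _)
      ?_ (tendsto_exp_mul_const_comap ((∑' m, ‖supCoeff 0 m * supHarmonic m‖
        * Real.exp (-(3 * Real.log 3) - 1) ^ m) / Real.exp (-(3 * Real.log 3) - 1)))
    filter_upwards [eventually_re_le_comap (-(3 * Real.log 3) - 1)] with b hb
    have := norm_tsum_exp_sub_le summable_supHarmonic_mul hb
    rwa [show supHarmonic 0 = 0 from Finset.sum_range_zero _, mul_zero, sub_zero] at this
  have h := h1.add (h2.comp tendsto_ray)
  rw [add_zero] at h
  refine h.congr' ?_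
  filter_upwards [eventually_lt_atBot (-(3 * Real.log 3))] with β hβ
  rw [supLog_eq (show (β + Real.pi * Complex.I : ℂ) ∈ supHalf by simpa [supHalf] using hβ)]
  simp only [Function.comp]
  ring

end

section

open Filter

/-! ### The solutions of a subscript variable -/

/-- The strip `0 < Im b < 2π`. -/
def strip : Set ℂ := {b | 0 < b.im ∧ b.im < 2 * Real.pi}

/-- The domain of the solutions of a subscript variable. -/
def subDomain : Set ℂ := subHalf ∪ strip

theorem isOpen_strip : IsOpen strip :=
  (isOpen_lt continuous_const Complex.continuous_im).inter
    (isOpen_lt Complex.continuous_im continuous_const)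

theorem convex_strip : Convex ℝ strip :=
  (convex_halfSpace_im_gt 0).inter (convex_halfSpace_im_lt _)

theorem isOpen_subDomain : IsOpen subDomain := isOpen_subHalf.union isOpen_strip

theorem ray_mem_strip (β : ℝ) : (β + Real.pi * Complex.I : ℂ) ∈ strip := by
  have := Real.pi_pos
  exact ⟨by simpa using this, by simp; linarith⟩

theorem isPreconnected_subDomain : IsPreconnected subDomain :=
  IsPreconnected.union ((0 : ℝ) + Real.pi * Complex.I : ℂ)
    (by simpa [subHalf] using Real.log_pos (by norm_num)) (ray_mem_strip 0)
    (convex_halfSpace_re_gt _).isPreconnected convex_strip.isPreconnected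

theorem leftHalfStrip_subset_strip : leftHalfStrip ⊆ strip := fun _ hb => hb.2

theorem leftHalfStrip_subset_supHalf : leftHalfStrip ⊆ supHalf := fun _ hb => hb.1

theorem norm_exp_neg_div_lt {b : ℂ} (hb : b ∈ subHalf) : ‖Complex.exp (-b) / 27‖ < 1 := by
  have h := Real.exp_lt_exp.2 (show -(3 * Real.log 3) < b.re from hb)
  rw [exp_neg_three_mul_log_three] at h
  rw [norm_div, Complex.norm_exp, Complex.neg_re, Real.exp_neg, div_lt_one (by norm_num)]
  rw [inv_lt_comm₀ (Real.exp_pos _) (by norm_num)]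
  simpa using h

/-- In the right half plane the modulus is below $1$. In the strip $e^{-b}$ is never a positive
real: its imaginary part vanishes only at $\operatorname{Im} b=\pi$, where it is negative. -/
theorem exp_neg_div_mem_cutPlane {b : ℂ} (hb : b ∈ subDomain) :
    Complex.exp (-b) / 27 ∈ cutPlane := by
  rcases hb with hb | ⟨h0, h1⟩
  · exact mem_cutPlane_of_norm_lt (norm_exp_neg_div_lt hb)
  · have hre : (Complex.exp (-b) / 27).re = Real.exp (-b.re) * Real.cos b.im / 27 := by
      rw [show (27 : ℂ) = ((27 : ℝ) : ℂ) by norm_num, Complex.div_ofReal_re, Complex.exp_re]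
      simp
    have him : (Complex.exp (-b) / 27).im = -(Real.exp (-b.re) * Real.sin b.im) / 27 := by
      rw [show (27 : ℂ) = ((27 : ℝ) : ℂ) by norm_num, Complex.div_ofReal_im, Complex.exp_im]
      simp
    simp only [cutPlane, Set.mem_ofPred_eq, Complex.mem_slitPlane_iff, Complex.sub_re,
      Complex.one_re, Complex.sub_im, Complex.one_im, hre, him]
    by_cases hs : Real.sin b.im = 0
    · left
      have hπ : b.im = Real.pi := by
        have h2 : Real.sin (b.im - Real.pi) = 0 := by rw [Real.sin_sub_pi, hs, neg_zero]
        have := (Real.sin_eq_zero_iff_of_lt_of_lt (by linarith) (by linarith)).1 h2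
        linarith
      rw [hπ, Real.cos_pi]
      have := Real.exp_pos (-b.re)
      linarith
    · right
      have := (Real.exp_pos (-b.re)).ne'
      simp [this, hs]

/-- The sum of the series of a subscript variable, on its whole domain. -/
def subFun (ħ : ℂ) (j k : ℕ) (b : ℂ) : ℂ :=
  subLead ħ j k * Complex.exp (-(j / 3) * b) *
    if k = 0 then
      eulerIntegral (j / 3) (Complex.exp (-b) / 27)
        / Complex.betaIntegral ((j / 3 : ℝ) : ℂ) ((j / 3 : ℝ) : ℂ)
    else (1 - Complex.exp (-b) / 27) ^ (-((j / 3 : ℝ) : ℂ))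

theorem differentiableOn_subFun (ħ : ℂ) {j : ℕ} (hj : 0 < j) (k : ℕ) :
    DifferentiableOn ℂ (subFun ħ j k) subDomain := by
  have hw : DifferentiableOn ℂ (fun b => Complex.exp (-b) / 27) subDomain := by fun_prop
  unfold subFun
  refine DifferentiableOn.mul (by fun_prop) ?_
  by_cases hk : k = 0
  · simp only [if_pos hk]
    exact ((differentiableOn_eulerIntegral (by positivity)).comp hw
      fun b hb => exp_neg_div_mem_cutPlane hb).div_const _
  · simp only [if_neg hk]
    exact (hw.const_sub 1).cpow (differentiableOn_const _) fun b hb => exp_neg_div_mem_cutPlane hb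

/-- Of the denominators $3m+j+1$ and $3m+j+2$ one is $3(m+1)$ and the other is $3(m+2j/3)$. This is
the reason why the parameters are $(a,a;2a)$ with $a=j/3$. -/
theorem subCoeff_zero_right (ħ : ℂ) {j : ℕ} (hj : j = 1 ∨ j = 2) (m : ℕ) :
    subCoeff ħ j 0 m = subLead ħ j 0 * (eulerCoeff (j / 3) m / 27 ^ m) := by
  induction m with
  | zero => simp [subCoeff, eulerCoeff]
  | succ m ih =>
    rw [subCoeff_succ, ih, eulerCoeff, eulerCoeff, Finset.prod_range_succ, pow_succ]
    have h0 := natCast_add_one_ne_zero m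
    have h1 : (3 * m + 2 : ℂ) ≠ 0 := by simpa using three_mul_add_ne_zero m (j := 2) (by norm_num)
    have h2 : (3 * m + 4 : ℂ) ≠ 0 := by simpa using three_mul_add_ne_zero m (j := 4) (by norm_num)
    rcases hj with rfl | rfl
    · have e : (3 * m + (1 : ℕ) + 2 : ℂ) = 3 * (m + 1) := by push_cast; ring
      have e1 : (3 * m + (1 : ℕ) + 1 : ℂ) = 3 * m + 2 := by push_cast; ring
      have e2 : (m + 2 * ((1 : ℕ) / 3 : ℝ) : ℂ) = (3 * m + 2) / 3 := by push_cast; ring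
      rw [e, e1, e2]
      push_cast
      field_simp
      ring_nf
    · have e : (3 * m + (2 : ℕ) + 1 : ℂ) = 3 * (m + 1) := by push_cast; ring
      have e1 : (3 * m + (2 : ℕ) + 2 : ℂ) = 3 * m + 4 := by push_cast; ring
      have e2 : (m + 2 * ((2 : ℕ) / 3 : ℝ) : ℂ) = (3 * m + 4) / 3 := by push_cast; ring
      rw [e, e1, e2]
      push_cast
      field_simp
      ring_nf

/-- For $k=j$ the numerator $3m+2j$ cancels the denominator other than $3(m+1)$, and a binomial
series remains. -/
theorem subCoeff_self (ħ : ℂ) {j : ℕ} (hj : j = 1 ∨ j = 2) (m : ℕ) :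
    subCoeff ħ j j m = subLead ħ j j * (binCoeff (j / 3) m / 27 ^ m) := by
  induction m with
  | zero => simp [subCoeff, binCoeff]
  | succ m ih =>
    rw [subCoeff_succ, ih, binCoeff_succ, pow_succ]
    have h0 := natCast_add_one_ne_zero m
    have h1 : (3 * m + 2 : ℂ) ≠ 0 := by simpa using three_mul_add_ne_zero m (j := 2) (by norm_num)
    have h2 : (3 * m + 4 : ℂ) ≠ 0 := by simpa using three_mul_add_ne_zero m (j := 4) (by norm_num)
    rcases hj with rfl | rfl
    · have e : (3 * m + (1 : ℕ) + 2 : ℂ) = 3 * (m + 1) := by push_cast; ring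
      have e1 : (3 * m + (1 : ℕ) + 1 : ℂ) = 3 * m + 2 := by push_cast; ring
      rw [e, e1]
      push_cast
      field_simp
      ring
    · have e : (3 * m + (2 : ℕ) + 1 : ℂ) = 3 * (m + 1) := by push_cast; ring
      have e1 : (3 * m + (2 : ℕ) + 2 : ℂ) = 3 * m + 4 := by push_cast; ring
      rw [e, e1]
      push_cast
      field_simp
      ring

theorem hasSum_subFun (ħ : ℂ) {j k : ℕ} (hj : j = 1 ∨ j = 2) (hk : k < 3) (hjk : ¬ 3 ∣ j + k)
    {b : ℂ} (hb : b ∈ subHalf) :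
    HasSum (fun m : ℕ => subCoeff ħ j k m * Complex.exp (-(m + j / 3) * b)) (subFun ħ j k b) := by
  have hw := norm_exp_neg_div_lt hb
  have hpos : (0 : ℝ) < j / 3 := by rcases hj with rfl | rfl <;> norm_num
  have he : ∀ m : ℕ, Complex.exp (-(m + j / 3) * b)
      = Complex.exp (-(j / 3) * b) * Complex.exp (-b) ^ m := by
    intro m
    rw [← Complex.exp_nat_mul, ← Complex.exp_add]
    congr 1
    ring
  unfold subFun
  rcases Nat.eq_zero_or_pos k with rfl | hk0
  · rw [if_pos rfl]
    refine (((hasSum_eulerIntegral hpos hw).div_const _).mul_left _).congr_fun fun m => ?_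
    have hB := betaIntegral_self_ne_zero hpos
    rw [subCoeff_zero_right ħ hj, he, div_pow]
    field_simp
  · rw [if_neg hk0.ne']
    obtain rfl : k = j := by omega
    refine ((hasSum_one_sub_cpow _ hw).mul_left _).congr_fun fun m => ?_
    rw [subCoeff_self ħ hj, he, div_pow]
    ring

theorem locallyDominated_sub {j : ℕ} (hj : j = 1 ∨ j = 2) :
    LocallyDominated (fun (m : ℕ) b => subCoeff 1 j 0 m * Complex.exp (-(m + j / 3) * b)) subHalf := by
  have hjk : ¬ 3 ∣ j + 0 := by omega
  intro b hb
  obtain ⟨U, hU, hbU, -, v, hv, h⟩ :=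
    (seriesFamily_sub one_ne_zero hj (by norm_num : 0 < 3) hjk).exists_ball isOpen_subHalf hb 0
  refine ⟨U, hU, hbU, v, hv, fun m w hw => ?_⟩
  have := h m w hw
  rwa [mul_zero, add_zero, fst_degreeFactor_zero 1 one_ne_zero w j 0 m hj (by norm_num) hjk] at this

/-- The recursion proves the equation where the series converges; the identity theorem carries it to
the connected domain of the continuation. The lowest term is annihilated because $-j/3$ is a root of
$(\theta+\frac13)(\theta+\frac23)$. -/
theorem hypergeomOp_subFun {j : ℕ} (hj : j = 1 ∨ j = 2) {b : ℂ} (hb : b ∈ subDomain) :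
    hypergeomOp (subFun 1 j 0) b = 0 := by
  have hjk : ¬ 3 ∣ j + 0 := by omega
  have h1 : ∀ b ∈ subHalf, hypergeomOp (subFun 1 j 0) b = 0 := by
    intro b hb
    rw [hypergeomOp_congr isOpen_subHalf
      (fun b hb => (hasSum_subFun 1 hj (by norm_num) hjk hb).tsum_eq.symm) hb]
    refine hypergeomOp_tsum_eq_zero_of_down isOpen_subHalf
      (u' := fun m b => -(m + j / 3) * (subCoeff 1 j 0 m * Complex.exp (-(m + j / 3) * b)))
      (u'' := fun m b => -(m + j / 3) *
        (-(m + j / 3) * (subCoeff 1 j 0 m * Complex.exp (-(m + j / 3) * b))))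
      (locallyDominated_sub hj) (fun m b => ?_) (fun m b => ?_) hb ?_ fun m => ?_
    · exact ((hasDerivAt_exp_const_mul _ b).const_mul _).congr_deriv (by ring)
    · exact (((hasDerivAt_exp_const_mul _ b).const_mul _).const_mul _).congr_deriv (by ring)
    · rcases hj with rfl | rfl <;> push_cast <;> ring
    · have e : Complex.exp (-(m + j / 3) * b)
          = Complex.exp b * Complex.exp (-(((m + 1 : ℕ) : ℂ) + j / 3) * b) := by
        rw [← Complex.exp_add]
        congr 1
        push_cast
        ring
      have h0 := natCast_add_one_ne_zero m
      have h1 : (3 * m + 2 : ℂ) ≠ 0 := by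
        simpa using three_mul_add_ne_zero m (j := 2) (by norm_num)
      have h2 : (3 * m + 4 : ℂ) ≠ 0 := by
        simpa using three_mul_add_ne_zero m (j := 4) (by norm_num)
      have key : subCoeff 1 j 0 (m + 1) * (3 * (3 * m + j + 1) * (3 * m + j + 2))
          = subCoeff 1 j 0 m * ((m + j / 3) * (m + j / 3)) := by
        rw [subCoeff_succ]
        rcases hj with rfl | rfl
        · rw [show (3 * m + (1 : ℕ) + 2 : ℂ) = 3 * (m + 1) by push_cast; ring,
            show (3 * m + (1 : ℕ) + 1 : ℂ) = 3 * m + 2 by push_cast; ring]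
          push_cast
          field_simp
          ring
        · rw [show (3 * m + (2 : ℕ) + 1 : ℂ) = 3 * (m + 1) by push_cast; ring,
            show (3 * m + (2 : ℕ) + 2 : ℂ) = 3 * m + 4 by push_cast; ring]
          push_cast
          field_simp
          ring
      rw [e]
      push_cast
      linear_combination Complex.exp b * Complex.exp (-(m + 1 + j / 3) * b) * key
  have hd := hypergeomOp_differentiableOn isOpen_subDomain
    (differentiableOn_subFun 1 (j := j) (by omega) 0)
  have h0 : (0 : ℂ) ∈ subHalf := by simpa [subHalf] using Real.log_pos (by norm_num)
  exact (hd.analyticOnNhd isOpen_subDomain).eqOn_zero_of_preconnected_of_eventuallyEq_zero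
    isPreconnected_subDomain (Or.inl h0)
    (Filter.eventuallyEq_of_mem (isOpen_subHalf.mem_nhds h0) h1) hb

theorem eulerIntegral_neg_inv {a x : ℝ} (hx : 0 < x) :
    eulerIntegral a (-(1 / x : ℝ)) = ((x ^ a * realEuler a x : ℝ) : ℂ) := by
  rw [realEuler, ← intervalIntegral.integral_const_mul, ← intervalIntegral.integral_ofReal,
    eulerIntegral]
  refine intervalIntegral.integral_congr fun t ht => ?_
  rw [Set.uIcc_of_le zero_le_one] at ht
  have hxt : 0 < x + t := by linarith [ht.1]
  have e : (1 : ℂ) - t * -(1 / x : ℝ) = (((x + t) / x : ℝ) : ℂ) := by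
    push_cast
    have : (x : ℂ) ≠ 0 := by exact_mod_cast hx.ne'
    field_simp
    ring
  have e1 : (1 : ℂ) - t = ((1 - t : ℝ) : ℂ) := by push_cast; rfl
  have e2 : ((a : ℂ) - 1) = ((a - 1 : ℝ) : ℂ) := by push_cast; rfl
  rw [e, e1, e2, ← Complex.ofReal_neg, ← Complex.ofReal_cpow ht.1,
    ← Complex.ofReal_cpow (by linarith [ht.2]), ← Complex.ofReal_cpow (by positivity),
    Real.div_rpow hxt.le hx.le, Real.rpow_neg hx.le]
  push_cast
  field_simp

theorem exp_neg_ray_div (β : ℝ) :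
    Complex.exp (-(β + Real.pi * Complex.I)) / 27 = -(1 / (27 * Real.exp β) : ℝ) := by
  rw [Complex.exp_neg, Complex.exp_add, Complex.exp_pi_mul_I]
  push_cast
  have := Complex.exp_ne_zero β
  field_simp

theorem rpow_mul_exp (β : ℝ) (j : ℕ) :
    (27 * Real.exp β) ^ (j / 3 : ℝ) = 3 ^ j * Real.exp (j / 3 * β) := by
  rw [Real.mul_rpow (by norm_num) (Real.exp_pos _).le, ← Real.exp_mul,
    show (27 : ℝ) = 3 ^ (3 : ℝ) by norm_num, ← Real.rpow_mul (by norm_num),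
    show (3 : ℝ) * (j / 3) = j by ring, Real.rpow_natCast, mul_comm β]

/-- The normalized solution, real on the middle ray of the strip. -/
def eulerFun (j : ℕ) (b : ℂ) : ℂ :=
  (3 : ℂ)⁻¹ ^ j * Complex.exp (-(j / 3) * (b - Real.pi * Complex.I))
    * eulerIntegral (j / 3) (Complex.exp (-b) / 27)

theorem eulerFun_ray (j : ℕ) (β : ℝ) :
    eulerFun j (β + Real.pi * Complex.I) = realEuler (j / 3) (27 * Real.exp β) := by
  rw [eulerFun, exp_neg_ray_div, eulerIntegral_neg_inv (by positivity), rpow_mul_exp,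
    add_sub_cancel_right]
  push_cast
  rw [neg_mul, Complex.exp_neg, inv_pow]
  have := Complex.exp_ne_zero (j / 3 * β)
  have h3 : (3 : ℂ) ^ j ≠ 0 := pow_ne_zero _ three_ne_zero
  field_simp

theorem subFun_eq_eulerFun (ħ : ℂ) (j : ℕ) (b : ℂ) :
    subFun ħ j 0 b = subLead ħ j 0 * 3 ^ j * Complex.exp (-(j / 3) * (Real.pi * Complex.I))
      / Complex.betaIntegral ((j / 3 : ℝ) : ℂ) ((j / 3 : ℝ) : ℂ) * eulerFun j b := by
  have e : Complex.exp (-(j / 3) * b) = Complex.exp (-(j / 3) * (Real.pi * Complex.I))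
      * Complex.exp (-(j / 3) * (b - Real.pi * Complex.I)) := by
    rw [← Complex.exp_add]
    congr 1
    ring
  rw [subFun, if_pos rfl, eulerFun, e, inv_pow]
  have : (3 : ℂ) ^ j ≠ 0 := pow_ne_zero _ three_ne_zero
  field_simp

theorem exists_eulerFun_eq {j : ℕ} (hj : j = 1 ∨ j = 2) :
    ∃ K : ℂ, eulerFun j = fun b => K * subFun 1 j 0 b := by
  have hpos : (0 : ℝ) < j / 3 := by rcases hj with rfl | rfl <;> norm_num
  have hB := betaIntegral_self_ne_zero hpos
  have hL : subLead 1 j 0 ≠ 0 := by rcases hj with rfl | rfl <;> simp [subLead]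
  have he := Complex.exp_ne_zero (-(j / 3) * (Real.pi * Complex.I))
  refine ⟨(subLead 1 j 0 * 3 ^ j * Complex.exp (-(j / 3) * (Real.pi * Complex.I))
      / Complex.betaIntegral ((j / 3 : ℝ) : ℂ) ((j / 3 : ℝ) : ℂ))⁻¹, funext fun b => ?_⟩
  rw [subFun_eq_eulerFun, inv_mul_cancel_left₀]
  exact div_ne_zero (mul_ne_zero (mul_ne_zero hL (pow_ne_zero _ three_ne_zero)) he) hB

/-! ### The connection formulas -/

/-- The sign of the asymptotic constant. -/
def thirdSign (j : ℕ) : ℝ := if j = 1 then 1 else -1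

theorem isThird_thirdSign {j : ℕ} (hj : j = 1 ∨ j = 2) : IsThird (j / 3) (thirdSign j) := by
  rcases hj with rfl | rfl <;> simp [IsThird, thirdSign]

/-- On the ray the argument is $x=27e^\beta$, so $\log x=3\log3+\beta$ and the constant $3\log3$ of
the real asymptotics cancels. -/
theorem tendsto_eulerFun_ray {j : ℕ} (hj : j = 1 ∨ j = 2) :
    Tendsto (fun β : ℝ => eulerFun j (β + Real.pi * Complex.I) + β) atBot
      (𝓝 ((thirdSign j * (Real.pi / √3) : ℝ) : ℂ)) := by
  have hx : Tendsto (fun β : ℝ => 27 * Real.exp β) atBot (𝓝[>] 0) := by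
    refine tendsto_nhdsWithin_of_tendsto_nhds_of_eventually_within _ ?_
      (Eventually.of_forall fun β => by simp [Real.exp_pos])
    simpa using Real.tendsto_exp_atBot.const_mul 27
  have h := ((tendsto_realEuler_add_log (isThird_thirdSign hj)).comp hx).sub_const (3 * Real.log 3)
  rw [add_sub_cancel_left] at h
  refine ((Complex.continuous_ofReal.tendsto _).comp h).congr fun β => ?_
  have hlog : Real.log (27 * Real.exp β) = 3 * Real.log 3 + β := by
    rw [Real.log_mul (by norm_num) (Real.exp_pos β).ne', Real.log_exp,
      show (27 : ℝ) = 3 ^ 3 by norm_num, Real.log_pow]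
    norm_num
  simp only [Function.comp]
  rw [eulerFun_ray, hlog]
  push_cast
  ring

/-- The difference of the two sides solves the hypergeometric equation, and on the middle ray the
asymptotics $-\beta\pm\pi/\sqrt3$ makes it tend to $0$. The summand $\pi i$ compensates the
imaginary part of $b$ in the logarithmic solution. -/
theorem eulerFun_eq {j : ℕ} (hj : j = 1 ∨ j = 2) {b : ℂ} (hb : b ∈ leftHalfStrip) :
    eulerFun j b = -supLog b
      + (Real.pi * Complex.I + (thirdSign j * (Real.pi / √3) : ℝ)) * supSeries 0 b := by
  set κ : ℂ := -(Real.pi * Complex.I + (thirdSign j * (Real.pi / √3) : ℝ)) with hκ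
  obtain ⟨K, hK⟩ := exists_eulerFun_eq hj
  have hH : IsOpen leftHalfStrip := isOpen_halfStrip _
  have d0 : DifferentiableOn ℂ (supSeries 0) leftHalfStrip :=
    (differentiableOn_supSeries (by norm_num)).mono leftHalfStrip_subset_supHalf
  have d1 : DifferentiableOn ℂ supLog leftHalfStrip :=
    differentiableOn_supLog.mono leftHalfStrip_subset_supHalf
  have hsub : leftHalfStrip ⊆ subDomain := fun b hb => Or.inr (leftHalfStrip_subset_strip hb)
  have d2 : DifferentiableOn ℂ (eulerFun j) leftHalfStrip := by
    rw [hK]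
    exact ((differentiableOn_subFun 1 (by omega) 0).mono hsub).const_mul K
  have hz := eqOn_zero_of_hypergeomOp
    (δ := fun b => eulerFun j b + (supLog b + κ * supSeries 0 b))
    (d2.add (d1.add (d0.const_mul κ))) d0 (fun b hb => ?_)
    (fun b hb => hypergeomOp_supSeries (leftHalfStrip_subset_supHalf hb)) tendsto_supSeries ?_ hb
  · have : eulerFun j b + (supLog b + κ * supSeries 0 b) = 0 := hz
    linear_combination this
  · rw [hypergeomOp_add hH (y' := fun b => supLog b + κ * supSeries 0 b) d2
        (d1.add (d0.const_mul κ)) hb, hypergeomOp_add hH d1 (d0.const_mul κ) hb,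
      hypergeomOp_const_mul, hypergeomOp_supLog (leftHalfStrip_subset_supHalf hb),
      hypergeomOp_supSeries (leftHalfStrip_subset_supHalf hb), hK, hypergeomOp_const_mul,
      hypergeomOp_subFun hj (hsub hb)]
    simp
  · have h := ((tendsto_eulerFun_ray hj).add tendsto_supLog_ray).add
      (((tendsto_supSeries.comp tendsto_ray).const_mul
        ((thirdSign j * (Real.pi / √3) : ℝ) : ℂ)).neg)
    simp only [mul_one, add_zero, add_neg_cancel] at h
    refine h.congr fun β => ?_
    simp only [Function.comp, hκ]
    ring

theorem supCoeff_self {k : ℕ} (hk : k = 1 ∨ k = 2) (m : ℕ) :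
    supCoeff k m = 27 ^ m * binCoeff (k / 3) m := by
  induction m with
  | zero => simp [supCoeff, binCoeff]
  | succ m ih =>
    have h0 := natCast_add_one_ne_zero m
    have h1 : (3 * m + 2 : ℂ) ≠ 0 := by simpa using three_mul_add_ne_zero m (j := 2) (by norm_num)
    have h2 : (3 * m + 1 : ℂ) ≠ 0 := by simpa using three_mul_add_ne_zero m (j := 1) (by norm_num)
    rw [supCoeff_succ, ih, binCoeff_succ, pow_succ]
    rcases hk with rfl | rfl
    · rw [show (3 * m + 3 - (1 : ℕ) : ℂ) = 3 * m + 2 by push_cast; ring]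
      push_cast
      field_simp
      ring
    · rw [show (3 * m + 3 - (2 : ℕ) : ℂ) = 3 * m + 1 by push_cast; ring]
      push_cast
      field_simp
      ring

theorem supSeries_self {k : ℕ} (hk : k = 1 ∨ k = 2) {b : ℂ} (hb : b ∈ supHalf) :
    supSeries k b = (1 - 27 * Complex.exp b) ^ (-((k / 3 : ℝ) : ℂ)) := by
  have hw : ‖27 * Complex.exp b‖ < 1 := by
    have h := Real.exp_lt_exp.2 (show b.re < -(3 * Real.log 3) from hb)
    rw [exp_neg_three_mul_log_three] at h
    rw [norm_mul, Complex.norm_exp]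
    norm_num
    linarith
  rw [← (hasSum_one_sub_cpow (k / 3) hw).tsum_eq, supSeries]
  refine tsum_congr fun m => ?_
  rw [supCoeff_self hk, mul_pow, ← Complex.exp_nat_mul]
  ring

/-- On the middle ray, with $x=27e^\beta$, both powers have positive real bases and the claim
reduces to $1+1/x=(1+x)/x$. The phase $e^{-k\pi i/3}$ comes from $e^{-kb/3}$. -/
theorem subFun_self_eq {k : ℕ} (hk : k = 1 ∨ k = 2) (ħ : ℂ) {b : ℂ} (hb : b ∈ leftHalfStrip) :
    subFun ħ k k b = subLead ħ k k * 3 ^ k * Complex.exp (-(k / 3) * (Real.pi * Complex.I))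
      * supSeries k b := by
  have hsub : leftHalfStrip ⊆ subDomain := fun b hb => Or.inr (leftHalfStrip_subset_strip hb)
  refine eqOn_of_eventually_ray (isOpen_halfStrip _) (convex_halfStrip _).isPreconnected
    ((differentiableOn_subFun ħ (by omega) k).mono hsub)
    (((differentiableOn_supSeries (by omega)).mono leftHalfStrip_subset_supHalf).const_mul _)
    (β₀ := -(3 * Real.log 3) - 1) (ray_mem_halfStrip (by linarith)) ?_ hb
  filter_upwards [gt_mem_nhds (show -(3 * Real.log 3) - 1 < -(3 * Real.log 3) by linarith)] with β hβ
  rw [supSeries_self hk (leftHalfStrip_subset_supHalf (ray_mem_halfStrip hβ)), subFun,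
    if_neg (by omega), exp_neg_ray_div, Complex.exp_add, Complex.exp_pi_mul_I]
  have hx : (0 : ℝ) < 27 * Real.exp β := by positivity
  have e1 : (1 : ℂ) - -((1 / (27 * Real.exp β) : ℝ) : ℂ)
      = (((1 + 27 * Real.exp β) / (27 * Real.exp β) : ℝ) : ℂ) := by
    push_cast
    have := Complex.exp_ne_zero β
    field_simp
    ring
  have e2 : (1 : ℂ) - 27 * (Complex.exp β * -1) = ((1 + 27 * Real.exp β : ℝ) : ℂ) := by
    push_cast; ring
  rw [e1, e2, ← Complex.ofReal_neg, ← Complex.ofReal_cpow (by positivity),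
    ← Complex.ofReal_cpow (by positivity), Real.div_rpow (by positivity) hx.le,
    Real.rpow_neg hx.le, rpow_mul_exp, mul_add, Complex.exp_add, neg_mul _ (β : ℂ), Complex.exp_neg]
  push_cast
  have := Complex.exp_ne_zero (k / 3 * β)
  field_simp

end

section

open TrivSqZeroExt

/-! ### The entries of the wall-crossing map -/

theorem fst_dualExt (f : ℂ → ℂ) (A : ℂ[ε]) : (dualExt f A).fst = f A.fst := by
  simp [dualExt]

theorem snd_dualExt (f : ℂ → ℂ) (A : ℂ[ε]) : (dualExt f A).snd = deriv f A.fst * A.snd := by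
  simp [dualExt]

theorem fst_gammaCoeff (ħ : ℂ) (r f : ℚ) :
    (gammaCoeff ħ r f).fst =
      2 * Real.pi * Complex.I / 3 * (Complex.exp (2 * Real.pi * Complex.I * r) - 1)⁻¹
        * Complex.Gamma (1 - f)
        * (Complex.Gamma ((Int.fract (r - f) : ℚ) : ℂ) * Complex.Gamma r ^ 2)⁻¹ := by
  simp [gammaCoeff, fst_dualExt]

/-- For $f=0$ the Gamma functions of $H$ combine to $\Gamma(1+H)^3/\Gamma(1+3H)$, which has no
first-order term. Only the exponential contributes to the logarithmic derivative. -/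
theorem snd_gammaCoeff_zero (ħ : ℂ) (r : ℚ)
    (hr : Complex.exp (2 * Real.pi * Complex.I * r) - 1 ≠ 0)
    (h1 : Complex.Gamma ((Int.fract r : ℚ) : ℂ) ≠ 0) (h2 : Complex.Gamma r ≠ 0) :
    (gammaCoeff ħ r 0).snd = (gammaCoeff ħ r 0).fst *
      (ħ⁻¹ * (2 * Real.pi * Complex.I * Complex.exp (2 * Real.pi * Complex.I * r)
        / (Complex.exp (2 * Real.pi * Complex.I * r) - 1))) := by
  rw [fst_gammaCoeff]
  simp [gammaCoeff, fst_dualExt, snd_dualExt, fst_three, snd_three, pow_two]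
  field_simp
  ring

/-- The primitive sixth root of unity. -/
def sixthRoot : ℂ := Complex.exp (Real.pi * Complex.I / 3)

theorem sixthRoot_eq : sixthRoot = 1 / 2 + √3 / 2 * Complex.I := by
  rw [sixthRoot, show (Real.pi * Complex.I / 3 : ℂ) = ((Real.pi / 3 : ℝ) : ℂ) * Complex.I by
    push_cast; ring, Complex.exp_mul_I, ← Complex.ofReal_cos, ← Complex.ofReal_sin,
    Real.cos_pi_div_three, Real.sin_pi_div_three]
  push_cast
  rfl

theorem sqrt_three_sq : ((√3 : ℝ) : ℂ) ^ 2 = 3 := by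
  rw [← Complex.ofReal_pow, Real.sq_sqrt (by norm_num)]
  norm_num

theorem sqrt_three_ne_zero : ((√3 : ℝ) : ℂ) ≠ 0 := by
  exact_mod_cast (Real.sqrt_pos.2 (by norm_num : (0 : ℝ) < 3)).ne'

theorem pi_ne_zero' : ((Real.pi : ℝ) : ℂ) ≠ 0 := by exact_mod_cast Real.pi_ne_zero

theorem sixthRoot_sq : sixthRoot ^ 2 = sixthRoot - 1 := by
  rw [sixthRoot_eq]
  linear_combination (√3 / 2 : ℂ) ^ 2 * Complex.I_sq - 1 / 4 * sqrt_three_sq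

theorem sqrt_three_mul_I : (√3 : ℂ) * Complex.I = 2 * sixthRoot - 1 := by
  rw [sixthRoot_eq]
  ring

theorem pi_div_sqrt_three :
    (Real.pi / √3 : ℂ) = -(Real.pi * Complex.I * (2 * sixthRoot - 1) / 3) := by
  rw [div_eq_iff sqrt_three_ne_zero, ← sqrt_three_mul_I]
  linear_combination Real.pi * Complex.I ^ 2 / 3 * sqrt_three_sq + Real.pi * Complex.I_sq

theorem exp_two_thirds : Complex.exp (2 * Real.pi * Complex.I * ((1 / 3 : ℚ) : ℂ))
    = sixthRoot - 1 := by
  rw [← sixthRoot_sq, sixthRoot, ← Complex.exp_nat_mul]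
  congr 1
  push_cast
  ring

theorem exp_four_thirds : Complex.exp (2 * Real.pi * Complex.I * ((2 / 3 : ℚ) : ℂ))
    = -sixthRoot := by
  have h : sixthRoot ^ 4 = -sixthRoot := by
    linear_combination (sixthRoot ^ 2 + sixthRoot) * sixthRoot_sq
  rw [← h, sixthRoot, ← Complex.exp_nat_mul]
  congr 1
  push_cast
  ring

theorem exp_neg_third : Complex.exp (-(((1 : ℕ) : ℂ) / 3) * (Real.pi * Complex.I))
    = 1 - sixthRoot := by
  rw [show -(((1 : ℕ) : ℂ) / 3) * (Real.pi * Complex.I) = -(Real.pi * Complex.I / 3) by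
    push_cast; ring, Complex.exp_neg, ← sixthRoot, inv_eq_of_mul_eq_one_right]
  linear_combination -sixthRoot_sq

theorem exp_neg_two_thirds : Complex.exp (-(((2 : ℕ) : ℂ) / 3) * (Real.pi * Complex.I))
    = -sixthRoot := by
  rw [show -(((2 : ℕ) : ℂ) / 3) * (Real.pi * Complex.I)
    = ((2 : ℕ) : ℂ) * (-(((1 : ℕ) : ℂ) / 3) * (Real.pi * Complex.I)) by push_cast; ring,
    Complex.exp_nat_mul, exp_neg_third]
  linear_combination sixthRoot_sq

theorem sixthRoot_sub_two_ne_zero : sixthRoot - 1 - 1 ≠ 0 := by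
  intro h
  have h1 := sixthRoot_sq
  have h2 : sixthRoot = 2 := by linear_combination h
  rw [h2] at h1
  norm_num at h1

theorem neg_sixthRoot_sub_one_ne_zero : -sixthRoot - 1 ≠ 0 := by
  intro h
  have h1 := sixthRoot_sq
  have h2 : sixthRoot = -1 := by linear_combination -h
  rw [h2] at h1
  norm_num at h1

theorem Gamma_third_ne_zero : Complex.Gamma (1 / 3) ≠ 0 :=
  Complex.Gamma_ne_zero_of_re_pos (by norm_num)

theorem Gamma_two_thirds_ne_zero : Complex.Gamma (2 / 3) ≠ 0 :=
  Complex.Gamma_ne_zero_of_re_pos (by norm_num)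

theorem Gamma_third_mul : Complex.Gamma (1 / 3) * Complex.Gamma (2 / 3) * √3 = 2 * Real.pi := by
  have h := Complex.Gamma_mul_Gamma_one_sub (1 / 3)
  rw [show (1 - 1 / 3 : ℂ) = 2 / 3 by norm_num] at h
  rw [h, show (Real.pi * (1 / 3) : ℂ) = ((Real.pi / 3 : ℝ) : ℂ) by push_cast; ring,
    ← Complex.ofReal_sin, Real.sin_pi_div_three]
  have := sqrt_three_ne_zero
  push_cast
  field_simp

theorem fracOf_zero : fracOf 0 = 0 := by simp [fracOf]

theorem fracOf_one : fracOf 1 = 2 / 3 := by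
  rw [fracOf, show (1 : ZMod 3).val = 1 from rfl]; norm_num

theorem fracOf_two : fracOf 2 = 1 / 3 := by
  rw [fracOf, show (2 : ZMod 3).val = 2 from rfl]; norm_num

/-- The entry is the reciprocal of the connection constant of the binomial series; this is the
reflection formula for $\Gamma(\frac13)\Gamma(\frac23)$ together with the value of a sixth root of
unity. -/
theorem fst_wallCoeff_two_one (ħ : ℂ) : (wallCoeff ħ 2 1).fst
    * (subLead ħ 2 2 * 3 ^ 2 * Complex.exp (-(((2 : ℕ) : ℂ) / 3) * (Real.pi * Complex.I))) = 1 := by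
  rw [wallCoeff, if_neg (by decide), one_smul, fracOf_two, fracOf_one, fst_gammaCoeff,
    exp_two_thirds, exp_neg_two_thirds, show Int.fract (1 / 3 - 2 / 3 : ℚ) = 2 / 3 by norm_num]
  have h1 := sixthRoot_sub_two_ne_zero
  have hG1 := Gamma_third_ne_zero
  have hG2 := Gamma_two_thirds_ne_zero
  push_cast
  rw [show (1 - 2 / 3 : ℂ) = 1 / 3 by norm_num]
  simp only [subLead]
  norm_num only
  field_simp
  simp only [if_false]
  linear_combination -3 * Complex.I * sixthRoot * Gamma_third_mul
    + 3 * sixthRoot * (Complex.Gamma (1 / 3) * Complex.Gamma (2 / 3)) * sqrt_three_mul_I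
    + 6 * (Complex.Gamma (1 / 3) * Complex.Gamma (2 / 3)) * sixthRoot_sq

theorem fst_wallCoeff_one_two (ħ : ℂ) : (wallCoeff ħ 1 2).fst
    * (subLead ħ 1 1 * 3 ^ 1 * Complex.exp (-(((1 : ℕ) : ℂ) / 3) * (Real.pi * Complex.I))) = 1 := by
  rw [wallCoeff, if_neg (by decide), one_smul, fracOf_two, fracOf_one, fst_gammaCoeff,
    exp_four_thirds, exp_neg_third, show Int.fract (2 / 3 - 1 / 3 : ℚ) = 1 / 3 by norm_num]
  have h1 := neg_sixthRoot_sub_one_ne_zero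
  have hG1 := Gamma_third_ne_zero
  have hG2 := Gamma_two_thirds_ne_zero
  push_cast
  rw [show (1 - 1 / 3 : ℂ) = 2 / 3 by norm_num]
  simp only [subLead]
  norm_num only
  field_simp
  simp only [if_true]
  linear_combination Complex.I * (1 - sixthRoot) * Gamma_third_mul
    - (Complex.Gamma (1 / 3) * Complex.Gamma (2 / 3)) * (1 - sixthRoot) * sqrt_three_mul_I
    + 2 * (Complex.Gamma (1 / 3) * Complex.Gamma (2 / 3)) * sixthRoot_sq

/-- The Gamma factors cancel the beta integral that normalizes the subscript series. What is left is
a multiple of the solution that is real on the middle ray, with a constant independent of $\hbar$.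
-/
theorem fst_wallCoeff_one_zero (ħ : ℂ) (b : ℂ) : (wallCoeff ħ 1 0).fst * subFun ħ 1 0 b
    = √3 / (2 * Real.pi) * eulerFun 1 b := by
  rw [wallCoeff, if_neg (by decide), one_smul, fracOf_one, fracOf_zero, fst_gammaCoeff,
    exp_four_thirds, subFun_eq_eulerFun, exp_neg_third,
    show Int.fract (2 / 3 - 0 : ℚ) = 2 / 3 by norm_num,
    Complex.betaIntegral_eq_Gamma_mul_div _ _ (by norm_num) (by norm_num)]
  have h1 := neg_sixthRoot_sub_one_ne_zero
  have hG1 := Gamma_third_ne_zero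
  have hG2 := Gamma_two_thirds_ne_zero
  have hπ := pi_ne_zero'
  push_cast
  rw [show (1 / 3 + 1 / 3 : ℂ) = 2 / 3 by norm_num, sub_zero, Complex.Gamma_one]
  simp only [subLead]
  norm_num only
  field_simp
  simp only [if_true]
  linear_combination 2 * Real.pi * eulerFun 1 b * (Complex.I * (1 - sixthRoot) * Gamma_third_mul
    - (Complex.Gamma (1 / 3) * Complex.Gamma (2 / 3)) * (1 - sixthRoot) * sqrt_three_mul_I
    + 2 * (Complex.Gamma (1 / 3) * Complex.Gamma (2 / 3)) * sixthRoot_sq)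
    - eulerFun 1 b * (-sixthRoot - 1) * (Complex.Gamma (1 / 3) * Complex.Gamma (2 / 3)) * Gamma_third_mul

/-- The extra factor $\hbar$ of the entry cancels the $\hbar^{-1}$ in the leading coefficient of
this series. The constant is opposite to that for $j=1$, so that the logarithms cancel in the sum.
-/
theorem fst_wallCoeff_two_zero {ħ : ℂ} (hħ : ħ ≠ 0) (b : ℂ) :
    (wallCoeff ħ 2 0).fst * subFun ħ 2 0 b = -(√3 / (2 * Real.pi)) * eulerFun 2 b := by
  rw [wallCoeff, if_pos (by decide), fst_smul, fracOf_two, fracOf_zero, fst_gammaCoeff,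
    exp_two_thirds, subFun_eq_eulerFun, exp_neg_two_thirds,
    show Int.fract (1 / 3 - 0 : ℚ) = 1 / 3 by norm_num,
    Complex.betaIntegral_eq_Gamma_mul_div _ _ (by norm_num) (by norm_num)]
  have h1 := sixthRoot_sub_two_ne_zero
  have hG1 := Gamma_third_ne_zero
  have hG2 := Gamma_two_thirds_ne_zero
  have hπ := pi_ne_zero'
  push_cast
  rw [show (2 / 3 + 2 / 3 : ℂ) = 1 / 3 + 1 by norm_num, sub_zero, Complex.Gamma_one,
    Complex.Gamma_add_one _ (by norm_num)]
  simp only [subLead]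
  norm_num only
  simp only [smul_eq_mul]
  field_simp
  simp only [if_true, if_false]
  field_simp
  linear_combination -9 * (2 * Real.pi * eulerFun 2 b * (-Complex.I * sixthRoot * Gamma_third_mul
    + sixthRoot * (Complex.Gamma (1 / 3) * Complex.Gamma (2 / 3)) * sqrt_three_mul_I
    + 2 * (Complex.Gamma (1 / 3) * Complex.Gamma (2 / 3)) * sixthRoot_sq)
    - eulerFun 2 b * (sixthRoot - 2) * (Complex.Gamma (1 / 3) * Complex.Gamma (2 / 3)) * Gamma_third_mul)

/-- The logarithmic derivative $2\pi i\,e^{2\pi ir}/(e^{2\pi ir}-1)$ equals $\pi i+\pi\cot(\pi r)$,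
here at $r=2/3$. The cotangent changes sign for $r=1/3$. -/
theorem snd_wallCoeff_one_zero (ħ : ℂ) : (wallCoeff ħ 1 0).snd
    = (wallCoeff ħ 1 0).fst * (ħ⁻¹ * (Real.pi * Complex.I - Real.pi / √3)) := by
  rw [wallCoeff, if_neg (by decide), one_smul, fracOf_one, fracOf_zero, snd_gammaCoeff_zero,
    exp_four_thirds]
  · congr 2
    rw [div_eq_iff neg_sixthRoot_sub_one_ne_zero, pi_div_sqrt_three]
    linear_combination 2 / 3 * Real.pi * Complex.I * sixthRoot_sq
  · rw [exp_four_thirds]; exact neg_sixthRoot_sub_one_ne_zero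
  · rw [show Int.fract (2 / 3 : ℚ) = 2 / 3 by norm_num]
    simpa using Gamma_two_thirds_ne_zero
  · simpa using Gamma_two_thirds_ne_zero

theorem snd_wallCoeff_two_zero (ħ : ℂ) : (wallCoeff ħ 2 0).snd
    = (wallCoeff ħ 2 0).fst * (ħ⁻¹ * (Real.pi * Complex.I + Real.pi / √3)) := by
  rw [wallCoeff, if_pos (by decide), fst_smul, snd_smul, fracOf_two, fracOf_zero,
    snd_gammaCoeff_zero, exp_two_thirds, smul_eq_mul, smul_eq_mul, mul_assoc ħ]
  · congr 3
    rw [div_eq_iff sixthRoot_sub_two_ne_zero, pi_div_sqrt_three]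
    linear_combination 2 / 3 * Real.pi * Complex.I * sixthRoot_sq
  · rw [exp_two_thirds]; exact sixthRoot_sub_two_ne_zero
  · rw [show Int.fract (1 / 3 : ℚ) = 1 / 3 by norm_num]
    simpa using Gamma_third_ne_zero
  · simpa using Gamma_third_ne_zero

end

section

open TrivSqZeroExt

/-! ### The function of a superscript variable -/

/-- The `v`-exponents of the narrow sectors with `a`-exponent `ga`, for a subscript variable `v`. -/
def narrowExponents (ga : ZMod 3) : Finset (ZMod 3) :=
  Finset.univ.filter fun j => j ≠ 0 ∧ j ≠ ga

/-- The combination of the functions of a subscript variable given by the wall-crossing map. -/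
def wallFun (ħ : ℂ) (ga : ZMod 3) (e : Finset (Fin 3)) (v : Fin 3) (b : ℂ) : ℂ :=
  ∑ j ∈ narrowExponents ga, coeffAt e v (wallCoeff ħ j ga) * subFun ħ j.val (-ga).val b

open Classical in
/-- The sum of the series of a superscript variable, continued to the strip. -/
def supFun (ħ : ℂ) (ga : ZMod 3) (e : Finset (Fin 3)) (v : Fin 3) (b : ℂ) : ℂ :=
  if b ∈ supHalf then
    ∑' m : ℕ, coeffAt e v (degreeFactor ε ħ b (3 * (m : ℤ)) (((-ga).val : ℕ) : ℤ))
  else wallFun ħ ga e v b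

/-- The domain of the function of a superscript variable. -/
def supDomain : Set ℂ := supHalf ∪ strip

theorem isOpen_supDomain : IsOpen supDomain := isOpen_supHalf.union isOpen_strip

theorem tsum_degreeFactor_fst {ħ : ℂ} (hħ : ħ ≠ 0) {k : ℕ} (hk : k < 3) (b : ℂ) :
    ∑' m : ℕ, (degreeFactor ε ħ b (3 * (m : ℤ)) k).fst = supSeries k b :=
  tsum_congr fun m => fst_degreeFactor_eps ħ hħ b m k hk

theorem tsum_degreeFactor_snd {ħ : ℂ} (hħ : ħ ≠ 0) (b : ℂ) :
    ∑' m : ℕ, (degreeFactor ε ħ b (3 * (m : ℤ)) 0).snd = supLog b / ħ := by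
  rw [supLog, ← tsum_div_const]
  refine tsum_congr fun m => ?_
  rw [snd_degreeFactor_eps ħ hħ b m]
  ring

theorem narrowExponents_zero : narrowExponents 0 = {1, 2} := by decide

theorem narrowExponents_one : narrowExponents 1 = {2} := by decide

theorem narrowExponents_two : narrowExponents 2 = {1} := by decide

theorem zmod_three_cases (g : ZMod 3) : g = 0 ∨ g = 1 ∨ g = 2 := by revert g; decide

theorem supSeries_zero_eq {b : ℂ} (hb : b ∈ leftHalfStrip) :
    supSeries 0 b = √3 / (2 * Real.pi) * (eulerFun 1 b - eulerFun 2 b) := by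
  rw [eulerFun_eq (Or.inl rfl) hb, eulerFun_eq (Or.inr rfl) hb]
  have h1 := sqrt_three_ne_zero
  have h2 := pi_ne_zero'
  simp only [thirdSign]
  norm_num
  field_simp
  ring

theorem supLog_eq_eulerFun {b : ℂ} (hb : b ∈ leftHalfStrip) :
    supLog b = Real.pi * Complex.I * supSeries 0 b - (eulerFun 1 b + eulerFun 2 b) / 2 := by
  rw [eulerFun_eq (Or.inl rfl) hb, eulerFun_eq (Or.inr rfl) hb]
  simp only [thirdSign]
  norm_num
  ring

/-- The connection formula in one variable. -/
theorem tsum_eq_wallFun {ħ : ℂ} (hħ : ħ ≠ 0) (ga : ZMod 3) (e : Finset (Fin 3)) (v : Fin 3)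
    (h : v ∈ e → ga = 0) {b : ℂ} (hb : b ∈ leftHalfStrip) :
    ∑' m : ℕ, coeffAt e v (degreeFactor ε ħ b (3 * (m : ℤ)) (((-ga).val : ℕ) : ℤ))
      = wallFun ħ ga e v b := by
  rcases zmod_three_cases ga with rfl | rfl | rfl
  · rw [wallFun, narrowExponents_zero, Finset.sum_pair (by decide)]
    simp only [show (-0 : ZMod 3).val = 0 from rfl, show (1 : ZMod 3).val = 1 from rfl,
      show (2 : ZMod 3).val = 2 from rfl]
    -- The $H_v$-coefficients weight the two Euler functions by $\pm\frac{\sqrt3}{2\pi}(\pi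
    -- i\mp\pi/\sqrt3)$. The $\pi i$ parts assemble to $\pi i$ times the power series and the others
    -- to minus the mean of the Euler functions, which is the logarithmic solution.
    by_cases hv : v ∈ e
    · simp only [coeffAt, if_pos hv]
      rw [Nat.cast_zero, tsum_degreeFactor_snd hħ, supLog_eq_eulerFun hb, supSeries_zero_eq hb,
        snd_wallCoeff_one_zero, snd_wallCoeff_two_zero, mul_right_comm (wallCoeff ħ 1 0).fst,
        fst_wallCoeff_one_zero,
        mul_right_comm (wallCoeff ħ 2 0).fst, fst_wallCoeff_two_zero hħ]
      have h1 := sqrt_three_ne_zero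
      have h2 := pi_ne_zero'
      field_simp
      ring
    · simp only [coeffAt, if_neg hv]
      rw [tsum_degreeFactor_fst hħ (by norm_num), fst_wallCoeff_one_zero,
        fst_wallCoeff_two_zero hħ, supSeries_zero_eq hb]
      ring
  · have hv : v ∉ e := fun hv => by simpa using h hv
    rw [wallFun, narrowExponents_one, Finset.sum_singleton]
    simp only [show (-1 : ZMod 3).val = 2 from rfl, show (2 : ZMod 3).val = 2 from rfl,
      coeffAt, if_neg hv]
    rw [tsum_degreeFactor_fst hħ (by norm_num), subFun_self_eq (Or.inr rfl) ħ hb, ← mul_assoc,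
      fst_wallCoeff_two_one, one_mul]
  · have hv : v ∉ e := fun hv => absurd (h hv) (by decide)
    rw [wallFun, narrowExponents_two, Finset.sum_singleton]
    simp only [show (-2 : ZMod 3).val = 1 from rfl, show (1 : ZMod 3).val = 1 from rfl,
      coeffAt, if_neg hv]
    rw [tsum_degreeFactor_fst hħ (by norm_num), subFun_self_eq (Or.inl rfl) ħ hb, ← mul_assoc,
      fst_wallCoeff_one_two, one_mul]

theorem supFun_of_mem_supHalf (ħ : ℂ) (ga : ZMod 3) (e : Finset (Fin 3)) (v : Fin 3) {b : ℂ}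
    (hb : b ∈ supHalf) : supFun ħ ga e v b =
      ∑' m : ℕ, coeffAt e v (degreeFactor ε ħ b (3 * (m : ℤ)) (((-ga).val : ℕ) : ℤ)) :=
  if_pos hb

/-- On the overlap of the strip with the half plane of convergence this is the connection formula;
elsewhere in the strip it is the definition. Hence the piecewise definition is consistent. -/
theorem supFun_of_mem_strip {ħ : ℂ} (hħ : ħ ≠ 0) (ga : ZMod 3) (e : Finset (Fin 3)) (v : Fin 3)
    (h : v ∈ e → ga = 0) {b : ℂ} (hb : b ∈ strip) : supFun ħ ga e v b = wallFun ħ ga e v b := by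
  by_cases hs : b ∈ supHalf
  · rw [supFun_of_mem_supHalf ħ ga e v hs, tsum_eq_wallFun hħ ga e v h ⟨hs, hb⟩]
  · exact if_neg hs

theorem val_pos_of_mem_narrowExponents {ga j : ZMod 3} (hj : j ∈ narrowExponents ga) :
    j.val = 1 ∨ j.val = 2 := by
  revert ga j; decide

theorem not_dvd_of_mem_narrowExponents {ga j : ZMod 3} (hj : j ∈ narrowExponents ga) :
    ¬ 3 ∣ j.val + (-ga).val := by
  revert ga j; decide

theorem differentiableOn_wallFun (ħ : ℂ) (ga : ZMod 3) (e : Finset (Fin 3)) (v : Fin 3) :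
    DifferentiableOn ℂ (wallFun ħ ga e v) subDomain := by
  unfold wallFun
  refine DifferentiableOn.fun_sum fun j hj => DifferentiableOn.const_mul
    (differentiableOn_subFun ħ ?_ _) _
  have := val_pos_of_mem_narrowExponents hj
  omega

/-- The family of series of a superscript variable. -/
def supTerm (ħ : ℂ) (ga : ZMod 3) (e : Finset (Fin 3)) (v : Fin 3) (l m : ℕ) (b : ℂ) : ℂ :=
  coeffAt e v (degreeFactor ε ħ b (3 * (m : ℤ)) (((-ga).val + 3 * l : ℕ) : ℤ))

/-- The family of series of a subscript variable. -/
def subTerm (ħ : ℂ) (ga j : ZMod 3) (l m : ℕ) (b : ℂ) : ℂ :=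
  (degreeFactor 0 ħ b (-((3 * m + j.val : ℕ) : ℤ)) (((-ga).val + 3 * l : ℕ) : ℤ)).fst

theorem seriesFamily_supTerm {ħ : ℂ} (hħ : ħ ≠ 0) (ga : ZMod 3) (e : Finset (Fin 3)) (v : Fin 3)
    (h : v ∈ e → ga = 0) :
    SeriesFamily ħ (((-ga).val : ℂ) / 3) supHalf (supTerm ħ ga e v) := by
  by_cases hv : v ∈ e
  · obtain rfl := h hv
    have e0 : supTerm ħ 0 e v = fun l (m : ℕ) b =>
        (degreeFactor ε ħ b (3 * (m : ℤ)) ((3 * l : ℕ) : ℤ)).snd := by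
      funext l m b
      simp [supTerm, coeffAt, hv]
    rw [e0]
    simpa using seriesFamily_sup_snd hħ
  · have e0 : supTerm ħ ga e v = fun l (m : ℕ) b =>
        (degreeFactor ε ħ b (3 * (m : ℤ)) (((-ga).val + 3 * l : ℕ) : ℤ)).fst := by
      funext l m b
      simp [supTerm, coeffAt, hv]
    rw [e0]
    exact seriesFamily_sup_fst hħ (ZMod.val_lt _)

theorem seriesFamily_subTerm {ħ : ℂ} (hħ : ħ ≠ 0) {ga j : ZMod 3} (hj : j ∈ narrowExponents ga) :
    SeriesFamily ħ (((-ga).val : ℂ) / 3) subHalf (subTerm ħ ga j) :=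
  seriesFamily_sub hħ (val_pos_of_mem_narrowExponents hj) (ZMod.val_lt _)
    (not_dvd_of_mem_narrowExponents hj)

theorem tsum_supTerm (ħ : ℂ) (ga : ZMod 3) (e : Finset (Fin 3)) (v : Fin 3) :
    Set.EqOn (fun b => ∑' m, supTerm ħ ga e v 0 m b) (supFun ħ ga e v) supHalf :=
  fun _ hb => (supFun_of_mem_supHalf ħ ga e v hb).symm

theorem tsum_subTerm {ħ : ℂ} (hħ : ħ ≠ 0) {ga j : ZMod 3} (hj : j ∈ narrowExponents ga) :
    Set.EqOn (fun b => ∑' m, subTerm ħ ga j 0 m b) (subFun ħ j.val (-ga).val) subHalf := by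
  intro b hb
  have h1 := val_pos_of_mem_narrowExponents hj
  have h2 := not_dvd_of_mem_narrowExponents hj
  refine (tsum_congr fun m => ?_).trans
    (hasSum_subFun ħ h1 (ZMod.val_lt (-ga)) h2 hb).tsum_eq
  exact fst_degreeFactor_zero ħ hħ b _ _ m h1 (ZMod.val_lt _) h2

/-- The domain is covered by two open sets, on each of which the function is given by a single
holomorphic expression. -/
theorem differentiableOn_supFun {ħ : ℂ} (hħ : ħ ≠ 0) (ga : ZMod 3) (e : Finset (Fin 3)) (v : Fin 3)
    (h : v ∈ e → ga = 0) : DifferentiableOn ℂ (supFun ħ ga e v) supDomain := by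
  rintro b (hb | hb)
  · have := ((seriesFamily_supTerm hħ ga e v h).differentiableOn_tsum isOpen_supHalf 0).congr
      fun b hb => (tsum_supTerm ħ ga e v hb).symm
    exact (this.differentiableAt (isOpen_supHalf.mem_nhds hb)).differentiableWithinAt
  · have := ((differentiableOn_wallFun ħ ga e v).mono (show strip ⊆ subDomain from
      Set.subset_union_right)).congr fun b hb => supFun_of_mem_strip hħ ga e v h hb
    exact (this.differentiableAt (isOpen_strip.mem_nhds hb)).differentiableWithinAt

end

section

open Filter

/-! ### Basis labels -/

theorem fixedCount_eq (γ : GroupElt) (v : Fin 3) :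
    fixedCount γ v = (if γ.1 v = γ.2 then 1 else 0) + if γ.1 v = 0 then 2 else 0 := by
  have e0 : coordWeight γ v 0 = γ.1 v - γ.2 := rfl
  have e1 : coordWeight γ v 1 = γ.1 v := rfl
  have e2 : coordWeight γ v 2 = γ.1 v := rfl
  rw [fixedCount, Finset.card_filter, Fin.sum_univ_three]
  simp only [e0, e1, e2, sub_eq_zero]
  split_ifs <;> rfl

/-- The coordinates $v_1,v_2$ have equal weight, so two fixed coordinates already force $g_v=0$; the
third is then fixed exactly when $g_a=0$. For a subscript variable, fixing nothing means $g_v\ne0$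
and $g_v\ne g_a$. -/
theorem isBasisLabel_iff (s : Finset (Fin 3)) (p : GroupElt × Finset (Fin 3)) :
    IsBasisLabel s p ↔ (∀ v ∈ s, p.1.1 v ∈ narrowExponents p.1.2) ∧ (∀ v ∉ s, p.1.1 v = 0) ∧
      ∀ v ∈ p.2, v ∉ s ∧ p.1.2 = 0 := by
  have h1 : IsSector s p.1 ↔
      (∀ v ∈ s, p.1.1 v ∈ narrowExponents p.1.2) ∧ ∀ v ∉ s, p.1.1 v = 0 := by
    rw [IsSector, ← forall_and]
    refine forall_congr' fun v => ?_
    rw [fixedCount_eq]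
    by_cases hv : v ∈ s
    · simp [hv, narrowExponents, and_comm]
    · simp only [hv, if_false, false_imp_iff, not_false_eq_true, true_imp_iff, true_and]
      split_ifs <;> simp_all
  rw [IsBasisLabel, h1, and_assoc]
  refine and_congr_right fun _ => and_congr_right fun h => ?_
  refine forall_congr' fun v => imp_congr_right fun _ => and_congr_right fun hv => ?_
  rw [fixedCount_eq, h v hv]
  simp only [if_true]
  split_ifs with h2
  · simp [h2.symm]
  · simp [Ne.symm h2]

/-- The function of the variable `v` for the label `p`. -/
def labelFun (ħ : ℂ) (s : Finset (Fin 3)) (p : GroupElt × Finset (Fin 3)) (v : Fin 3) : ℂ → ℂ :=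
  if v ∈ s then subFun ħ (p.1.1 v).val (-p.1.2).val else supFun ħ p.1.2 p.2 v

/-- The terms of the series of `labelFun`. -/
def labelTerm (ħ : ℂ) (s : Finset (Fin 3)) (p : GroupElt × Finset (Fin 3)) (v : Fin 3) :
    ℕ → ℕ → ℂ → ℂ :=
  if v ∈ s then subTerm ħ p.1.2 (p.1.1 v) else supTerm ħ p.1.2 p.2 v

/-- The half plane `InChamber s v` as a subset of `ℂ`. -/
def halfPlane (s : Finset (Fin 3)) (v : Fin 3) : Set ℂ := if v ∈ s then subHalf else supHalf

/-- The domain of `labelFun`. -/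
def labelDomain (s : Finset (Fin 3)) (v : Fin 3) : Set ℂ := if v ∈ s then subDomain else supDomain

theorem inChamber_iff (s : Finset (Fin 3)) (v : Fin 3) (b : Fin 3 → ℂ) :
    InChamber s v b ↔ b v ∈ halfPlane s v := by
  unfold InChamber halfPlane
  split_ifs <;> rfl

theorem isOpen_halfPlane (s : Finset (Fin 3)) (v : Fin 3) : IsOpen (halfPlane s v) := by
  unfold halfPlane
  split_ifs
  exacts [isOpen_subHalf, isOpen_supHalf]

theorem isOpen_labelDomain (s : Finset (Fin 3)) (v : Fin 3) : IsOpen (labelDomain s v) := by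
  unfold labelDomain
  split_ifs
  exacts [isOpen_subDomain, isOpen_supDomain]

theorem halfPlane_subset_labelDomain (s : Finset (Fin 3)) (v : Fin 3) :
    halfPlane s v ⊆ labelDomain s v := by
  unfold halfPlane labelDomain
  split_ifs <;> exact Set.subset_union_left

theorem strip_subset_labelDomain (s : Finset (Fin 3)) (v : Fin 3) : strip ⊆ labelDomain s v := by
  unfold labelDomain
  split_ifs <;> exact Set.subset_union_right

section Label

variable {ħ : ℂ} {s : Finset (Fin 3)} {p : GroupElt × Finset (Fin 3)}

theorem differentiableOn_labelFun (hħ : ħ ≠ 0) (hp : IsBasisLabel s p) (v : Fin 3) :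
    DifferentiableOn ℂ (labelFun ħ s p v) (labelDomain s v) := by
  obtain ⟨h1, -, h3⟩ := (isBasisLabel_iff s p).1 hp
  unfold labelFun labelDomain
  split_ifs with hv
  · have := val_pos_of_mem_narrowExponents (h1 v hv)
    exact differentiableOn_subFun ħ (by omega) _
  · exact differentiableOn_supFun hħ _ _ _ fun he => (h3 v he).2

theorem seriesFamily_labelTerm (hħ : ħ ≠ 0) (hp : IsBasisLabel s p) (v : Fin 3) :
    SeriesFamily ħ (((-p.1.2).val : ℂ) / 3) (halfPlane s v) (labelTerm ħ s p v) := by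
  obtain ⟨h1, -, h3⟩ := (isBasisLabel_iff s p).1 hp
  unfold labelTerm halfPlane
  split_ifs with hv
  · exact seriesFamily_subTerm hħ (h1 v hv)
  · exact seriesFamily_supTerm hħ _ _ _ fun he => (h3 v he).2

theorem tsum_labelTerm (hħ : ħ ≠ 0) (hp : IsBasisLabel s p) (v : Fin 3) :
    Set.EqOn (fun b => ∑' m, labelTerm ħ s p v 0 m b) (labelFun ħ s p v) (halfPlane s v) := by
  obtain ⟨h1, -, -⟩ := (isBasisLabel_iff s p).1 hp
  unfold labelTerm halfPlane labelFun
  split_ifs with hv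
  · exact tsum_subTerm hħ (h1 v hv)
  · exact tsum_supTerm ħ _ _ _

/-- The tower of functions of the variable `v` for the label `p`. -/
def labelTower (ħ : ℂ) (s : Finset (Fin 3)) (p : GroupElt × Finset (Fin 3)) (v : Fin 3) :
    ℕ → ℂ → ℂ :=
  tower ħ (((-p.1.2).val : ℂ) / 3) (labelFun ħ s p v)

theorem labelTower_eq (hħ : ħ ≠ 0) (hp : IsBasisLabel s p) (v : Fin 3) (l : ℕ) :
    Set.EqOn (labelTower ħ s p v l) (fun b => ∑' m, labelTerm ħ s p v l m b) (halfPlane s v) :=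
  fun _ hb => (tower_congr _ _ (isOpen_halfPlane s v) (tsum_labelTerm hħ hp v) l hb).symm.trans
    ((seriesFamily_labelTerm hħ hp v).tower_eq hħ (isOpen_halfPlane s v) l hb)

theorem differentiableOn_labelTower (hħ : ħ ≠ 0) (hp : IsBasisLabel s p) (v : Fin 3) (l : ℕ) :
    DifferentiableOn ℂ (labelTower ħ s p v l) (labelDomain s v) :=
  tower_differentiableOn _ _ (isOpen_labelDomain s v) (differentiableOn_labelFun hħ hp v) l

theorem norm_val_div_three_le (g : ZMod 3) : ‖(g.val : ℂ) / 3‖ ≤ 1 := by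
  rw [norm_div, Complex.norm_natCast, div_le_one (by norm_num)]
  have : (g.val : ℝ) ≤ 3 := by exact_mod_cast (ZMod.val_lt g).le
  simpa using this

theorem pow_mul_factorial_le {A B x : ℝ} (hA : 1 ≤ A) (hAB : A ≤ B) {l : ℕ}
    (h : x ≤ A ^ (l + 1) * l.factorial) : x ≤ B ^ (l + 1) * l.factorial :=
  h.trans (by gcongr)

/-- The growth holds on the whole continued domain, including points outside both chambers; a common
constant for the three variables is their maximum. -/
theorem exists_growthNear (hħ : ħ ≠ 0) (hp : IsBasisLabel s p) {b : Fin 3 → ℂ}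
    (hb : ∀ v, b v ∈ labelDomain s v) : ∃ A, GrowthNear (labelTower ħ s p) b A := by
  choose A hA hev using fun v => factorialGrowthAt_tower (ħ := ħ) (norm_val_div_three_le (-p.1.2))
    (isOpen_labelDomain s v) (differentiableOn_labelFun hħ hp v) (hb v)
  obtain ⟨B, hB⟩ := (Set.finite_range A).bddAbove
  have hAB : ∀ v, A v ≤ B := fun v => hB ⟨v, rfl⟩
  refine ⟨B, (hA 0).trans (hAB 0), ?_⟩
  filter_upwards [eventually_all.2 fun v => (continuous_apply v).continuousAt.eventually (hev v)]
    with b' hb' v l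
  exact pow_mul_factorial_le (hA v) (hAB v) (hb' v l)

theorem GrowthNear.eventually {Φ : Fin 3 → ℕ → ℂ → ℂ} {b : Fin 3 → ℂ} {A : ℝ}
    (h : GrowthNear Φ b A) : ∀ᶠ b' in 𝓝 b, GrowthNear Φ b' A :=
  h.2.eventually_nhds.mono fun _ hb => ⟨h.1, hb⟩

end Label

/-! ### The statements for small `q_a` -/

theorem ForSmallQa.mono {b₀ : Fin 3 → ℂ} {P Q : (Fin 3 → ℂ) × ℂ → Prop} (h : ForSmallQa b₀ P)
    (hPQ : ∀ t, P t → Q t) : ForSmallQa b₀ Q := by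
  obtain ⟨R, hR⟩ := h
  exact ⟨R, hR.mono fun b hb c hc => hPQ _ (hb c hc)⟩

theorem ForSmallQa.and {b₀ : Fin 3 → ℂ} {P Q : (Fin 3 → ℂ) × ℂ → Prop} (h : ForSmallQa b₀ P)
    (h' : ForSmallQa b₀ Q) : ForSmallQa b₀ fun t => P t ∧ Q t := by
  obtain ⟨R, hR⟩ := h
  obtain ⟨R', hR'⟩ := h'
  refine ⟨min R R', (hR.and hR').mono fun b hb c hc => ⟨hb.1 c ?_, hb.2 c ?_⟩⟩
  · exact hc.trans_le (min_le_left _ _)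
  · exact hc.trans_le (min_le_right _ _)

theorem ForSmallQa.forall {ι : Type*} [Finite ι] {b₀ : Fin 3 → ℂ}
    {P : ι → (Fin 3 → ℂ) × ℂ → Prop} (h : ∀ i, ForSmallQa b₀ (P i)) :
    ForSmallQa b₀ fun t => ∀ i, P i t := by
  choose R hR using h
  obtain ⟨B, hB⟩ := (Set.finite_range R).bddBelow
  exact ⟨B, (eventually_all.2 hR).mono fun b hb c hc i => hb i c (hc.trans_le (hB ⟨i, rfl⟩))⟩

/-! ### The continued I-function -/

/-- The sum of the `I`-function, continued in the variables `log q_v`. -/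
def iFun (ħ : ℂ) (s : Finset (Fin 3)) (t : (Fin 3 → ℂ) × ℂ) : StateSpace s := fun x =>
  towerSeries ħ (-x.1.1.2).val (labelTower ħ s x.1) t

theorem differentiableAt_iFun {ħ : ℂ} (hħ : ħ ≠ 0) {s : Finset (Fin 3)} {b₀ : Fin 3 → ℂ}
    (hb₀ : ∀ v, b₀ v ∈ labelDomain s v) :
    ForSmallQa b₀ fun t => DifferentiableAt ℂ (iFun ħ s) t := by
  refine (ForSmallQa.forall (P := fun x : BasisLabel s => fun t =>
    DifferentiableAt ℂ (fun t => iFun ħ s t x) t) fun x => ?_).mono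
      fun t ht => differentiableAt_pi.2 ht
  obtain ⟨A, hA⟩ := exists_growthNear hħ x.2 hb₀
  refine ⟨logRadius ħ A, ?_⟩
  have hd : ∀ᶠ b in 𝓝 b₀, ∀ v, b v ∈ labelDomain s v := eventually_all.2 fun v =>
    (continuous_apply v).continuousAt.eventually ((isOpen_labelDomain s v).mem_nhds (hb₀ v))
  filter_upwards [hA.eventually, hd] with b hb hbd c hc
  exact differentiableAt_towerSeries hħ _ (isOpen_labelDomain s)
    (differentiableOn_labelTower hħ x.2) hbd hb hc

/-- The degrees with `⟨-β⟩ = γ`. -/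
def labelDegree (s : Finset (Fin 3)) (γ : GroupElt) (p : ℕ × (Fin 3 → ℕ)) : (Fin 3 → ℤ) × ℤ :=
  (fun v => if v ∈ s then -((3 * p.2 v + (γ.1 v).val : ℕ) : ℤ) else 3 * (p.2 v : ℤ),
    (((-γ.2).val + 3 * p.1 : ℕ) : ℤ))

theorem effective_labelDegree {s : Finset (Fin 3)} {γ : GroupElt} (h : ∀ v ∈ s, γ.1 v ≠ 0)
    (p : ℕ × (Fin 3 → ℕ)) : Effective s (labelDegree s γ p) := by
  refine ⟨by simp only [labelDegree]; positivity, fun v => ?_⟩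
  simp only [labelDegree]
  split_ifs with hv
  · have := (ZMod.val_ne_zero _).2 (h v hv)
    omega
  · positivity

theorem three_eq_zero_zmod : (3 : ZMod 3) = 0 := rfl

theorem negMonodromy_labelDegree {s : Finset (Fin 3)} {γ : GroupElt} (h : ∀ v ∉ s, γ.1 v = 0)
    (p : ℕ × (Fin 3 → ℕ)) : negMonodromy (labelDegree s γ p) = γ := by
  refine Prod.ext (funext fun v => ?_) ?_
  · simp only [negMonodromy, labelDegree]
    split_ifs with hv
    · push_cast
      simp [three_eq_zero_zmod]
    · push_cast
      simp [three_eq_zero_zmod, h v hv]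
  · simp only [negMonodromy, labelDegree]
    push_cast
    simp [three_eq_zero_zmod]

theorem labelDegree_injective (s : Finset (Fin 3)) (γ : GroupElt) :
    Function.Injective (labelDegree s γ) := by
  rintro ⟨l, m⟩ ⟨l', m'⟩ h
  simp only [labelDegree, Prod.mk.injEq] at h
  refine Prod.ext (by have := h.2; omega) (funext fun v => ?_)
  have := congrFun h.1 v
  split_ifs at this <;> simp only <;> omega

/-- Division with remainder by $3$ in each coordinate. Together with injectivity this parametrizes
the effective degrees contributing to one sector by $\mathbb N\times\mathbb N^3$. -/
theorem exists_labelDegree_eq {s : Finset (Fin 3)} {β : (Fin 3 → ℤ) × ℤ} (h : Effective s β)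
    (hs : ∀ v ∉ s, (negMonodromy β).1 v = 0) : ∃ p, labelDegree s (negMonodromy β) p = β := by
  have hmod : ∀ n : ℤ, (((-n : ℤ) : ZMod 3).val : ℤ) = (-n) % 3 := fun n => ZMod.val_intCast _
  have hv : ∀ v, ∃ m : ℕ, (if v ∈ s then -((3 * m + ((negMonodromy β).1 v).val : ℕ) : ℤ)
      else 3 * (m : ℤ)) = β.1 v := by
    intro v
    have h1 := h.2 v
    by_cases hv : v ∈ s
    · simp only [if_pos hv] at h1 ⊢
      have h2 := hmod (β.1 v)
      refine ⟨((-β.1 v) / 3).toNat, ?_⟩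
      simp only [negMonodromy]
      omega
    · simp only [if_neg hv] at h1 ⊢
      have h2 := hmod (β.1 v)
      have h3 := hs v hv
      simp only [negMonodromy] at h3
      rw [h3, ZMod.val_zero] at h2
      exact ⟨(β.1 v / 3).toNat, by omega⟩
  choose m hm using hv
  have h2 := hmod (-β.2)
  have h0 := h.1
  refine ⟨((β.2 / 3).toNat, m), Prod.ext (funext hm) ?_⟩
  simp only [labelDegree, negMonodromy]
  rw [← Int.cast_neg]
  simp only [neg_neg] at h2 ⊢
  omega

theorem ITerm_labelDegree (ħ : ℂ) (s : Finset (Fin 3)) (t : (Fin 3 → ℂ) × ℂ) (x : BasisLabel s)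
    (p : ℕ × (Fin 3 → ℕ)) : ITerm s ħ t (labelDegree s x.1.1 p) x =
      aTerm ħ t.2 ((-x.1.1.2).val + 3 * p.1) * ∏ v, labelTerm ħ s x.1 v p.1 (p.2 v) (t.1 v) := by
  obtain ⟨-, h2, h3⟩ := (isBasisLabel_iff s x.1).1 x.2
  rw [ITerm, if_pos (negMonodromy_labelDegree h2 p).symm]
  congr 1
  · exact aFactor_natCast ħ t.2 _ _
  · refine Finset.prod_congr rfl fun v _ => ?_
    rw [varFactor_eq_degreeFactor]
    simp only [labelDegree, labelTerm]
    by_cases hv : v ∈ s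
    · have he : v ∉ x.1.2 := fun he => (h3 v he).1 hv
      simp only [if_pos hv, divisor, coeffAt, if_neg he, subTerm]
    · simp only [if_neg hv, divisor, supTerm]

/-- In one coordinate of the state space only degrees with $\langle-\beta\rangle=\gamma$ contribute,
and these are parametrized by `labelDegree`. Their sum is the jointly absolutely convergent tower
series, whose inner sums are the towers. -/
theorem hasIValue_iFun {ħ : ℂ} (hħ : ħ ≠ 0) {s : Finset (Fin 3)} {b₀ : Fin 3 → ℂ}
    (hb₀ : ∀ v, InChamber s v b₀) : ForSmallQa b₀ fun t => HasIValue s ħ t (iFun ħ s t) := by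
  have hb₀' : ∀ v, b₀ v ∈ halfPlane s v := fun v => (inChamber_iff s v b₀).1 (hb₀ v)
  refine (ForSmallQa.forall (P := fun x : BasisLabel s => fun t =>
    HasSum (fun β : {β : (Fin 3 → ℤ) × ℤ // Effective s β} => ITerm s ħ t β.1 x) (iFun ħ s t x))
      fun x => ?_).mono fun t ht => Pi.hasSum.2 ht
  obtain ⟨h1, h2, -⟩ := (isBasisLabel_iff s x.1).1 x.2
  choose A hA hev using fun v => (seriesFamily_labelTerm hħ x.2 v).norm_growth (hb₀' v)
  obtain ⟨B, hB⟩ := (Set.finite_range A).bddAbove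
  have hAB : ∀ v, A v ≤ B := fun v => hB ⟨v, rfl⟩
  have hd : ∀ᶠ b in 𝓝 b₀, ∀ v, b v ∈ halfPlane s v := eventually_all.2 fun v =>
    (continuous_apply v).continuousAt.eventually ((isOpen_halfPlane s v).mem_nhds (hb₀' v))
  refine ⟨logRadius ħ B, ?_⟩
  filter_upwards [eventually_all.2 fun v => (continuous_apply v).continuousAt.eventually (hev v), hd]
    with b hb hbd c hc
  have hne : ∀ v ∈ s, x.1.1.1 v ≠ 0 := fun v hv => by
    have := h1 v hv
    simp only [narrowExponents, Finset.mem_filter] at this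
    exact this.2.1
  have hinj : Function.Injective fun p : ℕ × (Fin 3 → ℕ) =>
      (⟨labelDegree s x.1.1 p, effective_labelDegree hne p⟩ :
        {β : (Fin 3 → ℤ) × ℤ // Effective s β}) :=
    fun p q h => labelDegree_injective s x.1.1 (congrArg Subtype.val h)
  refine (hinj.hasSum_iff fun β hβ => ?_).1 ?_
  · refine if_neg fun hγ => hβ ?_
    obtain ⟨p, hp⟩ := exists_labelDegree_eq β.2 fun v hv => by rw [← hγ]; exact h2 v hv
    exact ⟨p, Subtype.ext (by rw [← hγ] at hp; exact hp)⟩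
  · have key := hasSum_towerSeries hħ (-x.1.1.2).val
      (u := fun v l m => labelTerm ħ s x.1 v l m (b v)) ((hA 0).trans (hAB 0))
      (fun v l => (hb v l).1) (fun v l => pow_mul_factorial_le (hA v) (hAB v) (hb v l).2) hc
    have e : iFun ħ s (b, c) x = ∑' l, aTerm ħ c ((-x.1.1.2).val + 3 * l) *
        ∏ v, ∑' m, labelTerm ħ s x.1 v l m (b v) := by
      refine tsum_congr fun l => ?_
      congr 1
      exact Finset.prod_congr rfl fun v _ => labelTower_eq hħ x.2 v l (hbd v)
    rw [e]
    exact key.congr_fun fun p => ITerm_labelDegree ħ s (b, c) x p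

end

section

open Filter

/-! ### The wall-crossing map -/

section Wall

variable {s : Finset (Fin 3)} {v : Fin 3}

/-- The label of `insert v s` with `v`-exponent `j` and all other entries as in `x`. -/
def extLabel (hv : v ∉ s) (x : BasisLabel s) (j : {j // j ∈ narrowExponents x.1.1.2}) :
    BasisLabel (insert v s) :=
  ⟨((Function.update x.1.1.1 v j, x.1.1.2), x.1.2.erase v), by
    obtain ⟨h1, h2, h3⟩ := (isBasisLabel_iff s x.1).1 x.2
    refine (isBasisLabel_iff _ _).2 ⟨fun w hw => ?_, fun w hw => ?_, fun w hw => ?_⟩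
    · by_cases hwv : w = v
      · subst hwv
        simp
      · simpa [hwv] using h1 w ((Finset.mem_insert.1 hw).resolve_left hwv)
    · rw [Finset.mem_insert, not_or] at hw
      simpa [hw.1] using h2 w hw.2
    · rw [Finset.mem_erase] at hw
      refine ⟨fun h => ?_, (h3 w hw.2).2⟩
      exact (h3 w hw.2).1 ((Finset.mem_insert.1 h).resolve_left hw.1)⟩

/-- In the row of $x$ the nonzero entries can only occur at the extensions of $x$ by an exponent
narrow for $v$. Such an exponent replaces the zero $v$-exponent of $x$, and a possible $H_v$ is
dropped. -/
theorem wallMap_apply (hv : v ∉ s) (ħ : ℂ) (y : StateSpace (insert v s)) (x : BasisLabel s) :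
    wallMap s v ħ y x = ∑ j : {j // j ∈ narrowExponents x.1.1.2},
      coeffAt x.1.2 v (wallCoeff ħ j x.1.1.2) * y (extLabel hv x j) := by
  obtain ⟨h1, h2, h3⟩ := (isBasisLabel_iff s x.1).1 x.2
  rw [wallMap, Matrix.mulVecLin_apply, Matrix.mulVec, dotProduct]
  symm
  refine Fintype.sum_of_injective (extLabel hv x) (fun j j' h => ?_) _ _ (fun x' hx' => ?_)
    fun j => ?_
  · have := congrFun (congrArg (fun z : BasisLabel (insert v s) => z.1.1.1) h) v
    simp only [extLabel, Function.update_self] at this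
    exact Subtype.ext this
  · rw [Matrix.of_apply, if_neg, zero_mul]
    rintro ⟨hγ, he⟩
    obtain ⟨h1', -, -⟩ := (isBasisLabel_iff _ x'.1).1 x'.2
    have hga : x.1.1.2 = x'.1.1.2 := (Prod.ext_iff.1 hγ).2
    have hg : x.1.1.1 = Function.update x'.1.1.1 v 0 :=
      (Prod.ext_iff.1 hγ).1
    refine hx' ⟨⟨x'.1.1.1 v, hga ▸ h1' v (Finset.mem_insert_self v s)⟩, Subtype.ext ?_⟩
    refine Prod.ext (Prod.ext ?_ hga) he
    simp only [extLabel, hg, Function.update_idem, Function.update_eq_self]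
  · rw [Matrix.of_apply, if_pos]
    · simp [extLabel]
    · refine ⟨Prod.ext ?_ rfl, rfl⟩
      simp only [extLabel, Function.update_idem]
      rw [← h2 v hv, Function.update_eq_self]

/-- The label of `s` with `v`-exponent zero, and all other entries as in `x`. -/
def resLabel (hv : v ∉ s) (x : BasisLabel (insert v s)) (e : Finset (Fin 3))
    (he : e.erase v = x.1.2) (h0 : v ∈ e → x.1.1.2 = 0) : BasisLabel s :=
  ⟨((Function.update x.1.1.1 v 0, x.1.1.2), e), by
    obtain ⟨h1, h2, h3⟩ := (isBasisLabel_iff _ x.1).1 x.2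
    refine (isBasisLabel_iff _ _).2 ⟨fun w hw => ?_, fun w hw => ?_, fun w hw => ?_⟩
    · have hwv : w ≠ v := fun h => hv (h ▸ hw)
      simpa [hwv] using h1 w (Finset.mem_insert_of_mem hw)
    · by_cases hwv : w = v
      · subst hwv
        simp
      · simpa [hwv] using h2 w (by simp [hwv, hw])
    · by_cases hwv : w = v
      · subst hwv
        exact ⟨hv, h0 hw⟩
      · have := h3 w (he ▸ Finset.mem_erase.2 ⟨hwv, hw⟩)
        exact ⟨fun h => this.1 (Finset.mem_insert_of_mem h), this.2⟩⟩

theorem fst_wallCoeff_one_zero_ne_zero (ħ : ℂ) : (wallCoeff ħ 1 0).fst ≠ 0 := by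
  rw [wallCoeff, if_neg (by decide), one_smul, fracOf_one, fracOf_zero, fst_gammaCoeff,
    exp_four_thirds, show Int.fract (2 / 3 - 0 : ℚ) = 2 / 3 by norm_num]
  have h1 := neg_sixthRoot_sub_one_ne_zero
  have hG2 := Gamma_two_thirds_ne_zero
  have hπ := pi_ne_zero'
  push_cast
  rw [sub_zero, Complex.Gamma_one]
  simp [h1, hG2, hπ]

theorem fst_wallCoeff_two_zero_ne_zero {ħ : ℂ} (hħ : ħ ≠ 0) : (wallCoeff ħ 2 0).fst ≠ 0 := by
  rw [wallCoeff, if_pos (by decide), TrivSqZeroExt.fst_smul, fracOf_two, fracOf_zero,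
    fst_gammaCoeff, exp_two_thirds, show Int.fract (1 / 3 - 0 : ℚ) = 1 / 3 by norm_num]
  have h1 := sixthRoot_sub_two_ne_zero
  have hG1 := Gamma_third_ne_zero
  have hπ := pi_ne_zero'
  push_cast
  rw [sub_zero, Complex.Gamma_one, smul_eq_mul]
  refine mul_ne_zero hħ (mul_ne_zero (mul_ne_zero (mul_ne_zero ?_ (inv_ne_zero h1)) one_ne_zero)
    (inv_ne_zero (mul_ne_zero hG1 (pow_ne_zero 2 hG1))))
  simp [hπ]

/-- For $g_a=0$ there are two unknowns, and the ratios $C_1/C_0$ for $j=1,2$ differ by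
$2\pi/(\sqrt3\,\hbar)$, so the determinant is nonzero. Otherwise there is one unknown with nonzero
coefficient. -/
theorem eq_zero_of_wallCoeff {ħ : ℂ} (hħ : ħ ≠ 0) (ga : ZMod 3) (Y : ZMod 3 → ℂ)
    (h1 : ∑ j ∈ narrowExponents ga, (wallCoeff ħ j ga).fst * Y j = 0)
    (h2 : ga = 0 → ∑ j ∈ narrowExponents ga, (wallCoeff ħ j ga).snd * Y j = 0) :
    ∀ j ∈ narrowExponents ga, Y j = 0 := by
  rcases zmod_three_cases ga with rfl | rfl | rfl
  · have h2 := h2 rfl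
    rw [narrowExponents_zero, Finset.sum_pair (by decide)] at h1 h2
    rw [snd_wallCoeff_one_zero, snd_wallCoeff_two_zero] at h2
    have hπ := pi_ne_zero'
    have h3 := sqrt_three_ne_zero
    have e2 : (wallCoeff ħ 2 0).fst * Y 2 * (2 * (Real.pi / √3) * ħ⁻¹) = 0 := by
      linear_combination h2 - ħ⁻¹ * (Real.pi * Complex.I - Real.pi / √3) * h1
    have hY2 : Y 2 = 0 := by
      simpa [fst_wallCoeff_two_zero_ne_zero hħ, hπ, h3, hħ] using e2
    rw [hY2, mul_zero, add_zero] at h1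
    have hY1 := (mul_eq_zero.1 h1).resolve_left (fst_wallCoeff_one_zero_ne_zero ħ)
    intro j hj
    rw [narrowExponents_zero, Finset.mem_insert, Finset.mem_singleton] at hj
    rcases hj with rfl | rfl <;> assumption
  · rw [narrowExponents_one, Finset.sum_singleton] at h1
    have hc := left_ne_zero_of_mul (ne_of_eq_of_ne (fst_wallCoeff_two_one ħ) one_ne_zero)
    intro j hj
    rw [narrowExponents_one, Finset.mem_singleton] at hj
    rw [hj]
    exact (mul_eq_zero.1 h1).resolve_left hc
  · rw [narrowExponents_two, Finset.sum_singleton] at h1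
    have hc := left_ne_zero_of_mul (ne_of_eq_of_ne (fst_wallCoeff_one_two ħ) one_ne_zero)
    intro j hj
    rw [narrowExponents_two, Finset.mem_singleton] at hj
    rw [hj]
    exact (mul_eq_zero.1 h1).resolve_left hc

/-- The map is block diagonal: with all data except the $v$-exponent fixed, the row without $H_v$
and, if $g_a=0$, the row with $H_v$ form the small linear system already treated. -/
theorem wallMap_injective {ħ : ℂ} (hħ : ħ ≠ 0) (hv : v ∉ s) :
    Function.Injective (wallMap s v ħ) := by
  rw [← LinearMap.ker_eq_bot, LinearMap.ker_eq_bot']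
  intro y hy
  funext x
  obtain ⟨h1, -, h3⟩ := (isBasisLabel_iff _ x.1).1 x.2
  have hve : v ∉ x.1.2 := fun h => (h3 v h).1 (Finset.mem_insert_self v s)
  have hx := Finset.erase_eq_of_notMem hve
  set x₀ := resLabel hv x x.1.2 hx (fun h => absurd h hve) with hx₀
  set Y : ZMod 3 → ℂ := fun j =>
    if h : j ∈ narrowExponents x.1.1.2 then y (extLabel hv x₀ ⟨j, h⟩) else 0 with hY
  have hsum : ∀ c : ZMod 3 → ℂ, ∑ j ∈ narrowExponents x.1.1.2, c j * Y j
      = ∑ j : {j // j ∈ narrowExponents x.1.1.2}, c j * y (extLabel hv x₀ j) := by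
    intro c
    rw [← Finset.sum_coe_sort]
    refine Finset.sum_congr rfl fun j _ => ?_
    simp only [hY, dif_pos j.2]
    rfl
  have hres := eq_zero_of_wallCoeff hħ x.1.1.2 Y ?_ ?_ (x.1.1.1 v) (h1 v (Finset.mem_insert_self v s))
  · simp only [hY, dif_pos (h1 v (Finset.mem_insert_self v s))] at hres
    have hlab : extLabel hv x₀ ⟨x.1.1.1 v, h1 v (Finset.mem_insert_self v s)⟩ = x := by
      refine Subtype.ext (Prod.ext (Prod.ext ?_ rfl) hx)
      simp [extLabel, hx₀, resLabel]
    exact (congrArg y hlab).symm.trans hres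
  · have h := congrFun hy x₀
    rw [wallMap_apply hv] at h
    rw [hsum]
    refine Eq.trans (Finset.sum_congr rfl fun j _ => ?_) h
    have : v ∉ x₀.1.2 := hve
    rw [coeffAt, if_neg this]
    rfl
  · intro h0
    set x₁ := resLabel hv x (insert v x.1.2) (Finset.erase_insert hve) (fun _ => h0) with hx₁
    have h := congrFun hy x₁
    rw [wallMap_apply hv] at h
    rw [hsum]
    refine Eq.trans (Finset.sum_congr rfl fun j _ => ?_) h
    have : v ∈ x₁.1.2 := Finset.mem_insert_self _ _
    rw [coeffAt, if_pos this]
    refine congrArg₂ _ rfl (congrArg y (Subtype.ext (Prod.ext rfl ?_)))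
    change x.1.2.erase v = (insert v x.1.2).erase v
    rw [Finset.erase_insert hve, hx]

/-- The exponent of the label of `insert v s` which corresponds to a label of `s`. -/
def pickExponent (ga : ZMod 3) (P : Prop) [Decidable P] : ZMod 3 :=
  if ga = 0 then if P then 2 else 1 else -ga

theorem pickExponent_mem (ga : ZMod 3) (P : Prop) [Decidable P] :
    pickExponent ga P ∈ narrowExponents ga := by
  by_cases h : P <;> simp only [pickExponent, h, if_true, if_false] <;> revert ga <;> decide

/-- For $g_a=0$ the two choices $1,H_v$ are matched with the two narrow exponents $1,2$; for
$g_a\ne0$ there is one choice on either side. With injectivity of the wall map this yields equal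
dimensions. -/
theorem card_basisLabel_le (hv : v ∉ s) :
    Fintype.card (BasisLabel s) ≤ Fintype.card (BasisLabel (insert v s)) := by
  refine Fintype.card_le_of_injective (fun x =>
    extLabel hv x ⟨pickExponent x.1.1.2 (v ∈ x.1.2), pickExponent_mem _ _⟩) fun x x' h => ?_
  have hga : x.1.1.2 = x'.1.1.2 :=
    congrArg (fun z : BasisLabel (insert v s) => z.1.1.2) h
  have hg := congrArg (fun z : BasisLabel (insert v s) => z.1.1.1) h
  have he : x.1.2.erase v = x'.1.2.erase v :=
    congrArg (fun z : BasisLabel (insert v s) => z.1.2) h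
  simp only [extLabel] at hg
  obtain ⟨-, h2, h3⟩ := (isBasisLabel_iff _ x.1).1 x.2
  obtain ⟨-, h2', h3'⟩ := (isBasisLabel_iff _ x'.1).1 x'.2
  have hmem : v ∈ x.1.2 ↔ v ∈ x'.1.2 := by
    have hgv := congrFun hg v
    simp only [Function.update_self, pickExponent, ← hga] at hgv
    by_cases h0 : x.1.1.2 = 0
    · simp only [h0, if_true] at hgv
      by_cases hx : v ∈ x.1.2 <;> by_cases hx' : v ∈ x'.1.2 <;> simp only [hx, hx', if_true, if_false] at hgv ⊢
      · exact absurd hgv (by decide)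
      · exact absurd hgv (by decide)
    · exact ⟨fun h => absurd (h3 v h).2 h0, fun h => absurd (hga.trans (h3' v h).2) h0⟩
  refine Subtype.ext (Prod.ext (Prod.ext (funext fun w => ?_) hga) (Finset.ext fun w => ?_))
  · by_cases hwv : w = v
    · subst hwv
      rw [h2 w hv, h2' w hv]
    · simpa [hwv] using congrFun hg w
  · by_cases hwv : w = v
    · subst hwv
      exact hmem
    · have := Finset.ext_iff.1 he w
      simpa [hwv] using this

theorem wallMap_bijective {ħ : ℂ} (hħ : ħ ≠ 0) (hv : v ∉ s) :
    Function.Bijective (wallMap s v ħ) := by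
  have hi := wallMap_injective hħ hv
  refine ⟨hi, (LinearMap.injective_iff_surjective_of_finrank_eq_finrank ?_).1 hi⟩
  refine le_antisymm (LinearMap.finrank_le_finrank_of_injective hi) ?_
  rw [Module.finrank_fintype_fun_eq_card, Module.finrank_fintype_fun_eq_card]
  exact card_basisLabel_le hv

/-! ### The relation between the I-functions -/

theorem labelFun_extLabel_of_ne (ħ : ℂ) (hv : v ∉ s) (x : BasisLabel s)
    (j : {j // j ∈ narrowExponents x.1.1.2}) {w : Fin 3} (hw : w ≠ v) :
    labelFun ħ (insert v s) (extLabel hv x j).1 w = labelFun ħ s x.1 w := by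
  have h : (w ∈ x.1.2.erase v) = (w ∈ x.1.2) := by simp [hw]
  have hs : (w ∈ insert v s) = (w ∈ s) := by simp [hw]
  funext b
  simp only [labelFun, extLabel, hs, Function.update_of_ne hw]
  split_ifs with hws
  · rfl
  · simp only [supFun, wallFun, coeffAt, h]

theorem labelFun_extLabel_self (ħ : ℂ) (hv : v ∉ s) (x : BasisLabel s)
    (j : {j // j ∈ narrowExponents x.1.1.2}) :
    labelFun ħ (insert v s) (extLabel hv x j).1 v = subFun ħ j.1.val (-x.1.1.2).val := by
  simp [labelFun, extLabel]

/-- The connection formula at $l=0$ propagates to all $l$ because the operators of the tower are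
linear and depend only on $g_a$, which is common to both phases. -/
theorem labelTower_eq_sum {ħ : ℂ} (hħ : ħ ≠ 0) (hv : v ∉ s) (x : BasisLabel s) (l : ℕ) :
    Set.EqOn (labelTower ħ s x.1 v l) (fun b => ∑ j : {j // j ∈ narrowExponents x.1.1.2},
      coeffAt x.1.2 v (wallCoeff ħ j x.1.1.2)
        * labelTower ħ (insert v s) (extLabel hv x j).1 v l b) strip := by
  obtain ⟨-, -, h3⟩ := (isBasisLabel_iff _ x.1).1 x.2
  intro b hb
  have h1 : Set.EqOn (labelFun ħ s x.1 v) (fun b => ∑ j : {j // j ∈ narrowExponents x.1.1.2},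
      coeffAt x.1.2 v (wallCoeff ħ j x.1.1.2)
        * labelFun ħ (insert v s) (extLabel hv x j).1 v b) strip := by
    intro b hb
    simp only [labelFun_extLabel_self]
    rw [labelFun, if_neg hv, supFun_of_mem_strip hħ _ _ _ (fun h => (h3 v h).2) hb, wallFun]
    exact (Finset.sum_coe_sort (narrowExponents x.1.1.2) fun j =>
      coeffAt x.1.2 v (wallCoeff ħ j x.1.1.2) * subFun ħ j.val (-x.1.1.2).val b).symm
  rw [labelTower, tower_congr _ _ isOpen_strip h1 l hb]
  refine tower_sum Finset.univ ħ _ _ isOpen_strip (fun j _ => ?_) l hb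
  exact (differentiableOn_labelFun hħ (extLabel hv x j).2 v).mono (strip_subset_labelDomain _ _)

/-- The factors of the other variables and of $a$ are the same for all the labels involved. So the
one-variable relation can be multiplied by them and summed over $l$. -/
theorem iFun_apply_eq_sum {ħ : ℂ} (hħ : ħ ≠ 0) (hv : v ∉ s) (x : BasisLabel s)
    {t : (Fin 3 → ℂ) × ℂ} (ht : t.1 v ∈ strip)
    (hs : ∀ x' : BasisLabel (insert v s), Summable fun l =>
      aTerm ħ t.2 ((-x'.1.1.2).val + 3 * l) * ∏ w, labelTower ħ (insert v s) x'.1 w l (t.1 w)) :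
    iFun ħ s t x = ∑ j : {j // j ∈ narrowExponents x.1.1.2},
      coeffAt x.1.2 v (wallCoeff ħ j x.1.1.2) * iFun ħ (insert v s) t (extLabel hv x j) := by
  have h : ∀ j : {j // j ∈ narrowExponents x.1.1.2}, HasSum (fun l =>
      coeffAt x.1.2 v (wallCoeff ħ j x.1.1.2) * (aTerm ħ t.2 ((-x.1.1.2).val + 3 * l)
        * ∏ w, labelTower ħ (insert v s) (extLabel hv x j).1 w l (t.1 w)))
      (coeffAt x.1.2 v (wallCoeff ħ j x.1.1.2) * iFun ħ (insert v s) t (extLabel hv x j)) :=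
    fun j => (hs (extLabel hv x j)).hasSum.mul_left _
  rw [← (hasSum_sum fun j _ => h j).tsum_eq]
  refine tsum_congr fun l => ?_
  have hne : ∀ j : {j // j ∈ narrowExponents x.1.1.2},
      ∏ w ∈ Finset.univ.erase v, labelTower ħ (insert v s) (extLabel hv x j).1 w l (t.1 w)
        = ∏ w ∈ Finset.univ.erase v, labelTower ħ s x.1 w l (t.1 w) := fun j =>
    Finset.prod_congr rfl fun w hw => by
      rw [labelTower, labelTower, labelFun_extLabel_of_ne ħ hv x j (Finset.ne_of_mem_erase hw)]
      rfl
  rw [← Finset.mul_prod_erase _ _ (Finset.mem_univ v), labelTower_eq_sum hħ hv x l ht]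
  simp only [Finset.sum_mul, Finset.mul_sum]
  refine Finset.sum_congr rfl fun j _ => ?_
  rw [← Finset.mul_prod_erase _ _ (Finset.mem_univ v), hne]
  ring

theorem labelDomain_insert_of_ne {w : Fin 3} (hw : w ≠ v) :
    labelDomain (insert v s) w = labelDomain s w := by
  simp [labelDomain, hw]

/-- The other variables may lie anywhere in their continued domains, not only in the chamber. This
is what allows several wall-crossings to be composed at one point. -/
theorem iFun_eq_wallMap {ħ : ℂ} (hħ : ħ ≠ 0) (hv : v ∉ s) {b₀ : Fin 3 → ℂ} (hb₀v : b₀ v ∈ strip)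
    (hb₀ : ∀ w, w ≠ v → b₀ w ∈ labelDomain s w) :
    ForSmallQa b₀ fun t => iFun ħ s t = wallMap s v ħ (iFun ħ (insert v s) t) := by
  have hb₀' : ∀ w, b₀ w ∈ labelDomain (insert v s) w := fun w => by
    by_cases hw : w = v
    · subst hw
      exact strip_subset_labelDomain _ _ hb₀v
    · rw [labelDomain_insert_of_ne hw]
      exact hb₀ w hw
  have hS : ForSmallQa b₀ fun t => t.1 v ∈ strip :=
    ⟨0, ((continuous_apply v).continuousAt.eventually (isOpen_strip.mem_nhds hb₀v)).mono
      fun b hb _ _ => hb⟩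
  refine (hS.and (ForSmallQa.forall (P := fun x' : BasisLabel (insert v s) => fun t =>
    Summable fun l => aTerm ħ t.2 ((-x'.1.1.2).val + 3 * l)
      * ∏ w, labelTower ħ (insert v s) x'.1 w l (t.1 w)) fun x' => ?_)).mono fun t ht => ?_
  · obtain ⟨A, hA⟩ := exists_growthNear hħ x'.2 hb₀'
    exact ⟨logRadius ħ A, hA.eventually.mono fun b hb c hc => hb.summable hħ _ hc⟩
  · funext x
    rw [wallMap_apply hv, iFun_apply_eq_sum hħ hv x ht.1 ht.2]

end Wall

end

section

open Filter

/-! ### The domain of the continuation -/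

/-- The region `Re c < g b` over an open set. -/
theorem exists_isOpen_isPreconnected_forSmallQa {K : Set (Fin 3 → ℂ)} (hK : IsOpen K)
    (hKc : IsPreconnected K) {P : (Fin 3 → ℂ) × ℂ → Prop} (hP : ∀ b₀ ∈ K, ForSmallQa b₀ P) :
    ∃ Ω : Set ((Fin 3 → ℂ) × ℂ), IsOpen Ω ∧ IsPreconnected Ω ∧ (∀ t ∈ Ω, P t) ∧
      ∀ b₀ ∈ K, ForSmallQa b₀ fun t => t ∈ Ω := by
  -- The admissible bounds $R$ at a point form a downward closed set of reals, hence a convex one,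
  -- so a partition of unity glues local constant choices to a continuous function $g$.
  have hconv : ∀ b : K, Convex ℝ {R : ℝ | ∀ c : ℂ, c.re < R → P (b, c)} := by
    intro b R hR R' hR' a a' ha ha' haa c hc
    rcases le_total R R' with h | h
    · have h1 := mul_le_mul_of_nonneg_left h ha
      have h2 : R' = a * R' + a' * R' := by rw [← add_mul, haa, one_mul]
      exact hR' c (hc.trans_le (by simp only [smul_eq_mul]; linarith))
    · have h1 := mul_le_mul_of_nonneg_left h ha'
      have h2 : R = a * R + a' * R := by rw [← add_mul, haa, one_mul]
      exact hR c (hc.trans_le (by simp only [smul_eq_mul]; linarith))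
  have hloc : ∀ b : K, ∃ R : ℝ, ∀ᶠ b' : K in 𝓝 b, R ∈ {R : ℝ |
      ∀ c : ℂ, c.re < R → P (b', c)} := by
    intro b
    obtain ⟨R, hR⟩ := hP b b.2
    exact ⟨R, continuous_subtype_val.continuousAt.eventually hR⟩
  obtain ⟨g, hg⟩ := exists_continuous_forall_mem_convex_of_local_const hconv hloc
  refine ⟨(fun p : K × ℂ => ((p.1 : Fin 3 → ℂ), p.2)) '' {p | p.2.re < g p.1}, ?_, ?_, ?_, ?_⟩
  · refine (hK.isOpenEmbedding_subtypeVal.prodMap Topology.IsOpenEmbedding.id).isOpenMap _ ?_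
    exact isOpen_lt (Complex.continuous_re.comp continuous_snd)
      (g.continuous.comp continuous_fst)
  · have : PreconnectedSpace K := isPreconnected_iff_preconnectedSpace.1 hKc
    have hpre : IsPreconnected ((Set.univ : Set K) ×ˢ {c : ℂ | c.re < 0}) :=
      isPreconnected_univ.prod (convex_halfSpace_re_lt 0).isPreconnected
    -- The shear $c\mapsto c+g(b)$ identifies the region with the product of the connected base and
    -- a half plane.
    have himg : {p : K × ℂ | p.2.re < g p.1}
        = (fun p : K × ℂ => (p.1, p.2 + (g p.1 : ℂ))) '' (Set.univ ×ˢ {c : ℂ | c.re < 0}) := by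
      ext ⟨b, c⟩
      constructor
      · intro h
        exact ⟨(b, c - g b), ⟨trivial, by simpa using h⟩, by simp⟩
      · rintro ⟨⟨b', c'⟩, ⟨-, h⟩, heq⟩
        simp only [Prod.mk.injEq] at heq
        obtain ⟨rfl, rfl⟩ := heq
        simpa using h
    rw [himg]
    refine (hpre.image _ (Continuous.continuousOn ?_)).image _ (Continuous.continuousOn ?_)
    · exact continuous_fst.prodMk (continuous_snd.add
        (Complex.continuous_ofReal.comp (g.continuous.comp continuous_fst)))
    · exact (continuous_subtype_val.comp continuous_fst).prodMk continuous_snd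
  · rintro _ ⟨⟨b, c⟩, h, rfl⟩
    exact hg b c h
  · intro b₀ hb₀
    -- The margin $1$ leaves room for the variation of $g$ near the point.
    refine ⟨g ⟨b₀, hb₀⟩ - 1, ?_⟩
    have h1 : ∀ᶠ b : K in 𝓝 ⟨b₀, hb₀⟩, g ⟨b₀, hb₀⟩ - 1 < g b :=
      g.continuous.continuousAt.eventually (lt_mem_nhds (by linarith))
    rw [nhds_subtype_eq_comap, eventually_comap] at h1
    filter_upwards [h1, hK.mem_nhds hb₀] with b hb hbK c hc
    exact ⟨(⟨b, hbK⟩, c), hc.trans (hb ⟨b, hbK⟩ rfl), rfl⟩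

theorem isOpen_corridor (s s' : Finset (Fin 3)) : IsOpen (corridor s s') := by
  have : corridor s s' = ⋂ v, (fun b : Fin 3 → ℂ => b v) ⁻¹'
      (if v ∈ s' \ s then strip else halfPlane s v) := by
    ext b
    simp only [corridor, Set.mem_ofPred_eq, Set.mem_iInter, Set.mem_preimage]
    refine forall_congr' fun v => ?_
    split_ifs
    · rfl
    · exact inChamber_iff s v b
  rw [this]
  refine isOpen_iInter_of_finite fun v => IsOpen.preimage (continuous_apply v) ?_
  split_ifs
  exacts [isOpen_strip, isOpen_halfPlane s v]

theorem isPreconnected_corridor (s s' : Finset (Fin 3)) : IsPreconnected (corridor s s') := by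
  have : corridor s s' = Set.univ.pi fun v => if v ∈ s' \ s then strip else halfPlane s v := by
    ext b
    simp only [corridor, Set.mem_ofPred_eq, Set.mem_univ_pi]
    refine forall_congr' fun v => ?_
    split_ifs
    · rfl
    · exact inChamber_iff s v b
  rw [this]
  refine isPreconnected_univ_pi fun v => ?_
  split_ifs
  · exact convex_strip.isPreconnected
  · unfold halfPlane
    split_ifs
    · exact (convex_halfSpace_re_gt _).isPreconnected
    · exact (convex_halfSpace_re_lt _).isPreconnected

theorem mem_strip_of_mem_corridor {s s' : Finset (Fin 3)} {b : Fin 3 → ℂ} (hb : b ∈ corridor s s')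
    {v : Fin 3} (hv : v ∈ s' \ s) : b v ∈ strip := by
  have := hb v
  rwa [if_pos hv] at this

theorem mem_labelDomain_of_mem_corridor {s s' : Finset (Fin 3)} {b : Fin 3 → ℂ}
    (hb : b ∈ corridor s s') (v : Fin 3) : b v ∈ labelDomain s v := by
  by_cases hv : v ∈ s' \ s
  · exact strip_subset_labelDomain _ _ (mem_strip_of_mem_corridor hb hv)
  · have := hb v
    rw [if_neg hv] at this
    exact halfPlane_subset_labelDomain _ _ ((inChamber_iff s v b).1 this)

/-- The continued function `iFun` already sums the series in the chamber of each phase, so only its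
pointwise transformation under $U$ over the corridor has to be known. -/
theorem continuesTo_of_forSmallQa {ħ : ℂ} (hħ : ħ ≠ 0) {s s' : Finset (Fin 3)}
    (U : StateSpace s ≃ₗ[ℂ] StateSpace s')
    (hU : ∀ b₀ ∈ corridor s s', ForSmallQa b₀ fun t => U (iFun ħ s t) = iFun ħ s' t) :
    ContinuesTo s s' ħ U := by
  obtain ⟨Ω, hΩ, hΩc, hd, hmem⟩ := exists_isOpen_isPreconnected_forSmallQa
    (isOpen_corridor s s') (isPreconnected_corridor s s')
    (P := fun t => DifferentiableAt ℂ (iFun ħ s) t)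
    fun b₀ hb₀ => differentiableAt_iFun hħ (mem_labelDomain_of_mem_corridor hb₀)
  refine ⟨Ω, iFun ħ s, hΩ, hΩc, fun t ht => (hd t ht).differentiableWithinAt, hmem,
    fun b₀ _ h => hasIValue_iFun hħ h, fun b₀ hb₀ h => ?_⟩
  exact ((hU b₀ hb₀).and (hasIValue_iFun hħ h)).mono fun t ht => ht.1.symm ▸ ht.2

/-- The inverse of the wall-crossing map. -/
def wallEquiv {ħ : ℂ} (hħ : ħ ≠ 0) (s : Finset (Fin 3)) (v : Fin 3) (hv : v ∉ s) :
    StateSpace s ≃ₗ[ℂ] StateSpace (insert v s) :=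
  (LinearEquiv.ofBijective (wallMap s v ħ) (wallMap_bijective hħ hv)).symm

theorem wallEquiv_symm {ħ : ℂ} (hħ : ħ ≠ 0) (s : Finset (Fin 3)) (v : Fin 3) (hv : v ∉ s) :
    ((wallEquiv hħ s v hv).symm : StateSpace (insert v s) →ₗ[ℂ] StateSpace s)
      = wallMap s v ħ := by
  rw [wallEquiv, LinearEquiv.symm_symm]
  exact LinearMap.ext fun y => LinearEquiv.ofBijective_apply _ y

theorem wallEquiv_wallMap {ħ : ℂ} (hħ : ħ ≠ 0) (s : Finset (Fin 3)) (v : Fin 3) (hv : v ∉ s)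
    (y : StateSpace (insert v s)) : wallEquiv hħ s v hv (wallMap s v ħ y) = y :=
  LinearEquiv.ofBijective_symm_apply_apply _ y

theorem wallEquiv_iFun {ħ : ℂ} (hħ : ħ ≠ 0) {s : Finset (Fin 3)} {v : Fin 3} (hv : v ∉ s)
    {b₀ : Fin 3 → ℂ} (hb₀v : b₀ v ∈ strip) (hb₀ : ∀ w, w ≠ v → b₀ w ∈ labelDomain s w) :
    ForSmallQa b₀ fun t => wallEquiv hħ s v hv (iFun ħ s t) = iFun ħ (insert v s) t :=
  (iFun_eq_wallMap hħ hv hb₀v hb₀).mono fun t ht => by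
    rw [ht, wallEquiv_wallMap]

end

end LGCY

end

/-! ### The single wall-crossings and their composite -/

theorem theorem9p1 (hbar : ℂ) (hbar_ne : hbar ≠ 0) :
    ∃ U : ∀ (s : Finset (Fin 3)) (v : Fin 3), v ∉ s →
        (LGCY.StateSpace s ≃ₗ[ℂ] LGCY.StateSpace (insert v s)),
      (∀ (s : Finset (Fin 3)) (v : Fin 3) (hv : v ∉ s),
        ((U s v hv).symm : LGCY.StateSpace (insert v s) →ₗ[ℂ] LGCY.StateSpace s)
            = LGCY.wallMap s v hbar ∧
          LGCY.ContinuesTo s (insert v s) hbar (U s v hv)) ∧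
      LGCY.ContinuesTo ∅ (insert 0 (insert 1 (insert 2 ∅))) hbar
        (((U ∅ 2 (by decide)).trans (U (insert 2 ∅) 1 (by decide))).trans
          (U (insert 1 (insert 2 ∅)) 0 (by decide))) := by
  refine ⟨LGCY.wallEquiv hbar_ne, fun s v hv =>
    ⟨LGCY.wallEquiv_symm hbar_ne s v hv, ?_⟩, ?_⟩
  · refine LGCY.continuesTo_of_forSmallQa hbar_ne _ fun b₀ hb₀ => ?_
    exact LGCY.wallEquiv_iFun hbar_ne hv (LGCY.mem_strip_of_mem_corridor hb₀ (by simp [hv]))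
      fun w _ => LGCY.mem_labelDomain_of_mem_corridor hb₀ w
  · refine LGCY.continuesTo_of_forSmallQa hbar_ne _ fun b₀ hb₀ => ?_
    have hstrip : ∀ v, b₀ v ∈ LGCY.strip := fun v =>
      LGCY.mem_strip_of_mem_corridor hb₀ (by revert v; decide)
    -- In the full corridor all three coordinates lie in the strip, which is contained in the domain
    -- of every phase. So the three identities hold at the same point and no continuation through
    -- intermediate chambers is needed.
    have hwall : ∀ (s : Finset (Fin 3)) (v : Fin 3) (hv : v ∉ s), LGCY.ForSmallQa b₀ fun t =>
        LGCY.wallEquiv hbar_ne s v hv (LGCY.iFun hbar s t) = LGCY.iFun hbar (insert v s) t :=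
      fun s v hv => LGCY.wallEquiv_iFun hbar_ne hv (hstrip v)
        fun w _ => LGCY.strip_subset_labelDomain _ _ (hstrip w)
    refine ((hwall ∅ 2 (by decide)).and ((hwall (insert 2 ∅) 1 (by decide)).and
      (hwall (insert 1 (insert 2 ∅)) 0 (by decide)))).mono fun t ht => ?_
    rw [LinearEquiv.trans_apply, LinearEquiv.trans_apply, ht.1, ht.2.1, ht.2.2]
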